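/- Let $K$ be an algebraically closed field of characteristic zero. A smooth $\mathbb G_a^2$-surface is a smooth projective surface over $K$ with an effective action of $\mathbb G_a^2$ that has an open orbit. An equivariant isomorphism of two such surfaces is an isomorphism $\tau$ of surfaces together with an automorphism $\psi$ of the algebraic group $\mathbb G_a^2$ such that $\tau(g\cdot p)=\psi(g)\cdot\tau(p)$. For $r\ge 1$ let $\mathbb F_r$ be the Hirzebruch surface covered by four affine planes with coordinates $(x,y)$, $(x/y^r,1/y)$, $(y^r/x,1/y)$, $(1/x,y)$. It carries the $\mathbb G_a^2$-action $\varphi_r\colon (a,b)\cdot(x,y)=(x+a,y+b)$ with open orbit the $(x,y)$-plane, whose complement consists of the section $s=\{1/x=0\}$ with $s^2=-r$ and the fiber $f=\{1/y=0\}$. Points of $f\setminus s$ and points infinitely near to them are denoted by coordinate sequences $[a_1,\dots,a_k]$ with $a_1\in K$ and $a_2,\dots,a_k\in K\cup\{\infty\}$, as follows: $[q]$ is the point of $f$ with $x/y^r=q$, with local coordinates $(u,v)=(x/y^r-q,1/y)$; if $p=[a_1,\dots,a_k]$ has local coordinates $(u,v)$, then $[a_1,\dots,a_k,q]$ is the point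 with coordinate $u/v=q$ on the exceptional curve of the blowup of $p$, with local coordinates $(u/v-q,v)$ if $q\ne\infty$ and $(u,v/u)$ if $q=\infty$. We write $0_{(k)}$ for $0,\dots,0$ ($k$ times). For such points $p_1,\dots,p_m$, $Bl(\mathbb F_r,p_1,\dots,p_m)$ denotes the blowup of $\mathbb F_r$ at these points (for $p_j=[a_1,\dots,a_k]$ one blows up $[a_1]$, $[a_1,a_2]$, ..., $[a_1,\dots,a_k]$ in turn) with the action induced by $\varphi_r$; in all cases below the blown up points are fixed, so that the action lifts. **Proposition.** Let $X$ be a smooth $\mathbb G_a^2$-surface that is equivariantly isomorphic to a surface of one of the following forms: * (A) $Bl(\mathbb F_r,[0_{(k)},q_1],[q_2])$, where $r\ge 1$, $0\le k\le r-1$, $q_1,q_2\in K$, $q_1\neq 0$ if $k<r-1$, $q_2\ne q_1$ if $k=0$, and $q_2\neq 0$ if $k>0$; * (C) $Bl(\mathbb F_r,[0,\infty,w,q])$, where $r>1$, $w\in K\setminus\{0\}$, $q\in K$; * (E) $Bl(\mathbb F_r,[q,\infty,w])$, where $r\ge 1$ and $q,w\in K\setminus\{0\}$. Then $X$ is equivariantly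 isomorphic to exactly one of the following surfaces, where in case (ii) $r$ is unique, and $q$ is unique if $q=0$ and unique exactly up to replacing $q$ by $q^{-1}$ if $q\neq0$: 1. (i) $Bl(\mathbb F_1,[0],[1])$; 2. (ii) $Bl(\mathbb F_r,[1],[q])$, where $r\ge 2$ and $q\in K\setminus\{1\}$; 3. (iii) $Bl(\mathbb F_r,[0_{(k)},1],[1])$, where $r\ge2$ and $1\le k\le r-1$; 4. (iv) $Bl(\mathbb F_r,[0,\infty,1,0])$, where $r\ge 2$; 5. (v) $Bl(\mathbb F_r,[0,\infty,1,1])$, where $r\ge 3$; 6. (vi) $Bl(\mathbb F_r,[1,\infty,1])$, where $r\ge 2$. Moreover, $Bl(\mathbb F_1,[1,\infty,1])$ is equivariantly isomorphic to the surface $Bl(\mathbb F_2,[0,1],[1])$ of (iii). -/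

import Mathlib

universe u

noncomputable section

namespace GaSurfaces

open AlgebraicGeometry CategoryTheory
open scoped OnePoint

/-! ### Additive actions on surfaces -/

attribute [local instance] MvPolynomial.gradedAlgebra

/-- The constant functions on a `K`-scheme `φ : T ⟶ Spec K`. -/
def consts {K : Type u} [Field K] {T : Scheme.{u}} (φ : T ⟶ Spec (.of K)) : K →+* Γ(T, ⊤) :=
  ((Scheme.ΓSpecIso (.of K)).inv ≫ φ.appTop).hom

/-- The projective space of dimension `n` over `K`. -/
abbrev ProjSpace (K : Type u) [Field K] (n : ℕ) : Scheme.{u} :=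
  Proj (MvPolynomial.homogeneousSubmodule (Fin (n + 1)) K)

/-- The structure morphism of the projective space. -/
def ProjSpace.toK (K : Type u) [Field K] (n : ℕ) : ProjSpace K n ⟶ Spec (.of K) :=
  Proj.toSpecZero (MvPolynomial.homogeneousSubmodule (Fin (n + 1)) K) ≫
    Spec.map (CommRingCat.ofHom
      (algebraMap K (MvPolynomial.homogeneousSubmodule (Fin (n + 1)) K 0)))

/-- The function field `K(x, y)`. -/
abbrev FunField (K : Type u) [Field K] : Type u := FractionRing (MvPolynomial (Fin 2) K)

/-- A smooth surface `X` with an action of the algebraic group `𝔾ₐ²`, before effectivity and the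
open orbit are imposed: a smooth projective integral surface with an action of the group functor
`T ↦ Γ(T)²` on the functor of points of `X` (by Yoneda's lemma, a morphism
`𝔾ₐ² × X ⟶ X` of `K`-schemes which is an action of the group scheme `𝔾ₐ²`). -/
structure PreGaSurface (K : Type u) [Field K] where
  /-- the underlying scheme -/
  X : Scheme.{u}
  /-- the structure morphism -/
  toK : X ⟶ Spec (.of K)
  isIntegral : IsIntegral X
  smooth : SmoothOfRelativeDimension 2 toK
  projective : ∃ (n : ℕ) (i : X ⟶ ProjSpace K n),
    IsClosedImmersion i ∧ i ≫ ProjSpace.toK K n = toK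
  /-- `act a f` is the translate of the `T`-point `f` of `X` by the `T`-point `a` of `𝔾ₐ²` -/
  act : ∀ {T : Scheme.{u}}, (Fin 2 → Γ(T, ⊤)) → (T ⟶ X) → (T ⟶ X)
  act_natural : ∀ {T T' : Scheme.{u}} (g : T' ⟶ T) (a : Fin 2 → Γ(T, ⊤)) (f : T ⟶ X),
    g ≫ act a f = act (fun i => g.appTop.hom (a i)) (g ≫ f)
  act_toK : ∀ {T : Scheme.{u}} (a : Fin 2 → Γ(T, ⊤)) (f : T ⟶ X), act a f ≫ toK = f ≫ toK
  act_zero : ∀ {T : Scheme.{u}} (f : T ⟶ X), act 0 f = f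
  act_add : ∀ {T : Scheme.{u}} (a b : Fin 2 → Γ(T, ⊤)) (f : T ⟶ X),
    act (a + b) f = act a (act b f)

/-- The orbit map `𝔾ₐ² ⟶ X`, `g ↦ g · p`, of a `K`-point `p`, where `𝔾ₐ² = Spec K[x, y]`. -/
def PreGaSurface.orbitMap {K : Type u} [Field K] (S : PreGaSurface K) (p : Spec (.of K) ⟶ S.X) :
    Spec (.of (MvPolynomial (Fin 2) K)) ⟶ S.X :=
  S.act (fun i => (Scheme.ΓSpecIso (.of (MvPolynomial (Fin 2) K))).inv.hom (MvPolynomial.X i))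
    (Spec.map (CommRingCat.ofHom (MvPolynomial.C : K →+* MvPolynomial (Fin 2) K)) ≫ p)

/-- A smooth `𝔾ₐ²`-surface: a smooth projective surface with an effective action of `𝔾ₐ²` that has
an open orbit. As `𝔾ₐ²` is commutative and (in characteristic zero) stabilizers are reduced, this
means that the orbit map of some `K`-point is an open immersion. -/
structure GaSurface (K : Type u) [Field K] extends PreGaSurface K where
  open_orbit : ∃ p : Spec (.of K) ⟶ X, p ≫ toK = 𝟙 _ ∧
    IsOpenImmersion (toPreGaSurface.orbitMap p)

/-- An automorphism of the algebraic group `𝔾ₐ²` over `K`, given by the polynomials that define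
it and its inverse. -/
structure GaAut (K : Type u) [Field K] where
  fwd : Fin 2 → MvPolynomial (Fin 2) K
  inv : Fin 2 → MvPolynomial (Fin 2) K
  fwd_inv : ∀ i, MvPolynomial.bind₁ fwd (inv i) = MvPolynomial.X i
  inv_fwd : ∀ i, MvPolynomial.bind₁ inv (fwd i) = MvPolynomial.X i
  additive : ∀ i, MvPolynomial.bind₁
      (fun j => (MvPolynomial.X (Sum.inl j) + MvPolynomial.X (Sum.inr j) :
        MvPolynomial (Fin 2 ⊕ Fin 2) K)) (fwd i) =
    MvPolynomial.rename Sum.inl (fwd i) + MvPolynomial.rename Sum.inr (fwd i)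

/-- The action of an automorphism of `𝔾ₐ²` on `T`-points. -/
def GaAut.onPoints {K : Type u} [Field K] (ψ : GaAut K) {T : Scheme.{u}} (φ : T ⟶ Spec (.of K))
    (a : Fin 2 → Γ(T, ⊤)) : Fin 2 → Γ(T, ⊤) :=
  fun i => MvPolynomial.eval₂ (consts φ) a (ψ.fwd i)

/-- Equivariant isomorphism: an isomorphism `τ` of the underlying surfaces over `K` and an
automorphism `ψ` of the algebraic group `𝔾ₐ²` such that `τ (a · p) = ψ a · τ p`. -/
def EquivIsomorphic {K : Type u} [Field K] (S S' : GaSurface K) : Prop :=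
  ∃ (τ : S.X ≅ S'.X) (ψ : GaAut K), τ.hom ≫ S'.toK = S.toK ∧
    ∀ {T : Scheme.{u}} (a : Fin 2 → Γ(T, ⊤)) (f : T ⟶ S.X),
      S.act a f ≫ τ.hom = S'.act (ψ.onPoints (f ≫ S.toK) a) (f ≫ τ.hom)

/-! ### Local rings in `K(x, y)` and points of the bubble space

A point of a surface birational to the plane with coordinates `x, y`, in particular an infinitely
near point of `𝔽_r`, is the same thing as its local ring, a subring of `K(x, y)`: two points of
two such surfaces have the same local ring iff the birational map between the surfaces is an
isomorphism of neighbourhoods that takes one point to the other. A surface (an integral separated scheme of finite type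
over `K`) with function field `K(x, y)` is determined by the set of the local rings of its closed
points. -/

section Models

variable (K : Type u) [Field K]

/-- The coordinate function `x`. -/
def x : FunField K := algebraMap (MvPolynomial (Fin 2) K) _ (MvPolynomial.X 0)

/-- The coordinate function `y`. -/
def y : FunField K := algebraMap (MvPolynomial (Fin 2) K) _ (MvPolynomial.X 1)

variable {K}

/-- The local ring `K[u, v]_{(u, v)}` of the point with local coordinates `c = (u, v)`. It consists
of the fractions `P(u, v) / Q(u, v)` with `Q(0, 0) ≠ 0`. (All pairs `(u, v)` used below are
algebraically independent over `K`.) -/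
def localRing (c : FunField K × FunField K) : Subring (FunField K) where
  carrier := {f | ∃ P Q : MvPolynomial (Fin 2) K, MvPolynomial.constantCoeff Q ≠ 0 ∧
    f * MvPolynomial.aeval ![c.1, c.2] Q = MvPolynomial.aeval ![c.1, c.2] P}
  mul_mem' := by
    rintro f g ⟨P, Q, hQ, h⟩ ⟨P', Q', hQ', h'⟩
    refine ⟨P * P', Q * Q', by simp [hQ, hQ'], ?_⟩
    rw [map_mul, map_mul, ← h, ← h']; ring
  one_mem' := ⟨1, 1, by simp, by simp⟩
  add_mem' := by
    rintro f g ⟨P, Q, hQ, h⟩ ⟨P', Q', hQ', h'⟩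
    refine ⟨P * Q' + P' * Q, Q * Q', by simp [hQ, hQ'], ?_⟩
    rw [map_add, map_mul, map_mul, map_mul, ← h, ← h']; ring
  zero_mem' := ⟨0, 1, by simp, by simp⟩
  neg_mem' := by
    rintro f ⟨P, Q, hQ, h⟩
    exact ⟨-P, Q, hQ, by rw [map_neg, ← h]; ring⟩

/-- The local coordinates `(u - α, v - β)` at the point `(α, β)` of the chart with coordinates
`c = (u, v)`. -/
def shift (c : FunField K × FunField K) (α β : K) : FunField K × FunField K :=
  (c.1 - algebraMap K _ α, c.2 - algebraMap K _ β)

/-- The coordinates in the four toric charts of the Hirzebruch surface `𝔽_r`, each of which is an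
affine plane. The zero section `s`, with self-intersection number `-r`, is `{u = 0}` in the last two
charts, and the distinguished fiber `f` is `{v = 0}` in the second and third ones. -/
def charts (K : Type u) [Field K] (r : ℕ) : Set (FunField K × FunField K) :=
  {(x K, y K), (x K / y K ^ r, 1 / y K), (y K ^ r / x K, 1 / y K), (1 / x K, y K)}

/-- The (local rings of the) closed points of `𝔽_r`. -/
def hirzebruch (K : Type u) [Field K] (r : ℕ) : Set (Subring (FunField K)) :=
  {R | ∃ c ∈ charts K r, ∃ α β : K, R = localRing (shift c α β)}

/-- Let `(u, v)` be local coordinates at a point. These are the local coordinates at the point of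
the exceptional curve of its blowup at which the coordinate `u / v` of the curve takes the value
`q ∈ K ∪ {∞}`: they are `(u / v - q, v)` if `q ≠ ∞`, and `(u, v / u)` if `q = ∞`. -/
def next (c : FunField K × FunField K) (q : OnePoint K) : FunField K × FunField K :=
  q.elim (c.1, c.2 / c.1) (fun q => (c.1 / c.2 - algebraMap K _ q, c.2))

/-- A coordinate sequence `[a₁, a₂, …, aₖ]` with `a₁ ∈ K` and `a₂, …, aₖ ∈ K ∪ {∞}`, stored as
`(a₁, [a₂, …, aₖ])`. It stands for a point on, or infinitely near to, the fiber `f` away from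
the section `s`. -/
abbrev CoordSeq (K : Type u) : Type u := K × List (OnePoint K)

/-- The local coordinates at the point of the bubble space of `𝔽_r` with a given coordinate sequence:
`[q]` is the point of the fiber `f` at which `x / y ^ r` equals `q`, its local coordinates are
`(x / y ^ r - q, 1 / y)`, and `[a₁, …, aₖ, q]` is the point with coordinate `q` on the exceptional
curve of `[a₁, …, aₖ]`. -/
def coords (r : ℕ) (p : CoordSeq K) : FunField K × FunField K :=
  p.2.foldl next (x K / y K ^ r - algebraMap K _ p.1, 1 / y K)

/-- The points `[a₁], [a₁, a₂], …, [a₁, …, aₖ]` which have to be blown up one after another in order to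
blow up the point `[a₁, …, aₖ]`, for all the given points. -/
def blownUp (ps : List (CoordSeq K)) : Set (CoordSeq K) :=
  {s | ∃ p ∈ ps, s.1 = p.1 ∧ s.2 <+: p.2}

/-- The (local rings of the) closed points of the blowup of `𝔽_r` at `p₁, …, pₖ`: these are the points
of `𝔽_r` and of the exceptional curves of all blown up points, except the blown up points. -/
def blowupPoints (r : ℕ) (ps : List (CoordSeq K)) : Set (Subring (FunField K)) :=
  {R | (R ∈ hirzebruch K r ∨
      ∃ s ∈ blownUp ps, ∃ q : OnePoint K, R = localRing (next (coords r s) q)) ∧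
    ∀ s ∈ blownUp ps, R ≠ localRing (coords r s)}

end Models

/-! ### Equivariant blowups of `(𝔽_r, φ_r)` -/

/-- Let `η : Spec K(x, y) ⟶ X`. The subring `R` of `K(x, y)` is the local ring of `X` at `p`, if the
function field of `X` is identified with `K(x, y)` through `η`. -/
def HasLocalRing {K : Type u} [Field K] {X : Scheme.{u}} (η : Spec (.of (FunField K)) ⟶ X)
    (p : X) (R : Subring (FunField K)) : Prop :=
  ∃ e : X.presheaf.stalk p ≅ CommRingCat.of R,
    Spec.map (CommRingCat.ofHom R.subtype) ≫ Spec.map e.hom ≫ X.fromSpecStalk p = η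

/-- `S` is the `𝔾ₐ²`-surface `Bl(𝔽_r, p₁, …, pₖ)`, the blowup of `(𝔽_r, φ_r)` at `p₁, …, pₖ`, where
`φ_r` is the action `(a, b) · (x, y) = (x + a, y + b)`: there is a point `p` (the origin) such that
the orbit map `(x, y) ↦ (x, y) · p` is an open immersion and, when the function field of `S` is
identified with `K(x, y)` through it, the closed points of `S` are those of the blowup. -/
def GaSurface.IsBl {K : Type u} [Field K] (S : GaSurface K) (r : ℕ) (ps : List (CoordSeq K)) :
    Prop :=
  ∃ p : Spec (.of K) ⟶ S.X, p ≫ S.toK = 𝟙 _ ∧ IsOpenImmersion (S.orbitMap p) ∧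
    let η : Spec (.of (FunField K)) ⟶ S.X :=
      Spec.map (CommRingCat.ofHom (algebraMap (MvPolynomial (Fin 2) K) (FunField K))) ≫
        S.orbitMap p
    (∀ z : S.X, IsClosed {z} → ∃ R ∈ blowupPoints r ps, HasLocalRing η z R) ∧
    (∀ R ∈ blowupPoints r ps, ∃ z : S.X, IsClosed {z} ∧ HasLocalRing η z R)

/-- `S` is equivariantly isomorphic to `Bl(𝔽_r, p₁, …, pₖ)`. -/
def GaSurface.IsoBl {K : Type u} [Field K] (S : GaSurface K) (r : ℕ) (ps : List (CoordSeq K)) :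
    Prop :=
  ∃ S' : GaSurface K, S'.IsBl r ps ∧ EquivIsomorphic S S'

/-! ### The families of surfaces -/

section Families

variable {K : Type u} [Field K]

/-- The coordinate sequence `[a]`. -/
def pt (a : K) : CoordSeq K := (a, [])

/-- The coordinate sequence `[0, …, 0, q]` with `k` zeros before `q`. -/
def zerosPt : ℕ → K → CoordSeq K
  | 0, q => (q, [])
  | k + 1, q => (0, List.replicate k ((0 : K) : OnePoint K) ++ [(q : OnePoint K)])

/-- The coordinate sequence `[a, ∞, w]`. -/
def ptInf (a w : K) : CoordSeq K := (a, [∞, (w : OnePoint K)])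

/-- The coordinate sequence `[a, ∞, w, q]`. -/
def ptInf' (a w q : K) : CoordSeq K := (a, [∞, (w : OnePoint K), (q : OnePoint K)])

/-- `S` is up to equivariant isomorphism `Bl(𝔽_r, [0_(k), q₁], [q₂])`, where `k ≤ r - 1`. -/
def GaSurface.IsCaseA (S : GaSurface K) : Prop :=
  ∃ (r k : ℕ) (q₁ q₂ : K), 1 ≤ r ∧ k + 1 ≤ r ∧ (k + 1 < r → q₁ ≠ 0) ∧
    (k = 0 → q₂ ≠ q₁) ∧ (0 < k → q₂ ≠ 0) ∧ S.IsoBl r [zerosPt k q₁, pt q₂]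

/-- `S` is up to equivariant isomorphism `Bl(𝔽_r, [0, ∞, w, q])`, where `r > 1`. -/
def GaSurface.IsCaseC (S : GaSurface K) : Prop :=
  ∃ (r : ℕ) (w q : K), 1 < r ∧ w ≠ 0 ∧ S.IsoBl r [ptInf' 0 w q]

/-- `S` is up to equivariant isomorphism `Bl(𝔽_r, [q, ∞, w])`, where `r ≥ 1`. -/
def GaSurface.IsCaseE (S : GaSurface K) : Prop :=
  ∃ (r : ℕ) (q w : K), 1 ≤ r ∧ q ≠ 0 ∧ w ≠ 0 ∧ S.IsoBl r [ptInf q w]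

/-- The entries of the list of normal forms. -/
inductive NormalForm (K : Type u) : Type u
  | i : NormalForm K
  | ii (r : ℕ) (q : K) : NormalForm K
  | iii (r k : ℕ) : NormalForm K
  | iv (r : ℕ) : NormalForm K
  | v (r : ℕ) : NormalForm K
  | vi (r : ℕ) : NormalForm K

namespace NormalForm

/-- The range of the parameters. -/
def Valid : NormalForm K → Prop
  | i => True
  | ii r q => 2 ≤ r ∧ q ≠ 1
  | iii r k => 2 ≤ r ∧ 1 ≤ k ∧ k + 1 ≤ r
  | iv r => 2 ≤ r
  | v r => 3 ≤ r
  | vi r => 2 ≤ r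

/-- `S` is equivariantly isomorphic to the surface of the list. -/
def IsIso (S : GaSurface K) : NormalForm K → Prop
  | i => S.IsoBl 1 [pt 0, pt 1]
  | ii r q => S.IsoBl r [pt 1, pt q]
  | iii r k => S.IsoBl r [zerosPt k 1, pt 1]
  | iv r => S.IsoBl r [ptInf' 0 1 0]
  | v r => S.IsoBl r [ptInf' 0 1 1]
  | vi r => S.IsoBl r [ptInf 1 1]

/-- Two entries agree, up to replacing the parameter `q ≠ 0` in the second family by its inverse. -/
def Same (e e' : NormalForm K) : Prop :=
  e' = e ∨ ∃ (r : ℕ) (q : K), q ≠ 0 ∧ e = ii r q ∧ e' = ii r q⁻¹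

end NormalForm

end Families

end GaSurfaces

end

/-!
# Blowups of Hirzebruch surfaces with additive actions

The classification is reduced to a question on subrings of `K(x, y)`, and then to the action of
triangular matrices on coordinate sequences.

In characteristic zero, the automorphisms of the algebraic group `𝔾ₐ²` are linear
(`GaAut.exists_matrix`), and twisting an action by a matrix does not change the surface. The choice of
the origin in the open orbit does not matter either, since two open orbits meet
(`PreGaSurface.exists_act_eq`) and translations are automorphisms of the surface. Hence a surface
that is isomorphic to one blowup is also isomorphic to another one if and only if some linear
substitution `(x, y) ↦ M (x, y)` takes the set of the local rings of the closed points of the first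
blowup to that of the second one (`GaSurface.isoBl_iff_of_isoBl`).

The normal forms are different because the boundary curves can be recovered from the closed points:
their local rings are the subrings of `K(x, y)` that contain infinitely many local rings of closed
points, but not all linear forms (`boundary`, `exists_curve`). The two orders that nonzero linear
forms have along a boundary curve, the type of the curve, are therefore invariants, and they determine
`r` and the family up to three ambiguities (`NormalForm.eq_or_of_hasType_iff`). In these cases, the
section `s` is the only candidate for its image, so that the matrix is triangular
(`triangular_of_section`), and the order of a further function along a boundary curve decides: it is
`x - p y ^ r` for the parameter `q` of the second family (`NormalForm.eq_or_eq_inv_of_mapRings_eq`),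
`x - y ^ (r - 1)` for `Bl(𝔽_r, [1], [0])` and `Bl(𝔽_r, [0, 1], [1])`
(`NormalForm.not_mapRings_eq_zerosPt`), and `x ^ 2 / y ^ (2 r - 1) - 1` for the fourth and the fifth
family (`NormalForm.not_mapRings_eq_ptInf'`).

Every surface has a normal form because triangular substitutions `x ↦ α x + β y`, `y ↦ δ y` are
automorphisms of `𝔽_r` (`mapRings_hirzebruch`) and act on infinitely near points in a way that can be
read off from local coordinates which are adapted to the coordinate sequences (`Adapted`). Scalings
make the parameters `0` or `1` (`IsTri.mapRings_zerosPt`, `mapRings_ptInf`), and shears, that is,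
`β ≠ 0`, are needed on `𝔽₁`, for points `[0_(k), q]` with `k = r - 1`, and for points `[0, ∞, 1, q]` on
`𝔽₂` (`mapRings_shear_two`). Only the family of the surfaces `Bl(𝔽_r, [0_(k), 1], [1])` with
`k < r - 1` uses that `K` is algebraically closed, to find a `k`-th root. The single isomorphism
between blowups of different Hirzebruch surfaces, that of `Bl(𝔽₁, [1, ∞, 1])` and
`Bl(𝔽₂, [0, 1], [1])`, comes from a toric surface which is a blowup of `𝔽₁` and also, after an
exchange of `x` and `y`, of `𝔽₂` (`toricPoints`, `linRel_one_two`).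
-/

noncomputable section

namespace GaSurfaces

open AlgebraicGeometry CategoryTheory
open scoped OnePoint

/-! ### Linear substitutions -/

section LinearSubstitution

variable {K : Type u} [Field K]

/-- The linear form given by row `i` of the matrix `M`. -/
def linForm (M : Matrix (Fin 2) (Fin 2) K) (i : Fin 2) : MvPolynomial (Fin 2) K :=
  ∑ j, MvPolynomial.C (M i j) * MvPolynomial.X j

theorem bind₁_linForm (M N : Matrix (Fin 2) (Fin 2) K) (i : Fin 2) :
    MvPolynomial.bind₁ (linForm M) (linForm N i) = linForm (N * M) i := by
  simp [linForm, Matrix.mul_apply, Fin.sum_univ_two]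
  ring

theorem linForm_one (i : Fin 2) : linForm (1 : Matrix (Fin 2) (Fin 2) K) i = MvPolynomial.X i := by
  revert i
  simp [linForm, Fin.sum_univ_two, Fin.forall_fin_two]

/-- The linear substitution `(x, y) ↦ M (x, y)` of the polynomial ring. -/
def linEquiv (M : GL (Fin 2) K) : MvPolynomial (Fin 2) K ≃ₐ[K] MvPolynomial (Fin 2) K :=
  AlgEquiv.ofAlgHom (MvPolynomial.bind₁ (linForm M.1)) (MvPolynomial.bind₁ (linForm M⁻¹.1))
    (by
      refine MvPolynomial.algHom_ext fun i => ?_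
      simp only [AlgHom.comp_apply, MvPolynomial.bind₁_X_right, bind₁_linForm, AlgHom.id_apply]
      rw [← Units.val_mul, inv_mul_cancel, Units.val_one, linForm_one])
    (by
      refine MvPolynomial.algHom_ext fun i => ?_
      simp only [AlgHom.comp_apply, MvPolynomial.bind₁_X_right, bind₁_linForm, AlgHom.id_apply]
      rw [← Units.val_mul, mul_inv_cancel, Units.val_one, linForm_one])

@[simp] theorem linEquiv_X (M : GL (Fin 2) K) (i : Fin 2) :
    linEquiv M (MvPolynomial.X i) = linForm M.1 i := by
  simp [linEquiv]

/-- The automorphism of `K(x, y)` that extends the linear substitution `(x, y) ↦ M (x, y)`. -/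
def linAut (M : GL (Fin 2) K) : FunField K ≃ₐ[K] FunField K :=
  IsFractionRing.fieldEquivOfAlgEquiv K _ _ (linEquiv M)

theorem linAut_algebraMap (M : GL (Fin 2) K) (P : MvPolynomial (Fin 2) K) :
    linAut M (algebraMap _ (FunField K) P) = algebraMap _ (FunField K) (linEquiv M P) := by
  simp [linAut]

theorem linAut_x (M : GL (Fin 2) K) :
    linAut M (x K) = algebraMap K _ (M 0 0) * x K + algebraMap K _ (M 0 1) * y K := by
  rw [x, linAut_algebraMap, linEquiv_X, linForm, Fin.sum_univ_two]
  simp [y, IsScalarTower.algebraMap_apply K (MvPolynomial (Fin 2) K) (FunField K)]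

theorem linAut_y (M : GL (Fin 2) K) :
    linAut M (y K) = algebraMap K _ (M 1 0) * x K + algebraMap K _ (M 1 1) * y K := by
  rw [y, linAut_algebraMap, linEquiv_X, linForm, Fin.sum_univ_two]
  simp [x, IsScalarTower.algebraMap_apply K (MvPolynomial (Fin 2) K) (FunField K)]

theorem FunField.algHom_ext {A : Type*} [Field A] [Algebra K A] {f g : FunField K →ₐ[K] A}
    (hx : f (x K) = g (x K)) (hy : f (y K) = g (y K)) : f = g := by
  have : f.comp (IsScalarTower.toAlgHom K (MvPolynomial (Fin 2) K) (FunField K)) =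
      g.comp (IsScalarTower.toAlgHom K (MvPolynomial (Fin 2) K) (FunField K)) := by
    refine MvPolynomial.algHom_ext fun i => ?_
    fin_cases i
    · exact hx
    · exact hy
  apply AlgHom.coe_ringHom_injective
  refine IsLocalization.ringHom_ext (nonZeroDivisors (MvPolynomial (Fin 2) K)) ?_
  exact RingHom.ext fun P => congrArg (fun h => h P) this

theorem linAut_mul (M N : GL (Fin 2) K) (f : FunField K) :
    linAut (N * M) f = linAut M (linAut N f) := by
  have : (linAut (N * M) : FunField K →ₐ[K] FunField K) =
      (linAut M : FunField K →ₐ[K] FunField K).comp (linAut N : FunField K →ₐ[K] FunField K) := by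
    apply FunField.algHom_ext <;>
    · simp [linAut_x, linAut_y, Matrix.mul_apply, Fin.sum_univ_two]
      ring
  exact congrArg (fun h => h f) this

theorem linAut_mul_ringHom (M N : GL (Fin 2) K) :
    (linAut (N * M) : FunField K →+* FunField K) =
      (linAut M : FunField K →+* FunField K).comp (linAut N : FunField K →+* FunField K) :=
  RingHom.ext fun f => linAut_mul M N f

theorem linAut_one (f : FunField K) : linAut (1 : GL (Fin 2) K) f = f := by
  have : (linAut (1 : GL (Fin 2) K) : FunField K →ₐ[K] FunField K) = AlgHom.id K _ := by
    apply FunField.algHom_ext <;> simp [linAut_x, linAut_y]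
  exact congrArg (fun h => h f) this

/-- The set of the images of the rings in `B` under the linear substitution `M`. -/
def mapRings (M : GL (Fin 2) K) (B : Set (Subring (FunField K))) : Set (Subring (FunField K)) :=
  (fun R => R.map (linAut M : FunField K →+* FunField K)) '' B

theorem mapRings_mul (M N : GL (Fin 2) K) (B : Set (Subring (FunField K))) :
    mapRings (N * M) B = mapRings M (mapRings N B) := by
  rw [mapRings, mapRings, mapRings, Set.image_image]
  refine Set.image_congr fun R _ => ?_
  rw [Subring.map_map, linAut_mul_ringHom]

theorem linAut_one_ringHom :
    (linAut (1 : GL (Fin 2) K) : FunField K →+* FunField K) = RingHom.id _ :=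
  RingHom.ext fun f => linAut_one f

theorem mapRings_one (B : Set (Subring (FunField K))) : mapRings 1 B = B := by
  rw [mapRings, linAut_one_ringHom]
  simp only [Subring.map_id, Set.image_id']

theorem mapRings_eq_iff (M : GL (Fin 2) K) (B C : Set (Subring (FunField K))) :
    mapRings M B = C ↔ B = mapRings M⁻¹ C := by
  constructor
  · rintro rfl
    rw [← mapRings_mul, mul_inv_cancel, mapRings_one]
  · rintro rfl
    rw [← mapRings_mul, inv_mul_cancel, mapRings_one]

end LinearSubstitution

/-! ### Local rings of points of a surface -/

section LocalRings

variable {K : Type u} [Field K] {X Y : Scheme.{u}}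

theorem HasLocalRing.map {η : Spec (.of (FunField K)) ⟶ X} {p : X} {R : Subring (FunField K)}
    (h : HasLocalRing η p R) (σ : FunField K ≃+* FunField K) :
    HasLocalRing (Spec.map (CommRingCat.ofHom (σ : FunField K →+* FunField K)) ≫ η) p
      (R.map (σ : FunField K →+* FunField K)) := by
  obtain ⟨e, rfl⟩ := h
  refine ⟨e ≪≫ (R.equivMapOfInjective (σ : FunField K →+* FunField K)
    σ.injective).toCommRingCatIso, ?_⟩
  simp only [Iso.trans_hom, Spec.map_comp, ← Category.assoc]
  congr 2
  rw [← Spec.map_comp, ← Spec.map_comp]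
  rfl

theorem HasLocalRing.comp_iso {η : Spec (.of (FunField K)) ⟶ X} {p : X}
    {R : Subring (FunField K)} (h : HasLocalRing η p R) (τ : X ≅ Y) :
    HasLocalRing (η ≫ τ.hom) (τ.hom p) R := by
  obtain ⟨e, rfl⟩ := h
  refine ⟨asIso (τ.hom.stalkMap p) ≪≫ e, ?_⟩
  simp [Spec.map_comp, Scheme.SpecMap_stalkMap_fromSpecStalk]

/-- The local ring at a point is determined as a subring of `K(x, y)`, not only up to isomorphism,
since `Spec 𝒪_{X, p} ⟶ X` is a monomorphism. -/
theorem HasLocalRing.unique {η : Spec (.of (FunField K)) ⟶ X} {p : X}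
    {R R' : Subring (FunField K)} (h : HasLocalRing η p R) (h' : HasLocalRing η p R') :
    R = R' := by
  obtain ⟨e, he⟩ := h
  obtain ⟨e', he'⟩ := h'
  rw [← he', ← Category.assoc, ← Category.assoc, cancel_mono, ← Spec.map_comp, ← Spec.map_comp,
    Spec.map_inj] at he
  have key : ∀ {R R' : Subring (FunField K)} (e : X.presheaf.stalk p ≅ CommRingCat.of R)
      (e' : X.presheaf.stalk p ≅ CommRingCat.of R'),
      e.hom ≫ CommRingCat.ofHom R.subtype = e'.hom ≫ CommRingCat.ofHom R'.subtype → R ≤ R' := by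
    intro R R' e e' he f hf
    have h1 := congrArg (fun φ => φ.hom (e.inv.hom ⟨f, hf⟩)) he
    simp only [CommRingCat.hom_comp, RingHom.comp_apply] at h1
    have h2 : e.hom.hom (e.inv.hom ⟨f, hf⟩) = (⟨f, hf⟩ : R) := by
      have := congrArg (fun φ => φ.hom (⟨f, hf⟩ : R)) e.inv_hom_id
      exact this
    rw [h2] at h1
    change f = _ at h1
    rw [h1]
    exact (e'.hom.hom (e.inv.hom ⟨f, hf⟩)).2
  exact le_antisymm (key e e' he) (key e' e he.symm)

/-- The local rings of the closed points of `X`, as subrings of `K(x, y)` by means of `η`, are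
the rings in `B`. -/
def PointsAre (η : Spec (.of (FunField K)) ⟶ X) (B : Set (Subring (FunField K))) : Prop :=
  (∀ z : X, IsClosed {z} → ∃ R ∈ B, HasLocalRing η z R) ∧
    (∀ R ∈ B, ∃ z : X, IsClosed {z} ∧ HasLocalRing η z R)

theorem PointsAre.unique {η : Spec (.of (FunField K)) ⟶ X} {B C : Set (Subring (FunField K))}
    (hB : PointsAre η B) (hC : PointsAre η C) : B = C := by
  have key : ∀ {B C : Set (Subring (FunField K))}, PointsAre η B → PointsAre η C → B ⊆ C := by
    intro B C hB hC R hR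
    obtain ⟨z, hz, h⟩ := hB.2 R hR
    obtain ⟨R', hR', h'⟩ := hC.1 z hz
    rwa [h.unique h']
  exact (key hB hC).antisymm (key hC hB)

theorem PointsAre.map {η : Spec (.of (FunField K)) ⟶ X} {B : Set (Subring (FunField K))}
    (h : PointsAre η B) (M : GL (Fin 2) K) :
    PointsAre (Spec.map (CommRingCat.ofHom (linAut M : FunField K →+* FunField K)) ≫ η)
      (mapRings M B) := by
  constructor
  · intro z hz
    obtain ⟨R, hR, hz⟩ := h.1 z hz
    exact ⟨_, ⟨R, hR, rfl⟩, hz.map (linAut M : FunField K ≃+* FunField K)⟩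
  · rintro _ ⟨R, hR, rfl⟩
    obtain ⟨z, hz, h⟩ := h.2 R hR
    exact ⟨z, hz, h.map (linAut M : FunField K ≃+* FunField K)⟩

theorem isClosed_singleton_hom (τ : X ≅ Y) {z : X} (hz : IsClosed {z}) :
    IsClosed {τ.hom z} := by
  have := (Scheme.homeoOfIso τ).isClosedMap _ hz
  rwa [Set.image_singleton] at this

theorem PointsAre.comp_iso {η : Spec (.of (FunField K)) ⟶ X} {B : Set (Subring (FunField K))}
    (h : PointsAre η B) (τ : X ≅ Y) : PointsAre (η ≫ τ.hom) B := by
  constructor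
  · intro z hz
    obtain ⟨R, hR, hzR⟩ := h.1 (τ.inv z) (isClosed_singleton_hom τ.symm hz)
    refine ⟨R, hR, ?_⟩
    have := hzR.comp_iso τ
    have hz' : τ.hom (τ.inv z) = z := by
      rw [← Scheme.Hom.comp_apply, τ.inv_hom_id]; rfl
    rwa [hz'] at this
  · intro R hR
    obtain ⟨z, hz, h⟩ := h.2 R hR
    exact ⟨τ.hom z, isClosed_singleton_hom τ hz, h.comp_iso τ⟩

end LocalRings

/-! ### Automorphisms of the additive group in characteristic zero -/

section AdditivePolynomials

variable {K : Type u} [Field K]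

theorem coeff_bind₁_C_mul_X (c : K) (f : MvPolynomial (Fin 2) K) (d : Fin 2 →₀ ℕ) :
    (MvPolynomial.bind₁ (fun j => MvPolynomial.C c * MvPolynomial.X j) f).coeff d =
      c ^ (d 0 + d 1) * f.coeff d := by
  induction f using MvPolynomial.induction_on' with
  | monomial e a =>
    have : MvPolynomial.bind₁ (fun j => MvPolynomial.C c * MvPolynomial.X j)
        (MvPolynomial.monomial e a) = MvPolynomial.monomial e (c ^ (e 0 + e 1) * a) := by
      rw [MvPolynomial.monomial_eq, MvPolynomial.monomial_eq]
      simp only [map_mul, MvPolynomial.bind₁_C_right, Finsupp.prod_fintype, pow_zero, implies_true,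
        Fin.prod_univ_two, map_pow, MvPolynomial.bind₁_X_right, mul_pow, pow_add]
      ring
    rw [this, MvPolynomial.coeff_monomial, MvPolynomial.coeff_monomial]
    split_ifs with h
    · rw [h]
    · simp
  | add f g hf hg => rw [map_add, MvPolynomial.coeff_add, MvPolynomial.coeff_add, hf, hg, mul_add]

/-- An additive polynomial satisfies `f (2 x, 2 y) = 2 f (x, y)`. In characteristic zero, this forces
the coefficients of all monomials of degree different from one to vanish. -/
theorem eq_linForm_of_additive [CharZero K] {f : MvPolynomial (Fin 2) K}
    (hf : MvPolynomial.bind₁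
      (fun j => (MvPolynomial.X (Sum.inl j) + MvPolynomial.X (Sum.inr j) :
        MvPolynomial (Fin 2 ⊕ Fin 2) K)) f =
      MvPolynomial.rename Sum.inl f + MvPolynomial.rename Sum.inr f) :
    f = ∑ j, MvPolynomial.C (f.coeff (Finsupp.single j 1)) * MvPolynomial.X j := by
  have h2 : MvPolynomial.bind₁ (fun j => MvPolynomial.C (2 : K) * MvPolynomial.X j) f =
      MvPolynomial.C 2 * f := by
    have := congrArg (MvPolynomial.aeval
      (Sum.elim MvPolynomial.X MvPolynomial.X : _ → MvPolynomial (Fin 2) K)) hf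
    rw [map_add, MvPolynomial.aeval_rename, MvPolynomial.aeval_rename,
      MvPolynomial.aeval_bind₁] at this
    simp only [Sum.elim_comp_inl, Sum.elim_comp_inr, MvPolynomial.aeval_X_left, map_add,
      MvPolynomial.aeval_X, Sum.elim_inl, Sum.elim_inr, AlgHom.id_apply] at this
    have h3 : (MvPolynomial.C (2 : K) : MvPolynomial (Fin 2) K) = 2 := map_ofNat _ 2
    rw [h3, two_mul, ← this]
    simp only [two_mul]
    rfl
  have h3 : ∀ d : Fin 2 →₀ ℕ, d 0 + d 1 ≠ 1 → f.coeff d = 0 := by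
    intro d hd
    have := congrArg (MvPolynomial.coeff d) h2
    rw [coeff_bind₁_C_mul_X, MvPolynomial.coeff_C_mul] at this
    by_contra h
    have h4 : ((2 ^ (d 0 + d 1) : ℕ) : K) = ((2 ^ 1 : ℕ) : K) := by
      push_cast
      simpa using mul_right_cancel₀ h this
    exact hd (Nat.pow_right_injective le_rfl (Nat.cast_injective h4))
  ext d
  rw [Fin.sum_univ_two, MvPolynomial.coeff_add, MvPolynomial.coeff_C_mul, MvPolynomial.coeff_C_mul,
    MvPolynomial.coeff_X, MvPolynomial.coeff_X]
  by_cases h0 : d = Finsupp.single 0 1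
  · have : Finsupp.single (1 : Fin 2) 1 ≠ Finsupp.single (0 : Fin 2) (1 : ℕ) := fun h => by
      simpa using congrArg (fun e => e 0) h
    simp [h0, this]
  by_cases h1 : d = Finsupp.single 1 1
  · have : Finsupp.single (0 : Fin 2) 1 ≠ Finsupp.single (1 : Fin 2) (1 : ℕ) := fun h => by
      simpa using congrArg (fun e => e 0) h
    simp [h1, this]
  · rw [if_neg (Ne.symm h0), if_neg (Ne.symm h1), mul_zero, mul_zero, add_zero]
    apply h3
    intro h
    have : (d 0 = 1 ∧ d 1 = 0) ∨ (d 0 = 0 ∧ d 1 = 1) := by omega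
    rcases this with ⟨h, h'⟩ | ⟨h, h'⟩
    · apply h0
      ext i
      fin_cases i <;> simp [h, h']
    · apply h1
      ext i
      fin_cases i <;> simp [h, h']

/-- In characteristic zero, the automorphisms of the algebraic group `𝔾ₐ²` are linear. -/
theorem GaAut.exists_matrix [CharZero K] (ψ : GaAut K) :
    ∃ M : GL (Fin 2) K, ψ.fwd = linForm M.1 := by
  let N : Matrix (Fin 2) (Fin 2) K := fun i j => (ψ.fwd i).coeff (Finsupp.single j 1)
  have hN : ψ.fwd = linForm N := funext fun i => eq_linForm_of_additive (ψ.additive i)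
  have hunit : IsUnit N := by
    rw [← Matrix.vecMul_injective_iff_isUnit]
    have h0 : ∀ c : Fin 2 → K, Matrix.vecMul c N = 0 → c = 0 := by
      intro c hc
      have h1 : ∑ i, MvPolynomial.C (c i) * ψ.fwd i = 0 := by
        have e0 := congrFun hc 0
        have e1 := congrFun hc 1
        simp only [Matrix.vecMul, dotProduct, Fin.sum_univ_two, Pi.zero_apply] at e0 e1
        have e0' := congrArg (MvPolynomial.C (σ := Fin 2)) e0
        have e1' := congrArg (MvPolynomial.C (σ := Fin 2)) e1
        simp only [map_add, map_mul, map_zero] at e0' e1'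
        simp only [hN, linForm, Fin.sum_univ_two]
        linear_combination MvPolynomial.X 0 * e0' + MvPolynomial.X 1 * e1'
      have h2 := congrArg (MvPolynomial.bind₁ ψ.inv) h1
      simp only [Fin.sum_univ_two, map_add, map_mul, MvPolynomial.bind₁_C_right, ψ.inv_fwd,
        map_zero] at h2
      have a0 := congrArg (MvPolynomial.eval ![1, 0]) h2
      have a1 := congrArg (MvPolynomial.eval ![0, 1]) h2
      simp at a0 a1
      ext i
      fin_cases i
      · exact a0
      · exact a1
    intro c c' h
    rw [← sub_eq_zero]
    apply h0
    rw [Matrix.sub_vecMul]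
    exact sub_eq_zero.2 h
  exact ⟨hunit.unit, hN⟩

/-- The automorphism of `𝔾ₐ²` given by an invertible matrix. -/
def GaAut.ofMatrix (M : GL (Fin 2) K) : GaAut K where
  fwd := linForm M.1
  inv := linForm M⁻¹.1
  fwd_inv i := by
    rw [bind₁_linForm, ← Units.val_mul, inv_mul_cancel, Units.val_one, linForm_one]
  inv_fwd i := by
    rw [bind₁_linForm, ← Units.val_mul, mul_inv_cancel, Units.val_one, linForm_one]
  additive i := by
    simp [linForm, Fin.sum_univ_two]
    ring

end AdditivePolynomials

/-! ### Equivariant isomorphisms and twisted actions -/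

section Twist

variable {K : Type u} [Field K]

theorem appTop_consts {T T' : Scheme.{u}} (g : T' ⟶ T) (φ : T ⟶ Spec (.of K)) (c : K) :
    g.appTop.hom (consts φ c) = consts (g ≫ φ) c := by
  rw [consts, consts, Scheme.Hom.comp_appTop]
  rfl

theorem consts_Spec_map {A : Type u} [CommRing A] (φ : K →+* A) (c : K) :
    consts (Spec.map (CommRingCat.ofHom φ)) c = (Scheme.ΓSpecIso (.of A)).inv.hom (φ c) := by
  rw [consts, ← Scheme.ΓSpecIso_inv_naturality]
  rfl

/-- The action of an invertible matrix on the `T`-points of `𝔾ₐ²`. -/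
def matAct (M : Matrix (Fin 2) (Fin 2) K) {T : Scheme.{u}} (φ : T ⟶ Spec (.of K))
    (a : Fin 2 → Γ(T, ⊤)) : Fin 2 → Γ(T, ⊤) :=
  fun i => ∑ j, consts φ (M i j) * a j

theorem matAct_zero (M : Matrix (Fin 2) (Fin 2) K) {T : Scheme.{u}} (φ : T ⟶ Spec (.of K)) :
    matAct M φ 0 = 0 := by
  ext i; simp [matAct]

theorem matAct_add (M : Matrix (Fin 2) (Fin 2) K) {T : Scheme.{u}} (φ : T ⟶ Spec (.of K))
    (a b : Fin 2 → Γ(T, ⊤)) : matAct M φ (a + b) = matAct M φ a + matAct M φ b := by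
  ext i; simp [matAct, mul_add, Finset.sum_add_distrib]

theorem matAct_natural (M : Matrix (Fin 2) (Fin 2) K) {T T' : Scheme.{u}} (g : T' ⟶ T)
    (φ : T ⟶ Spec (.of K)) (a : Fin 2 → Γ(T, ⊤)) :
    (fun i => g.appTop.hom (matAct M φ a i)) =
      matAct M (g ≫ φ) (fun i => g.appTop.hom (a i)) := by
  ext i; simp [matAct, appTop_consts]

theorem matAct_mul (M N : Matrix (Fin 2) (Fin 2) K) {T : Scheme.{u}} (φ : T ⟶ Spec (.of K))
    (a : Fin 2 → Γ(T, ⊤)) : matAct M φ (matAct N φ a) = matAct (M * N) φ a := by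
  ext i
  simp [matAct, Matrix.mul_apply, Fin.sum_univ_two]
  ring

theorem matAct_one {T : Scheme.{u}} (φ : T ⟶ Spec (.of K)) (a : Fin 2 → Γ(T, ⊤)) :
    matAct (1 : Matrix (Fin 2) (Fin 2) K) φ a = a := by
  ext i
  revert i
  simp [matAct, Fin.sum_univ_two, Fin.forall_fin_two]

theorem onPoints_eq_matAct {ψ : GaAut K} {M : Matrix (Fin 2) (Fin 2) K} (h : ψ.fwd = linForm M)
    {T : Scheme.{u}} (φ : T ⟶ Spec (.of K)) (a : Fin 2 → Γ(T, ⊤)) :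
    ψ.onPoints φ a = matAct M φ a := by
  ext i
  simp [GaAut.onPoints, h, linForm, matAct, Fin.sum_univ_two]

theorem matAct_generic (M : GL (Fin 2) K) :
    matAct M.1 (Spec.map (CommRingCat.ofHom (MvPolynomial.C : K →+* MvPolynomial (Fin 2) K)))
      (fun i => (Scheme.ΓSpecIso (.of (MvPolynomial (Fin 2) K))).inv.hom (MvPolynomial.X i)) =
    fun i => (Spec.map (CommRingCat.ofHom (linEquiv M : MvPolynomial (Fin 2) K →+* _))).appTop.hom
      ((Scheme.ΓSpecIso (.of (MvPolynomial (Fin 2) K))).inv.hom (MvPolynomial.X i)) := by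
  ext i
  have h : (Spec.map (CommRingCat.ofHom (linEquiv M : MvPolynomial (Fin 2) K →+* _))).appTop.hom
      ((Scheme.ΓSpecIso (.of (MvPolynomial (Fin 2) K))).inv.hom (MvPolynomial.X i)) =
      (Scheme.ΓSpecIso (.of (MvPolynomial (Fin 2) K))).inv.hom
        (linEquiv M (MvPolynomial.X i)) := by
    have := Scheme.ΓSpecIso_inv_naturality
      (CommRingCat.ofHom (linEquiv M : MvPolynomial (Fin 2) K →+* MvPolynomial (Fin 2) K))
    exact (congrArg (fun φ => φ.hom (MvPolynomial.X i)) this).symm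
  rw [h, linEquiv_X]
  simp [matAct, consts_Spec_map, linForm]

/-- The surface `S` with the action of `a ∈ 𝔾ₐ²` replaced by the one of `M a`. -/
def PreGaSurface.twist (S : PreGaSurface K) (M : GL (Fin 2) K) : PreGaSurface K where
  X := S.X
  toK := S.toK
  isIntegral := S.isIntegral
  smooth := S.smooth
  projective := S.projective
  act a f := S.act (matAct M.1 (f ≫ S.toK) a) f
  act_natural g a f := by rw [S.act_natural, matAct_natural, Category.assoc]
  act_toK a f := S.act_toK _ f
  act_zero f := by rw [matAct_zero, S.act_zero]
  act_add a b f := by rw [matAct_add, S.act_add, S.act_toK]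

/-- For the twisted action, the orbit map of `p` is composed with the linear automorphism `M` of
`𝔾ₐ²`. The left-hand side is kept in the form in which it arises from `GaAut.onPoints`. -/
theorem PreGaSurface.act_matAct_generic (S : PreGaSurface K) (M : GL (Fin 2) K)
    (p : Spec (.of K) ⟶ S.X) (hp : p ≫ S.toK = 𝟙 _) :
    S.act (matAct M.1 ((Spec.map (CommRingCat.ofHom
        (MvPolynomial.C : K →+* MvPolynomial (Fin 2) K)) ≫ p) ≫ S.toK) fun i =>
      (Scheme.ΓSpecIso (.of (MvPolynomial (Fin 2) K))).inv.hom (MvPolynomial.X i))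
      (Spec.map (CommRingCat.ofHom (MvPolynomial.C : K →+* MvPolynomial (Fin 2) K)) ≫ p) =
      Spec.map (CommRingCat.ofHom (linEquiv M : MvPolynomial (Fin 2) K →+* _)) ≫
        S.orbitMap p := by
  let γ : Spec (.of (MvPolynomial (Fin 2) K)) ⟶ Spec (.of K) :=
    Spec.map (CommRingCat.ofHom (MvPolynomial.C : K →+* MvPolynomial (Fin 2) K))
  let ε : Spec (.of (MvPolynomial (Fin 2) K)) ⟶ Spec (.of (MvPolynomial (Fin 2) K)) :=
    Spec.map (CommRingCat.ofHom (linEquiv M : MvPolynomial (Fin 2) K →+* _))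
  have hε : ε ≫ γ = γ := by
    simp only [ε, γ]
    rw [← Spec.map_comp, ← CommRingCat.ofHom_comp]
    congr 2
    refine RingHom.ext fun a => ?_
    exact (linEquiv M).commutes a
  suffices h : S.act (matAct M.1 ((γ ≫ p) ≫ S.toK) fun i =>
      (Scheme.ΓSpecIso (.of (MvPolynomial (Fin 2) K))).inv.hom (MvPolynomial.X i)) (γ ≫ p) =
      ε ≫ S.orbitMap p from h
  have hγ : (γ ≫ p) ≫ S.toK = γ := by rw [Category.assoc, hp, Category.comp_id]
  rw [hγ, PreGaSurface.orbitMap, S.act_natural, matAct_generic, ← Category.assoc]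
  change _ = S.act _ ((ε ≫ γ) ≫ p)
  rw [hε]

theorem PreGaSurface.orbitMap_twist (S : PreGaSurface K) (M : GL (Fin 2) K)
    (p : Spec (.of K) ⟶ S.X) (hp : p ≫ S.toK = 𝟙 _) :
    (S.twist M).orbitMap p =
      Spec.map (CommRingCat.ofHom (linEquiv M : MvPolynomial (Fin 2) K →+* _)) ≫
        S.orbitMap p :=
  S.act_matAct_generic M p hp

instance (M : GL (Fin 2) K) :
    IsIso (Spec.map (CommRingCat.ofHom
      (linEquiv M : MvPolynomial (Fin 2) K →+* MvPolynomial (Fin 2) K))) := by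
  have : IsIso (CommRingCat.ofHom
      (linEquiv M : MvPolynomial (Fin 2) K →+* MvPolynomial (Fin 2) K)) :=
    (linEquiv M).toRingEquiv.toCommRingCatIso.isIso_hom
  infer_instance

theorem PreGaSurface.isOpenImmersion_orbitMap_twist (S : PreGaSurface K) (M : GL (Fin 2) K)
    (p : Spec (.of K) ⟶ S.X) (hp : p ≫ S.toK = 𝟙 _) [IsOpenImmersion (S.orbitMap p)] :
    IsOpenImmersion ((S.twist M).orbitMap p) := by
  have h : IsOpenImmersion (Spec.map (CommRingCat.ofHom
      (linEquiv M : MvPolynomial (Fin 2) K →+* MvPolynomial (Fin 2) K)) ≫ S.orbitMap p) :=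
    inferInstance
  rw [← S.orbitMap_twist M p hp] at h
  exact h

/-- The `𝔾ₐ²`-surface `S` with the action of `a ∈ 𝔾ₐ²` replaced by the one of `M a`. -/
def GaSurface.twist (S : GaSurface K) (M : GL (Fin 2) K) : GaSurface K where
  toPreGaSurface := S.toPreGaSurface.twist M
  open_orbit := by
    obtain ⟨p, hp, h⟩ := S.open_orbit
    exact ⟨p, hp, S.isOpenImmersion_orbitMap_twist M p hp⟩

/-- The identity of the surface and the automorphism `M⁻¹` of `𝔾ₐ²` are an equivariant isomorphism. -/
theorem GaSurface.equivIsomorphic_twist (S : GaSurface K) (M : GL (Fin 2) K) :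
    EquivIsomorphic S (S.twist M) := by
  refine ⟨Iso.refl S.X, GaAut.ofMatrix M⁻¹, Category.id_comp _, fun {T} a f => ?_⟩
  have h1 : S.act a f ≫ 𝟙 S.X = S.act (matAct M.1 (f ≫ S.toK)
      ((GaAut.ofMatrix M⁻¹).onPoints (f ≫ S.toK) a)) f := by
    rw [onPoints_eq_matAct rfl, matAct_mul, ← Units.val_mul, mul_inv_cancel, Units.val_one,
      matAct_one, Category.comp_id]
  have h2 : f ≫ 𝟙 S.X = f := Category.comp_id f
  change S.act a f ≫ 𝟙 S.X = S.act (matAct M.1 ((f ≫ 𝟙 S.X) ≫ S.toK)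
      ((GaAut.ofMatrix M⁻¹).onPoints (f ≫ S.toK) a)) (f ≫ 𝟙 S.X)
  rw [h1, h2]

/-- The embedding of the generic point of the open orbit of `p`. -/
def PreGaSurface.generic (S : PreGaSurface K) (p : Spec (.of K) ⟶ S.X) :
    Spec (.of (FunField K)) ⟶ S.X :=
  Spec.map (CommRingCat.ofHom (algebraMap (MvPolynomial (Fin 2) K) (FunField K))) ≫ S.orbitMap p

theorem Spec_map_linAut (M : GL (Fin 2) K) :
    Spec.map (CommRingCat.ofHom (linAut M : FunField K →+* FunField K)) ≫
      Spec.map (CommRingCat.ofHom (algebraMap (MvPolynomial (Fin 2) K) (FunField K))) =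
    Spec.map (CommRingCat.ofHom (algebraMap (MvPolynomial (Fin 2) K) (FunField K))) ≫
      Spec.map (CommRingCat.ofHom (linEquiv M : MvPolynomial (Fin 2) K →+* _)) := by
  rw [← Spec.map_comp, ← Spec.map_comp, ← CommRingCat.ofHom_comp, ← CommRingCat.ofHom_comp]
  congr 2
  exact RingHom.ext fun P => linAut_algebraMap M P

theorem PreGaSurface.generic_twist (S : PreGaSurface K) (M : GL (Fin 2) K)
    (p : Spec (.of K) ⟶ S.X) (hp : p ≫ S.toK = 𝟙 _) :
    (S.twist M).generic p =
      Spec.map (CommRingCat.ofHom (linAut M : FunField K →+* FunField K)) ≫ S.generic p := by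
  rw [generic, ← Category.assoc, Spec_map_linAut, Category.assoc, ← S.orbitMap_twist M p hp]
  rfl

/-- `S` is equivariantly isomorphic to a blowup of `𝔽_r` if and only if the closed points of `S`
are those of the blowup up to a linear substitution, for the identification of function fields
by some open orbit of `S`. -/
theorem GaSurface.isoBl_iff [CharZero K] (S : GaSurface K) (r : ℕ) (ps : List (CoordSeq K)) :
    S.IsoBl r ps ↔ ∃ p : Spec (.of K) ⟶ S.X, p ≫ S.toK = 𝟙 _ ∧ IsOpenImmersion (S.orbitMap p) ∧
      ∃ M : GL (Fin 2) K, PointsAre (S.generic p) (mapRings M (blowupPoints r ps)) := by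
  constructor
  · rintro ⟨S', ⟨p', hp', hop, hpts⟩, τ, ψ, hτ, hact⟩
    have hpts : PointsAre (S'.generic p') (blowupPoints r ps) := hpts
    obtain ⟨M, hM⟩ := ψ.exists_matrix
    have hp : (p' ≫ τ.inv) ≫ S.toK = 𝟙 _ := by
      rw [← hτ, Category.assoc, τ.inv_hom_id_assoc, hp']
    have horb : S.orbitMap (p' ≫ τ.inv) = Spec.map (CommRingCat.ofHom
        (linEquiv M : MvPolynomial (Fin 2) K →+* _)) ≫ S'.orbitMap p' ≫ τ.inv := by
      have h := S'.act_matAct_generic M p' hp'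
      rw [← Category.assoc, ← h, ← cancel_mono τ.hom, Category.assoc, τ.inv_hom_id,
        Category.comp_id, PreGaSurface.orbitMap, hact, onPoints_eq_matAct hM]
      simp only [Category.assoc, τ.inv_hom_id, Category.comp_id, ← hτ, τ.inv_hom_id_assoc]
    have hgen : S.generic (p' ≫ τ.inv) = (Spec.map (CommRingCat.ofHom
        (linAut M : FunField K →+* FunField K)) ≫ S'.generic p') ≫ τ.inv := by
      rw [PreGaSurface.generic, PreGaSurface.generic, horb, ← Category.assoc, ← Spec_map_linAut]
      simp only [Category.assoc]
    refine ⟨p' ≫ τ.inv, hp, ?_, M, ?_⟩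
    · rw [horb]
      exact inferInstance
    · rw [hgen]
      exact (hpts.map M).comp_iso τ.symm
  · rintro ⟨p, hp, hop, M, hpts⟩
    refine ⟨S.twist M⁻¹, ⟨p, hp, ?_, ?_⟩, S.equivIsomorphic_twist _⟩
    · exact S.isOpenImmersion_orbitMap_twist M⁻¹ p hp
    · change PointsAre ((S.toPreGaSurface.twist M⁻¹).generic p) (blowupPoints r ps)
      have := hpts.map M⁻¹
      rw [← mapRings_mul, mul_inv_cancel, mapRings_one] at this
      rw [S.toPreGaSurface.generic_twist M⁻¹ p hp]
      exact this

end Twist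

/-! ### Translations and the choice of the origin -/

section Translation

variable {K : Type u} [Field K]

/-- The structure morphism of `𝔾ₐ² = Spec K[x, y]`. -/
def gaToK (K : Type u) [Field K] : Spec (.of (MvPolynomial (Fin 2) K)) ⟶ Spec (.of K) :=
  Spec.map (CommRingCat.ofHom (MvPolynomial.C : K →+* MvPolynomial (Fin 2) K))

theorem PreGaSurface.orbitMap_toK (S : PreGaSurface K) (p : Spec (.of K) ⟶ S.X)
    (hp : p ≫ S.toK = 𝟙 _) : S.orbitMap p ≫ S.toK = gaToK K := by
  rw [orbitMap, S.act_toK, Category.assoc, hp, Category.comp_id, gaToK]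

theorem PreGaSurface.exists_comp_orbitMap (S : PreGaSurface K) (p : Spec (.of K) ⟶ S.X)
    (b : Spec (.of K) ⟶ Spec (.of (MvPolynomial (Fin 2) K))) (hb : b ≫ gaToK K = 𝟙 _) :
    ∃ g : Fin 2 → Γ(Spec (.of K), ⊤), b ≫ S.orbitMap p = S.act g p := by
  refine ⟨fun i => b.appTop.hom
    ((Scheme.ΓSpecIso (.of (MvPolynomial (Fin 2) K))).inv.hom (MvPolynomial.X i)),
    (S.act_natural b _ _).trans ?_⟩
  rw [← Category.assoc]
  change S.act _ ((b ≫ gaToK K) ≫ p) = _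
  rw [hb, Category.id_comp]

/-- A nonempty open subset of `𝔾ₐ²` contains a `K`-point. -/
theorem exists_point_mem_opens [Infinite K]
    (U : (Spec (.of (MvPolynomial (Fin 2) K))).Opens) (hU : U.carrier.Nonempty) :
    ∃ a : Spec (.of K) ⟶ Spec (.of (MvPolynomial (Fin 2) K)), a ≫ gaToK K = 𝟙 _ ∧
      ∀ z, a z ∈ U := by
  obtain ⟨q, hq⟩ := hU
  obtain ⟨_, ⟨f, rfl⟩, hqf, hfU⟩ :=
    PrimeSpectrum.isTopologicalBasis_basic_opens.exists_subset_of_mem_open hq U.2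
  have hf : f ≠ 0 := by
    rintro rfl
    simp only [PrimeSpectrum.basicOpen_zero] at hqf
    exact hqf
  obtain ⟨a, ha⟩ : ∃ a : Fin 2 → K, MvPolynomial.eval a f ≠ 0 := by
    by_contra! h
    exact hf (MvPolynomial.funext fun a => by rw [h, map_zero])
  refine ⟨Spec.map (CommRingCat.ofHom (MvPolynomial.eval a)), ?_, fun z => hfU ?_⟩
  · rw [gaToK, ← Spec.map_comp, ← CommRingCat.ofHom_comp, ← Spec.map_id]
    congr 1
    ext c
    simp
  · change f ∉ Ideal.comap (MvPolynomial.eval a) z.asIdeal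
    rw [Ideal.mem_comap]
    intro h
    exact z.2.ne_top (Ideal.eq_top_of_isUnit_mem _ h (Ne.isUnit ha))

/-- The points of the open orbit are translates of each other: two open orbits meet, since the
surface is irreducible, and they meet in a `K`-point. -/
theorem PreGaSurface.exists_act_eq [Infinite K] (S : PreGaSurface K) (p p' : Spec (.of K) ⟶ S.X)
    (hp : p ≫ S.toK = 𝟙 _) (hp' : p' ≫ S.toK = 𝟙 _) [IsOpenImmersion (S.orbitMap p)]
    [IsOpenImmersion (S.orbitMap p')] : ∃ g, p' = S.act g p := by
  have := S.isIntegral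
  obtain ⟨_, ⟨q, rfl⟩, hq⟩ := nonempty_preirreducible_inter
    (S.orbitMap p).opensRange.2 (S.orbitMap p').opensRange.2
    (Set.range_nonempty _) (Set.range_nonempty _)
  obtain ⟨a, ha, haU⟩ := exists_point_mem_opens
    ((S.orbitMap p) ⁻¹ᵁ (S.orbitMap p').opensRange) ⟨q, hq⟩
  let b := IsOpenImmersion.lift (S.orbitMap p') (a ≫ S.orbitMap p) (by
    rintro _ ⟨z, rfl⟩
    exact haU z)
  have hb : b ≫ S.orbitMap p' = a ≫ S.orbitMap p := IsOpenImmersion.lift_fac _ _ _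
  have hb' : b ≫ gaToK K = 𝟙 _ := by
    rw [← S.orbitMap_toK p' hp', ← Category.assoc, hb, Category.assoc, S.orbitMap_toK p hp, ha]
  obtain ⟨g, hg⟩ := S.exists_comp_orbitMap p a ha
  obtain ⟨g', hg'⟩ := S.exists_comp_orbitMap p' b hb'
  refine ⟨-g' + g, ?_⟩
  rw [S.act_add, ← hg, ← hb, hg', ← S.act_add, neg_add_cancel, S.act_zero]

/-- The translation of the surface by a `K`-point of `𝔾ₐ²`. -/
def PreGaSurface.translation (S : PreGaSurface K) (g : Fin 2 → Γ(Spec (.of K), ⊤)) : S.X ≅ S.X where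
  hom := S.act (fun i => S.toK.appTop.hom (g i)) (𝟙 _)
  inv := S.act (fun i => S.toK.appTop.hom ((-g) i)) (𝟙 _)
  hom_inv_id := by
    rw [S.act_natural, Category.comp_id]
    have : (fun i => (S.act (fun i => S.toK.appTop.hom (g i)) (𝟙 _)).appTop.hom
        (S.toK.appTop.hom ((-g) i))) = -fun i => S.toK.appTop.hom (g i) := by
      ext i
      rw [← CommRingCat.comp_apply, ← Scheme.Hom.comp_appTop, S.act_toK]
      simp
    rw [this, ← S.act_add, neg_add_cancel, S.act_zero]
  inv_hom_id := by
    rw [S.act_natural, Category.comp_id]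
    have : (fun i => (S.act (fun i => S.toK.appTop.hom ((-g) i)) (𝟙 _)).appTop.hom
        (S.toK.appTop.hom (g i))) = -fun i => S.toK.appTop.hom ((-g) i) := by
      ext i
      rw [← CommRingCat.comp_apply, ← Scheme.Hom.comp_appTop, S.act_toK]
      simp
    rw [this, ← S.act_add, neg_add_cancel, S.act_zero]

theorem PreGaSurface.generic_act (S : PreGaSurface K) (p : Spec (.of K) ⟶ S.X)
    (hp : p ≫ S.toK = 𝟙 _) (g : Fin 2 → Γ(Spec (.of K), ⊤)) :
    S.generic (S.act g p) = S.generic p ≫ (S.translation g).hom := by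
  rw [generic, generic, Category.assoc]
  congr 1
  have h : (fun i => (S.orbitMap p).appTop.hom (S.toK.appTop.hom (g i))) =
      fun i => (gaToK K).appTop.hom (g i) := by
    ext i
    rw [← CommRingCat.comp_apply, ← Scheme.Hom.comp_appTop, S.orbitMap_toK p hp]
  change _ = _ ≫ S.act _ _
  rw [S.act_natural, Category.comp_id, h, orbitMap, orbitMap, S.act_natural, ← S.act_add,
    ← S.act_add, add_comm]
  rfl

/-- If `S` is a blowup `Bl(𝔽_r, ps)`, then it is also the blowup `Bl(𝔽_r', ps')` if and only if some
linear substitution takes the closed points of the one to those of the other. -/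
theorem GaSurface.isoBl_iff_of_isoBl [CharZero K] {S : GaSurface K} {r r' : ℕ}
    {ps ps' : List (CoordSeq K)} (h : S.IsoBl r ps) :
    S.IsoBl r' ps' ↔
      ∃ M : GL (Fin 2) K, mapRings M (blowupPoints r ps) = blowupPoints r' ps' := by
  obtain ⟨p, hp, hop, M, hM⟩ := (S.isoBl_iff r ps).1 h
  rw [S.isoBl_iff]
  constructor
  · rintro ⟨p', hp', hop', M', hM'⟩
    obtain ⟨g, rfl⟩ := S.exists_act_eq p p' hp hp'
    rw [S.generic_act p hp] at hM'
    have := (hM.comp_iso (S.translation g)).unique hM'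
    refine ⟨M * M'⁻¹, ?_⟩
    rw [mapRings_mul, this, ← mapRings_mul, mul_inv_cancel, mapRings_one]
  · rintro ⟨N, hN⟩
    refine ⟨p, hp, hop, N⁻¹ * M, ?_⟩
    rwa [← hN, ← mapRings_mul, ← mul_assoc, mul_inv_cancel, one_mul]

end Translation

/-! ### Local coordinates -/

section Coordinates

variable {K : Type u} [Field K]

/-- Substitution of the pair `c = (u, v)` into a polynomial. -/
def ev (c : FunField K × FunField K) : MvPolynomial (Fin 2) K →ₐ[K] FunField K :=
  MvPolynomial.aeval ![c.1, c.2]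

@[simp] theorem ev_X_zero (c : FunField K × FunField K) : ev c (MvPolynomial.X 0) = c.1 := by
  simp [ev]

@[simp] theorem ev_X_one (c : FunField K × FunField K) : ev c (MvPolynomial.X 1) = c.2 := by
  simp [ev]

@[simp] theorem ev_C (c : FunField K × FunField K) (a : K) :
    ev c (MvPolynomial.C a) = algebraMap K _ a := by
  simp [ev]

/-- The pair `c = (u, v)` generates the field `K(x, y)`; in particular `u` and `v` are
algebraically independent. -/
def IsCoord (c : FunField K × FunField K) : Prop :=
  IntermediateField.adjoin K {c.1, c.2} = ⊤

theorem x_mem_y_mem {E : IntermediateField K (FunField K)} (hx : x K ∈ E) (hy : y K ∈ E) :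
    E = ⊤ := by
  rw [eq_top_iff]
  rintro f -
  have hP : ∀ P : MvPolynomial (Fin 2) K, algebraMap _ (FunField K) P ∈ E := by
    intro P
    induction P using MvPolynomial.induction_on with
    | C a =>
      have : algebraMap _ (FunField K) (MvPolynomial.C a : MvPolynomial (Fin 2) K) =
          algebraMap K _ a :=
        (IsScalarTower.algebraMap_apply K (MvPolynomial (Fin 2) K) (FunField K) a).symm
      rw [this]
      exact E.algebraMap_mem a
    | add P Q hP hQ => rw [map_add]; exact E.add_mem hP hQ
    | mul_X P i hP =>
      rw [map_mul]
      refine E.mul_mem hP ?_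
      fin_cases i
      · exact hx
      · exact hy
  obtain ⟨P, Q, -, rfl⟩ := IsFractionRing.div_surjective (A := MvPolynomial (Fin 2) K) f
  exact E.div_mem (hP P) (hP Q)

/-- It suffices that `x` and `y` are rational functions of `u` and `v`. Such memberships in
intermediate fields are the form in which all the coordinate changes are checked. -/
theorem isCoord_of_mem {c : FunField K × FunField K}
    (h : ∀ E : IntermediateField K (FunField K), c.1 ∈ E → c.2 ∈ E → x K ∈ E ∧ y K ∈ E) :
    IsCoord c := by
  have := h (IntermediateField.adjoin K {c.1, c.2})
    (IntermediateField.subset_adjoin _ _ (by simp)) (IntermediateField.subset_adjoin _ _ (by simp))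
  exact x_mem_y_mem this.1 this.2

theorem IsCoord.of_mem {c c' : FunField K × FunField K} (hc : IsCoord c)
    (h : ∀ E : IntermediateField K (FunField K), c'.1 ∈ E → c'.2 ∈ E → c.1 ∈ E ∧ c.2 ∈ E) :
    IsCoord c' := by
  refine isCoord_of_mem fun E h1 h2 => ?_
  have : IntermediateField.adjoin K {c.1, c.2} ≤ E := by
    rw [IntermediateField.adjoin_le_iff]
    rintro _ (rfl | rfl)
    exacts [(h E h1 h2).1, (h E h1 h2).2]
  rw [hc] at this
  exact ⟨this trivial, this trivial⟩

theorem IsCoord.exists_div {c : FunField K × FunField K} (hc : IsCoord c) (f : FunField K) :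
    ∃ P Q : MvPolynomial (Fin 2) K, f = ev c P / ev c Q := by
  have h : f ∈ IntermediateField.adjoin K {c.1, c.2} := by rw [hc]; trivial
  rw [IntermediateField.mem_adjoin_iff_div] at h
  obtain ⟨a, ha, b, hb, rfl⟩ := h
  have hr : ({c.1, c.2} : Set (FunField K)) = Set.range ![c.1, c.2] := by
    simp [Matrix.range_cons, Set.pair_comm]
  rw [hr, Algebra.adjoin_range_eq_range_aeval] at ha hb
  obtain ⟨P, rfl⟩ := ha
  obtain ⟨Q, rfl⟩ := hb
  exact ⟨P, Q, rfl⟩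

/-- Two generators of a field of transcendence degree two are algebraically independent. -/
theorem IsCoord.ev_injective {c : FunField K × FunField K} (hc : IsCoord c) :
    Function.Injective (ev c) := by
  have h1 : AlgebraicIndependent K ![x K, y K] := by
    have : (MvPolynomial.aeval ![x K, y K] : MvPolynomial (Fin 2) K →ₐ[K] FunField K) =
        IsScalarTower.toAlgHom K (MvPolynomial (Fin 2) K) (FunField K) := by
      refine MvPolynomial.algHom_ext fun i => ?_
      fin_cases i <;> simp [x, y]
    rw [AlgebraicIndependent, this]
    exact IsFractionRing.injective (MvPolynomial (Fin 2) K) (FunField K)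
  have h2 : Algebra.IsAlgebraic (Algebra.adjoin K (Set.range ![c.1, c.2])) (FunField K) := by
    refine ⟨fun f => ?_⟩
    obtain ⟨P, Q, rfl⟩ := hc.exists_div f
    have h : ∀ P, IsAlgebraic (Algebra.adjoin K (Set.range ![c.1, c.2])) (ev c P) := by
      intro P
      have hm : ev c P ∈ Algebra.adjoin K (Set.range ![c.1, c.2]) := by
        rw [Algebra.adjoin_range_eq_range_aeval]
        exact ⟨P, rfl⟩
      exact isAlgebraic_algebraMap (⟨ev c P, hm⟩ : Algebra.adjoin K (Set.range ![c.1, c.2]))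
    rw [div_eq_mul_inv]
    exact (h P).mul (h Q).inv
  have h3 := h1.lift_cardinalMk_le_trdeg
  exact (Algebra.IsAlgebraic.isTranscendenceBasis_of_lift_le_trdeg_of_finite K ![c.1, c.2] h3).1

theorem IsCoord.ev_ne_zero {c : FunField K × FunField K} (hc : IsCoord c)
    {P : MvPolynomial (Fin 2) K} (hP : P ≠ 0) : ev c P ≠ 0 := fun h =>
  hP (hc.ev_injective (h.trans (map_zero _).symm))

theorem IsCoord.fst_ne_zero {c : FunField K × FunField K} (hc : IsCoord c) : c.1 ≠ 0 := by
  have := hc.ev_ne_zero (MvPolynomial.X_ne_zero (0 : Fin 2))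
  rwa [ev_X_zero] at this

theorem IsCoord.snd_ne_zero {c : FunField K × FunField K} (hc : IsCoord c) : c.2 ≠ 0 := by
  have := hc.ev_ne_zero (MvPolynomial.X_ne_zero (1 : Fin 2))
  rwa [ev_X_one] at this

theorem isCoord_x_y : IsCoord (x K, y K) := isCoord_of_mem fun _ hx hy => ⟨hx, hy⟩

theorem x_ne_zero : x K ≠ 0 := (isCoord_x_y (K := K)).fst_ne_zero
theorem y_ne_zero : y K ≠ 0 := (isCoord_x_y (K := K)).snd_ne_zero

theorem IsCoord.sub_const {c : FunField K × FunField K} (hc : IsCoord c) (a b : K) :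
    IsCoord (c.1 - algebraMap K _ a, c.2 - algebraMap K _ b) :=
  hc.of_mem fun E h1 h2 => by
    constructor
    · simpa using E.add_mem h1 (E.algebraMap_mem a)
    · simpa using E.add_mem h2 (E.algebraMap_mem b)

theorem IsCoord.div_snd {c : FunField K × FunField K} (hc : IsCoord c) :
    IsCoord (c.1 / c.2, c.2) :=
  hc.of_mem fun E h1 h2 => by
    refine ⟨?_, h2⟩
    simpa [hc.snd_ne_zero] using E.mul_mem h1 h2

theorem next_infty (c : FunField K × FunField K) : next c ∞ = (c.1, c.2 / c.1) := rfl

theorem next_coe (c : FunField K × FunField K) (q : K) :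
    next c (q : OnePoint K) = (c.1 / c.2 - algebraMap K _ q, c.2) := rfl

theorem IsCoord.next {c : FunField K × FunField K} (hc : IsCoord c) (q : OnePoint K) :
    IsCoord (next c q) := by
  induction q using OnePoint.rec with
  | infty =>
    refine hc.of_mem fun E h1 h2 => ⟨h1, ?_⟩
    rw [next_infty] at h1 h2
    have := E.mul_mem h1 h2
    rwa [mul_div_cancel₀ _ hc.fst_ne_zero] at this
  | coe q =>
    have := hc.div_snd.sub_const q 0
    simpa [next_coe] using this

theorem isCoord_fiber (r : ℕ) (q : K) :
    IsCoord (x K / y K ^ r - algebraMap K _ q, 1 / y K) :=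
  isCoord_of_mem fun E h1 h2 => by
    have hy : y K ∈ E := by simpa using E.inv_mem h2
    refine ⟨?_, hy⟩
    have := E.mul_mem (E.add_mem h1 (E.algebraMap_mem q)) (pow_mem hy r)
    rwa [sub_add_cancel, div_mul_cancel₀ _ (pow_ne_zero r y_ne_zero)] at this

theorem isCoord_coords (r : ℕ) (p : CoordSeq K) : IsCoord (coords r p) := by
  obtain ⟨q, l⟩ := p
  induction l using List.reverseRecOn with
  | nil => exact isCoord_fiber r q
  | append_singleton l a ih =>
    rw [coords, List.foldl_append]
    exact ih.next a

theorem coords_append (r : ℕ) (q : K) (l : List (OnePoint K)) (a : OnePoint K) :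
    coords r (q, l ++ [a]) = next (coords r (q, l)) a := by
  simp [coords, List.foldl_append]

theorem isCoord_section : IsCoord (1 / x K, y K) :=
  isCoord_of_mem fun E h1 h2 => ⟨by simpa using E.inv_mem h1, h2⟩

theorem isCoord_corner (r : ℕ) : IsCoord (y K ^ r / x K, 1 / y K) :=
  isCoord_of_mem fun E h1 h2 => by
    have hy : y K ∈ E := by simpa using E.inv_mem h2
    refine ⟨?_, hy⟩
    have := E.mul_mem (E.inv_mem h1) (pow_mem hy r)
    rwa [inv_div, div_mul_cancel₀ _ (pow_ne_zero r y_ne_zero)] at this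

end Coordinates

/-! ### Values of functions at a point -/

section Values

variable {K : Type u} [Field K] {c c' : FunField K × FunField K} {f g : FunField K} {k l : K}

/-- The function `f` is regular at the point with local coordinates `c`, and takes there the
value `k`. -/
def Reg (c : FunField K × FunField K) (f : FunField K) (k : K) : Prop :=
  ∃ P Q : MvPolynomial (Fin 2) K, MvPolynomial.constantCoeff Q ≠ 0 ∧
    MvPolynomial.constantCoeff P = k * MvPolynomial.constantCoeff Q ∧ f * ev c Q = ev c P

theorem mem_localRing_iff : f ∈ localRing c ↔ ∃ k, Reg c f k := by
  constructor
  · rintro ⟨P, Q, hQ, h⟩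
    exact ⟨MvPolynomial.constantCoeff P / MvPolynomial.constantCoeff Q, P, Q, hQ,
      by rw [div_mul_cancel₀ _ hQ], h⟩
  · rintro ⟨k, P, Q, hQ, -, h⟩
    exact ⟨P, Q, hQ, h⟩

theorem Reg.mem (h : Reg c f k) : f ∈ localRing c := mem_localRing_iff.2 ⟨k, h⟩

theorem Reg.add (hf : Reg c f k) (hg : Reg c g l) : Reg c (f + g) (k + l) := by
  obtain ⟨P, Q, hQ, hP, h⟩ := hf
  obtain ⟨P', Q', hQ', hP', h'⟩ := hg
  refine ⟨P * Q' + P' * Q, Q * Q', by simp [hQ, hQ'], ?_, ?_⟩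
  · simp only [map_add, map_mul, hP, hP']; ring
  · rw [map_add, map_mul, map_mul, map_mul, ← h, ← h']; ring

theorem Reg.mul (hf : Reg c f k) (hg : Reg c g l) : Reg c (f * g) (k * l) := by
  obtain ⟨P, Q, hQ, hP, h⟩ := hf
  obtain ⟨P', Q', hQ', hP', h'⟩ := hg
  refine ⟨P * P', Q * Q', by simp [hQ, hQ'], ?_, ?_⟩
  · simp only [map_mul, hP, hP']; ring
  · rw [map_mul, map_mul, ← h, ← h']; ring

theorem reg_const (c : FunField K × FunField K) (a : K) : Reg c (algebraMap K _ a) a :=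
  ⟨MvPolynomial.C a, 1, by simp, by simp, by simp⟩

theorem reg_fst (c : FunField K × FunField K) : Reg c c.1 0 :=
  ⟨MvPolynomial.X 0, 1, by simp, by simp, by simp⟩

theorem reg_snd (c : FunField K × FunField K) : Reg c c.2 0 :=
  ⟨MvPolynomial.X 1, 1, by simp, by simp, by simp⟩

theorem reg_one (c : FunField K × FunField K) : Reg c 1 1 := by
  simpa using reg_const c (1 : K)

theorem Reg.neg (hf : Reg c f k) : Reg c (-f) (-k) := by
  simpa using (reg_const c (-1)).mul hf

theorem Reg.sub (hf : Reg c f k) (hg : Reg c g l) : Reg c (f - g) (k - l) := by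
  rw [sub_eq_add_neg, sub_eq_add_neg]
  exact hf.add hg.neg

theorem Reg.pow (hf : Reg c f k) (n : ℕ) : Reg c (f ^ n) (k ^ n) := by
  induction n with
  | zero => simpa using reg_one c
  | succ n ih => rw [pow_succ, pow_succ]; exact ih.mul hf

theorem Reg.congr (hf : Reg c f k) (hfg : g = f) (hkl : l = k) : Reg c g l := by
  rw [hfg, hkl]
  exact hf

theorem ne_zero_of_constantCoeff_ne_zero {P : MvPolynomial (Fin 2) K}
    (hP : MvPolynomial.constantCoeff P ≠ 0) : P ≠ 0 := by
  rintro rfl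
  simp at hP

/-- The point is a local ring: a function with nonzero value is a unit. -/
theorem Reg.inv (hc : IsCoord c) (hf : Reg c f k) (hk : k ≠ 0) : Reg c f⁻¹ k⁻¹ := by
  obtain ⟨P, Q, hQ, hP, h⟩ := hf
  have hP' : MvPolynomial.constantCoeff P ≠ 0 := by rw [hP]; exact mul_ne_zero hk hQ
  refine ⟨Q, P, hP', by rw [hP, inv_mul_cancel_left₀ hk], ?_⟩
  have hf : f ≠ 0 := by
    rintro rfl
    rw [zero_mul] at h
    exact hc.ev_ne_zero (ne_zero_of_constantCoeff_ne_zero hP') h.symm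
  rw [← h, inv_mul_cancel_left₀ hf]

theorem Reg.div (hc : IsCoord c) (hf : Reg c f k) (hg : Reg c g l) (hl : l ≠ 0) :
    Reg c (f / g) (k / l) := by
  rw [div_eq_mul_inv, div_eq_mul_inv]
  exact hf.mul (hg.inv hc hl)

theorem Reg.unique (hc : IsCoord c) (hf : Reg c f k) (hf' : Reg c f l) : k = l := by
  obtain ⟨P, Q, hQ, hP, h⟩ := hf
  obtain ⟨P', Q', hQ', hP', h'⟩ := hf'
  have h2 : ev c (P * Q') = ev c (P' * Q) := by
    rw [map_mul, map_mul, ← h, ← h']; ring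
  have h3 := congrArg MvPolynomial.constantCoeff (hc.ev_injective h2)
  rw [map_mul, map_mul, hP, hP'] at h3
  have h4 : (k - l) * (MvPolynomial.constantCoeff Q * MvPolynomial.constantCoeff Q') = 0 := by
    linear_combination h3
  exact sub_eq_zero.1 ((mul_eq_zero.1 h4).resolve_right (mul_ne_zero hQ hQ'))

theorem Reg.ev (h1 : Reg c c'.1 0) (h2 : Reg c c'.2 0) (P : MvPolynomial (Fin 2) K) :
    Reg c (ev c' P) (MvPolynomial.constantCoeff P) := by
  induction P using MvPolynomial.induction_on with
  | C a => simpa using reg_const c a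
  | add P Q hP hQ => rw [map_add, map_add]; exact hP.add hQ
  | mul_X P i hP =>
    rw [map_mul, map_mul, MvPolynomial.constantCoeff_X]
    refine hP.mul ?_
    fin_cases i
    · simpa using h1
    · simpa using h2

/-- If the coordinates `c'` are regular and vanish at the point with coordinates `c`, then that
point lies over the point with coordinates `c'`. -/
theorem Reg.trans (hc : IsCoord c) (h1 : Reg c c'.1 0) (h2 : Reg c c'.2 0) (hf : Reg c' f k) :
    Reg c f k := by
  obtain ⟨P, Q, hQ, hP, h⟩ := hf
  have hQ' := Reg.ev h1 h2 Q
  have h0 : GaSurfaces.ev c' Q ≠ 0 := by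
    intro h0
    rw [h0] at hQ'
    exact hQ (hQ'.unique hc (by simpa using reg_const c (0 : K)))
  refine ((Reg.ev h1 h2 P).div hc hQ' hQ).congr ?_ ?_
  · rw [← h, mul_div_cancel_right₀ _ h0]
  · rw [hP, mul_div_cancel_right₀ _ hQ]

theorem localRing_le (hc : IsCoord c) (h1 : Reg c c'.1 0) (h2 : Reg c c'.2 0) :
    localRing c' ≤ localRing c := fun _ hf => by
  obtain ⟨k, hk⟩ := mem_localRing_iff.1 hf
  exact (Reg.trans hc h1 h2 hk).mem

theorem localRing_eq (hc : IsCoord c) (hc' : IsCoord c') (h1 : Reg c c'.1 0) (h2 : Reg c c'.2 0)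
    (h1' : Reg c' c.1 0) (h2' : Reg c' c.2 0) : localRing c' = localRing c :=
  (localRing_le hc h1 h2).antisymm (localRing_le hc' h1' h2')

/-- Functions have the same value in a local ring and in a larger one with the same
residue field. -/
theorem Reg.eq_of_le (hc : IsCoord c) (hc' : IsCoord c') (hle : localRing c ≤ localRing c')
    (hf : Reg c f k) (hf' : Reg c' f l) : k = l := by
  by_contra hne
  have h1 : Reg c (f - algebraMap K _ l) (k - l) := hf.sub (reg_const c l)
  have h2 : Reg c' (f - algebraMap K _ l) 0 := by
    simpa using hf'.sub (reg_const c' l)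
  have h3 := h1.inv hc (sub_ne_zero.2 hne)
  obtain ⟨m, hm⟩ := mem_localRing_iff.1 (hle h3.mem)
  have h4 := h2.mul hm
  rw [mul_inv_cancel₀, zero_mul] at h4
  · exact one_ne_zero ((reg_one c').unique hc' h4)
  · intro h0
    rw [h0] at h1
    exact sub_ne_zero.2 hne (h1.unique hc (by simpa using reg_const c (0 : K)))

theorem Reg.of_localRing_eq (hc : IsCoord c) (hc' : IsCoord c') (h : localRing c = localRing c')
    (hf : Reg c f k) : Reg c' f k := by
  obtain ⟨l, hl⟩ := mem_localRing_iff.1 (h ▸ hf.mem)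
  rwa [hf.eq_of_le hc hc' h.le hl]

/-- The image of a pair of functions under a field automorphism. -/
def mapPair (σ : FunField K ≃ₐ[K] FunField K) (c : FunField K × FunField K) :
    FunField K × FunField K := (σ c.1, σ c.2)

theorem map_ev (σ : FunField K ≃ₐ[K] FunField K) (c : FunField K × FunField K)
    (P : MvPolynomial (Fin 2) K) : σ (ev c P) = ev (mapPair σ c) P := by
  have : (σ : FunField K →ₐ[K] FunField K).comp (ev c) = ev (mapPair σ c) := by
    refine MvPolynomial.algHom_ext fun i => ?_
    fin_cases i <;> simp [mapPair]
  exact congrArg (fun φ => φ P) this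

theorem map_localRing (σ : FunField K ≃ₐ[K] FunField K) (c : FunField K × FunField K) :
    (localRing c).map (σ : FunField K →+* FunField K) = localRing (mapPair σ c) := by
  ext f
  constructor
  · rintro ⟨g, ⟨P, Q, hQ, h⟩, rfl⟩
    refine ⟨P, Q, hQ, ?_⟩
    have := congrArg σ h
    change σ (g * ev c Q) = σ (ev c P) at this
    rwa [map_mul, map_ev, map_ev] at this
  · rintro ⟨P, Q, hQ, h⟩
    refine ⟨σ.symm f, ⟨P, Q, hQ, ?_⟩, σ.apply_symm_apply f⟩
    apply σ.injective
    change σ (σ.symm f * ev c Q) = σ (ev c P)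
    rw [map_mul, map_ev, map_ev, σ.apply_symm_apply]
    exact h

theorem IsCoord.map (hc : IsCoord c) (σ : FunField K ≃ₐ[K] FunField K) :
    IsCoord (mapPair σ c) := by
  refine eq_top_iff.2 fun f _ => ?_
  obtain ⟨P, Q, h⟩ := hc.exists_div (σ.symm f)
  have h' := congrArg σ h
  rw [σ.apply_symm_apply, map_div₀, map_ev, map_ev] at h'
  have key : ∀ P, GaSurfaces.ev (mapPair σ c) P ∈
      IntermediateField.adjoin K {(mapPair σ c).1, (mapPair σ c).2} := by
    intro P
    induction P using MvPolynomial.induction_on with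
    | C a => rw [ev_C]; exact IntermediateField.algebraMap_mem _ a
    | add P Q hP hQ => rw [map_add]; exact add_mem hP hQ
    | mul_X P i hP =>
      rw [map_mul]
      refine mul_mem hP (IntermediateField.subset_adjoin _ _ ?_)
      fin_cases i <;> simp
  rw [h']
  exact div_mem (key P) (key Q)

end Values

/-! ### Orders of functions along a curve -/

section Orders

variable {K : Type u} [Field K] {c c' : FunField K × FunField K} {f g : FunField K} {m n : ℤ}

/-- The restriction of a polynomial in `u, v` to the curve `v = 0`. -/
def restr (K : Type u) [Field K] : MvPolynomial (Fin 2) K →ₐ[K] Polynomial K :=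
  MvPolynomial.aeval ![Polynomial.X, 0]

@[simp] theorem restr_X_zero : restr K (MvPolynomial.X 0) = Polynomial.X := by simp [restr]

@[simp] theorem restr_X_one : restr K (MvPolynomial.X 1) = 0 := by simp [restr]

@[simp] theorem restr_C (a : K) : restr K (MvPolynomial.C a) = Polynomial.C a := by
  simp [restr]

theorem X_one_dvd_of_restr_eq_zero {P : MvPolynomial (Fin 2) K} (h : restr K P = 0) :
    MvPolynomial.X 1 ∣ P := by
  have key : ∀ P : MvPolynomial (Fin 2) K,
      MvPolynomial.X 1 ∣ P - Polynomial.aeval (MvPolynomial.X 0) (restr K P) := by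
    intro P
    induction P using MvPolynomial.induction_on with
    | C a => simp
    | add P Q hP hQ =>
      rw [map_add, map_add, add_sub_add_comm]
      exact dvd_add hP hQ
    | mul_X P i hP =>
      rw [map_mul, map_mul]
      fin_cases i
      · simpa [← sub_mul] using hP.mul_right _
      · simp
  simpa [h] using key P

theorem restr_C_mul_X_add_C_ne_zero {a b : K} (h : a ≠ 0 ∨ b ≠ 0) :
    restr K (MvPolynomial.C a * MvPolynomial.X 0 + MvPolynomial.C b) ≠ 0 := by
  simp only [map_add, map_mul, restr_C, restr_X_zero]
  intro h0
  have h1 := congrArg (fun p => p.coeff 1) h0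
  have h2 := congrArg (fun p => p.coeff 0) h0
  simp at h1 h2
  simp_all

/-- The local ring of the curve `v = 0` in the plane with coordinates `c = (u, v)`: it consists of
the fractions `P(u, v) / Q(u, v)` with `Q(u, 0) ≠ 0`. -/
def divRing (c : FunField K × FunField K) : Subring (FunField K) where
  carrier := {f | ∃ P Q : MvPolynomial (Fin 2) K, restr K Q ≠ 0 ∧ f * ev c Q = ev c P}
  mul_mem' := by
    rintro f g ⟨P, Q, hQ, h⟩ ⟨P', Q', hQ', h'⟩
    refine ⟨P * P', Q * Q', by simp [hQ, hQ'], ?_⟩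
    rw [map_mul, map_mul, ← h, ← h']; ring
  one_mem' := ⟨1, 1, by simp, by simp⟩
  add_mem' := by
    rintro f g ⟨P, Q, hQ, h⟩ ⟨P', Q', hQ', h'⟩
    refine ⟨P * Q' + P' * Q, Q * Q', by simp [hQ, hQ'], ?_⟩
    rw [map_add, map_mul, map_mul, map_mul, ← h, ← h']; ring
  zero_mem' := ⟨0, 1, by simp, by simp⟩
  neg_mem' := by
    rintro f ⟨P, Q, hQ, h⟩
    exact ⟨-P, Q, hQ, by rw [map_neg, ← h]; ring⟩

/-- The function `f` has order exactly `n` along the curve `v = 0`, where `c = (u, v)`. -/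
def Ord (c : FunField K × FunField K) (f : FunField K) (n : ℤ) : Prop :=
  ∃ P Q : MvPolynomial (Fin 2) K, restr K P ≠ 0 ∧ restr K Q ≠ 0 ∧ f * ev c Q = c.2 ^ n * ev c P

/-- The function `f` has order at least `n` along the curve `v = 0`, where `c = (u, v)`. -/
def OrdGE (c : FunField K × FunField K) (f : FunField K) (n : ℤ) : Prop :=
  ∃ P Q : MvPolynomial (Fin 2) K, restr K Q ≠ 0 ∧ f * ev c Q = c.2 ^ n * ev c P

theorem ne_zero_of_restr_ne_zero {P : MvPolynomial (Fin 2) K} (h : restr K P ≠ 0) : P ≠ 0 := by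
  rintro rfl
  simp at h

theorem Ord.ge (h : Ord c f n) : OrdGE c f n := by
  obtain ⟨P, Q, -, hQ, h⟩ := h
  exact ⟨P, Q, hQ, h⟩

theorem mem_divRing_iff : f ∈ divRing c ↔ OrdGE c f 0 := by
  constructor
  · rintro ⟨P, Q, hQ, h⟩
    exact ⟨P, Q, hQ, by simpa using h⟩
  · rintro ⟨P, Q, hQ, h⟩
    exact ⟨P, Q, hQ, by simpa using h⟩

theorem Ord.ne_zero (hc : IsCoord c) (h : Ord c f n) : f ≠ 0 := by
  rintro rfl
  obtain ⟨P, Q, hP, -, h⟩ := h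
  rw [zero_mul] at h
  exact mul_ne_zero (zpow_ne_zero n hc.snd_ne_zero)
    (hc.ev_ne_zero (ne_zero_of_restr_ne_zero hP)) h.symm

theorem OrdGE.add (hf : OrdGE c f n) (hg : OrdGE c g n) :
    OrdGE c (f + g) n := by
  obtain ⟨P, Q, hQ, h⟩ := hf
  obtain ⟨P', Q', hQ', h'⟩ := hg
  refine ⟨P * Q' + P' * Q, Q * Q', by simp [hQ, hQ'], ?_⟩
  simp only [map_add, map_mul]
  linear_combination ev c Q' * h + ev c Q * h'

theorem OrdGE.mul (hc : IsCoord c) (hf : OrdGE c f m) (hg : OrdGE c g n) :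
    OrdGE c (f * g) (m + n) := by
  obtain ⟨P, Q, hQ, h⟩ := hf
  obtain ⟨P', Q', hQ', h'⟩ := hg
  refine ⟨P * P', Q * Q', by simp [hQ, hQ'], ?_⟩
  rw [zpow_add₀ hc.snd_ne_zero, map_mul, map_mul, mul_mul_mul_comm, h, h']
  ring

theorem OrdGE.mono (hc : IsCoord c) (hf : OrdGE c f n) (hmn : m ≤ n) : OrdGE c f m := by
  obtain ⟨P, Q, hQ, h⟩ := hf
  obtain ⟨d, rfl⟩ := Int.le.dest hmn
  refine ⟨P * MvPolynomial.X 1 ^ d, Q, hQ, ?_⟩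
  rw [h, zpow_add₀ hc.snd_ne_zero, map_mul, map_pow, ev_X_one, zpow_natCast]
  ring

theorem Ord.mul (hc : IsCoord c) (hf : Ord c f m) (hg : Ord c g n) : Ord c (f * g) (m + n) := by
  obtain ⟨P, Q, hP, hQ, h⟩ := hf
  obtain ⟨P', Q', hP', hQ', h'⟩ := hg
  refine ⟨P * P', Q * Q', by simp [hP, hP'], by simp [hQ, hQ'], ?_⟩
  rw [zpow_add₀ hc.snd_ne_zero, map_mul, map_mul, mul_mul_mul_comm, h, h']
  ring

theorem Ord.inv (hc : IsCoord c) (hf : Ord c f n) : Ord c f⁻¹ (-n) := by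
  have hf0 := hf.ne_zero hc
  obtain ⟨P, Q, hP, hQ, h⟩ := hf
  refine ⟨Q, P, hQ, hP, ?_⟩
  have := zpow_ne_zero n hc.snd_ne_zero
  rw [zpow_neg]
  field_simp
  rw [h]
  ring

theorem Ord.pow (hc : IsCoord c) (hf : Ord c f n) (k : ℕ) : Ord c (f ^ k) (k * n) := by
  induction k with
  | zero => exact ⟨1, 1, by simp, by simp, by simp⟩
  | succ k ih =>
    have := ih.mul hc hf
    rw [pow_succ]
    convert this using 1
    push_cast
    ring

theorem Ord.congr (hf : Ord c f n) (hfg : g = f) (hmn : m = n) : Ord c g m := by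
  rw [hfg, hmn]; exact hf

theorem OrdGE.congr (hf : OrdGE c f n) (hfg : g = f) (hmn : m = n) : OrdGE c g m := by
  rw [hfg, hmn]; exact hf

theorem Ord.div (hc : IsCoord c) (hf : Ord c f m) (hg : Ord c g n) : Ord c (f / g) (m - n) := by
  rw [div_eq_mul_inv, sub_eq_add_neg]
  exact hf.mul hc (hg.inv hc)

/-- A nonconstant linear polynomial in the coordinate `u` of the curve `v = 0`, or a nonzero
constant, does not vanish along this curve. -/
theorem ord_linear (c : FunField K × FunField K) {a b : K} (h : a ≠ 0 ∨ b ≠ 0) :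
    Ord c (algebraMap K _ a * c.1 + algebraMap K _ b) 0 :=
  ⟨_, 1, restr_C_mul_X_add_C_ne_zero h, by simp, by simp⟩

theorem ord_const (c : FunField K × FunField K) {a : K} (h : a ≠ 0) :
    Ord c (algebraMap K _ a) 0 := by
  simpa using ord_linear c (a := 0) (Or.inr h)

theorem ord_fst (c : FunField K × FunField K) : Ord c c.1 0 := by
  simpa using ord_linear c (a := 1) (b := 0) (by simp)

theorem ord_snd (c : FunField K × FunField K) : Ord c c.2 1 :=
  ⟨1, 1, by simp, by simp, by simp⟩

theorem ordGE_const (c : FunField K × FunField K) (a : K) : OrdGE c (algebraMap K _ a) 0 :=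
  ⟨MvPolynomial.C a, 1, by simp, by simp⟩

theorem OrdGE.neg (hf : OrdGE c f n) : OrdGE c (-f) n := by
  obtain ⟨P, Q, hQ, h⟩ := hf
  exact ⟨-P, Q, hQ, by rw [map_neg, neg_mul, h, mul_neg]⟩

theorem OrdGE.const_mul (hc : IsCoord c) (hf : OrdGE c f n) (a : K) :
    OrdGE c (algebraMap K _ a * f) n :=
  ((ordGE_const c a).mul hc hf).congr rfl (zero_add n).symm

theorem Ord.const_mul (hc : IsCoord c) (hf : Ord c f n) {a : K} (ha : a ≠ 0) :
    Ord c (algebraMap K _ a * f) n :=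
  ((ord_const c ha).mul hc hf).congr rfl (zero_add n).symm

theorem Ord.add_of_ge (hc : IsCoord c) (hf : Ord c f n) (hg : OrdGE c g (n + 1)) :
    Ord c (f + g) n := by
  obtain ⟨P, Q, hP, hQ, h⟩ := hf
  obtain ⟨P', Q', hQ', h'⟩ := hg
  refine ⟨P * Q' + MvPolynomial.X 1 * P' * Q, Q * Q', by simp [hP, hQ'], by simp [hQ, hQ'], ?_⟩
  rw [zpow_add₀ hc.snd_ne_zero, zpow_one] at h'
  simp only [map_add, map_mul, ev_X_one]
  linear_combination ev c Q' * h + ev c Q * h'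

theorem Ord.add_of_lt (hc : IsCoord c) (hf : Ord c f n) (hg : Ord c g m) (h : n < m) :
    Ord c (f + g) n :=
  hf.add_of_ge hc (hg.ge.mono hc h)

theorem Ord.le_of_ge (hc : IsCoord c) (hf : Ord c f n) (hf' : OrdGE c f m) : m ≤ n := by
  by_contra! hlt
  obtain ⟨P, Q, hP, hQ, h⟩ := hf
  obtain ⟨P', Q', hQ', h'⟩ := hf'
  obtain ⟨d, hd⟩ := Int.le.dest (Int.add_one_le_of_lt hlt)
  have h2 : c.2 ^ n * ev c (P * Q') = c.2 ^ n * ev c (MvPolynomial.X 1 ^ (d + 1) * P' * Q) := by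
    have e : c.2 ^ m = c.2 ^ n * c.2 ^ (d + 1) := by
      rw [← hd, zpow_add₀ hc.snd_ne_zero, zpow_add₀ hc.snd_ne_zero, zpow_natCast, zpow_one,
        pow_succ]
      ring
    rw [e] at h'
    simp only [map_mul, map_pow, ev_X_one]
    linear_combination ev c Q * h' - ev c Q' * h
  have h3 := hc.ev_injective (mul_left_cancel₀ (zpow_ne_zero n hc.snd_ne_zero) h2)
  have h4 := congrArg (restr K) h3
  simp [hP, hQ'] at h4

theorem Ord.unique (hc : IsCoord c) (hf : Ord c f n) (hf' : Ord c f m) : n = m :=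
  (hf'.le_of_ge hc hf.ge).antisymm (hf.le_of_ge hc hf'.ge)

/-- Every nonzero polynomial is a power of `v` times a polynomial that is not divisible by `v`. -/
theorem exists_ord (hc : IsCoord c) (hf : f ≠ 0) : ∃ n, Ord c f n := by
  have hpol : ∀ P : MvPolynomial (Fin 2) K, P ≠ 0 → ∃ n, Ord c (ev c P) n := by
    intro P hP
    obtain ⟨n, Q, hQ, rfl⟩ := WfDvdMonoid.max_power_factor hP
      (MvPolynomial.X_prime (R := K) (i := (1 : Fin 2))).irreducible
    refine ⟨n, Q, 1, fun h => hQ (X_one_dvd_of_restr_eq_zero h), by simp, ?_⟩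
    rw [map_one, mul_one, map_mul, map_pow, ev_X_one, zpow_natCast]
  obtain ⟨P, Q, rfl⟩ := hc.exists_div f
  obtain ⟨n, hn⟩ := hpol P (by rintro rfl; simp at hf)
  obtain ⟨m, hm⟩ := hpol Q (by rintro rfl; simp at hf)
  exact ⟨_, hn.div hc hm⟩

/-- The ring `divRing c` is a discrete valuation ring, and thus a maximal proper subring. -/
theorem eq_divRing_of_le (hc : IsCoord c) {V : Subring (FunField K)} (h : divRing c ≤ V)
    (hV : ∃ f, f ∉ V) : V = divRing c := by
  refine le_antisymm (fun f hf => ?_) h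
  by_contra hf'
  have hf0 : f ≠ 0 := by
    rintro rfl
    exact hf' (divRing c).zero_mem
  obtain ⟨n, hn⟩ := exists_ord hc hf0
  have hn0 : n < 0 := by
    by_contra! h0
    exact hf' (mem_divRing_iff.2 (hn.ge.mono hc h0))
  have hv : c.2⁻¹ ∈ V := by
    have h1 : f⁻¹ * c.2⁻¹ ∈ divRing c :=
      mem_divRing_iff.2 (((hn.inv hc).mul hc ((ord_snd c).inv hc)).ge.mono hc (by omega))
    have := V.mul_mem hf (h h1)
    rwa [mul_inv_cancel_left₀ hf0] at this
  obtain ⟨g, hg⟩ := hV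
  have hg0 : g ≠ 0 := by
    rintro rfl
    exact hg V.zero_mem
  obtain ⟨m, hm⟩ := exists_ord hc hg0
  have h1 : g * c.2 ^ m.natAbs ∈ divRing c :=
    mem_divRing_iff.2 ((hm.mul hc ((ord_snd c).pow hc m.natAbs)).ge.mono hc (by omega))
  have := V.mul_mem (h h1) (V.pow_mem hv m.natAbs)
  rw [mul_assoc, inv_pow, mul_inv_cancel₀ (pow_ne_zero _ hc.snd_ne_zero), mul_one] at this
  exact hg this

theorem ord_zero_iff (hc : IsCoord c) :
    Ord c f 0 ↔ f ≠ 0 ∧ f ∈ divRing c ∧ f⁻¹ ∈ divRing c := by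
  constructor
  · intro h
    exact ⟨h.ne_zero hc, mem_divRing_iff.2 h.ge, mem_divRing_iff.2 (h.inv hc).ge⟩
  · rintro ⟨h0, h1, h2⟩
    obtain ⟨n, hn⟩ := exists_ord hc h0
    have e1 := hn.le_of_ge hc (mem_divRing_iff.1 h1)
    have e2 := (hn.inv hc).le_of_ge hc (mem_divRing_iff.1 h2)
    exact hn.congr rfl (by omega)

/-- The order along a curve is determined by the local ring of the curve. -/
theorem Ord.of_divRing_eq (hc : IsCoord c) (hc' : IsCoord c') (h : divRing c = divRing c')
    (hf : Ord c f n) : Ord c' f n := by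
  have unit : ∀ {g}, Ord c g 0 → Ord c' g 0 := by
    intro g hg
    rw [ord_zero_iff hc] at hg
    rw [ord_zero_iff hc', ← h]
    exact hg
  have unit' : ∀ {g}, Ord c' g 0 → Ord c g 0 := by
    intro g hg
    rw [ord_zero_iff hc'] at hg
    rw [ord_zero_iff hc, h]
    exact hg
  obtain ⟨m, hm⟩ := exists_ord hc hc'.snd_ne_zero
  obtain ⟨l, hl⟩ := exists_ord hc' hc.snd_ne_zero
  have hm1 : 1 ≤ m := by
    have h1 : 0 ≤ m := hm.le_of_ge hc (mem_divRing_iff.1 (h ▸ mem_divRing_iff.2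
      ((ord_snd c').ge.mono hc' (by norm_num))))
    by_contra! h2
    have := (unit (hm.congr rfl (by omega))).unique hc' (ord_snd c')
    omega
  have hl1 : 1 ≤ l := by
    have h1 : 0 ≤ l := hl.le_of_ge hc' (mem_divRing_iff.1 (h ▸ mem_divRing_iff.2
      ((ord_snd c).ge.mono hc (by norm_num))))
    by_contra! h2
    have := (unit' (hl.congr rfl (by omega))).unique hc (ord_snd c)
    omega
  -- `v'` is a unit times `v ^ m`, so its order `1` is the product of `m` and the order of `v`
  have hu : Ord c (c'.2 / c.2 ^ m.toNat) 0 :=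
    (hm.div hc ((ord_snd c).pow hc m.toNat)).congr rfl (by omega)
  have h3 := (unit hu).mul hc' (hl.pow hc' m.toNat)
  rw [div_mul_cancel₀ _ (pow_ne_zero _ hc.snd_ne_zero)] at h3
  have h4 := h3.unique hc' (ord_snd c')
  rw [Int.toNat_of_nonneg (by omega), zero_add] at h4
  have hl' : l = 1 := by nlinarith
  subst hl'
  have key : ∀ k : ℕ, Ord c (f * c.2 ^ k) 0 → Ord c' f (-k) := fun k hk => by
    have := (unit hk).div hc' (hl.pow hc' k)
    rw [mul_div_cancel_right₀ _ (pow_ne_zero _ hc.snd_ne_zero)] at this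
    exact this.congr rfl (by simp)
  have key' : ∀ k : ℕ, Ord c (f / c.2 ^ k) 0 → Ord c' f k := fun k hk => by
    have := (unit hk).mul hc' (hl.pow hc' k)
    rw [div_mul_cancel₀ _ (pow_ne_zero _ hc.snd_ne_zero)] at this
    exact this.congr rfl (by simp)
  rcases le_total 0 n with h0 | h0
  · exact (key' n.toNat ((hf.div hc ((ord_snd c).pow hc _)).congr rfl (by omega))).congr rfl
      (by omega)
  · exact (key n.natAbs ((hf.mul hc ((ord_snd c).pow hc _)).congr rfl (by omega))).congr rfl
      (by omega)

theorem map_divRing (σ : FunField K ≃ₐ[K] FunField K) (c : FunField K × FunField K) :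
    (divRing c).map (σ : FunField K →+* FunField K) = divRing (mapPair σ c) := by
  ext f
  constructor
  · rintro ⟨g, ⟨P, Q, hQ, h⟩, rfl⟩
    refine ⟨P, Q, hQ, ?_⟩
    have := congrArg σ h
    change σ (g * ev c Q) = σ (ev c P) at this
    rwa [map_mul, map_ev, map_ev] at this
  · rintro ⟨P, Q, hQ, h⟩
    refine ⟨σ.symm f, ⟨P, Q, hQ, ?_⟩, σ.apply_symm_apply f⟩
    apply σ.injective
    rw [map_mul, map_ev, map_ev, σ.apply_symm_apply]
    exact h

theorem ord_mapPair_iff (σ : FunField K ≃ₐ[K] FunField K) :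
    Ord (mapPair σ c) (σ f) n ↔ Ord c f n := by
  refine exists_congr fun P => exists_congr fun Q => and_congr_right fun _ =>
    and_congr_right fun _ => ?_
  rw [← map_ev, ← map_ev, mapPair, ← map_zpow₀, ← map_mul, ← map_mul]
  exact σ.injective.eq_iff

end Orders

/-! ### Boundary curves -/

section Boundary

variable {K : Type u} [Field K] {c c' : FunField K × FunField K} {f : FunField K} {k : K}

theorem IsCoord.swap (hc : IsCoord c) : IsCoord (c.2, c.1) :=
  hc.of_mem fun _ h1 h2 => ⟨h2, h1⟩

theorem localRing_swap (hc : IsCoord c) : localRing (c.2, c.1) = localRing c :=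
  localRing_eq hc hc.swap (reg_snd c) (reg_fst c) (reg_snd (c.2, c.1)) (reg_fst (c.2, c.1))

theorem Reg.of_sub {a : K} (h : Reg c (f - algebraMap K _ a) k) : Reg c f (k + a) := by
  simpa using h.add (reg_const c a)

theorem Reg.sub_const {g : FunField K} {a : K} (h : Reg c f k) (hg : g = f) (ha : a = k) :
    Reg c (g - algebraMap K _ a) 0 := by
  rw [hg, ha]
  simpa using h.sub (reg_const c k)

theorem Reg.next (hc : IsCoord c) (h : Reg c f k) (q : OnePoint K) : Reg (next c q) f k := by
  refine Reg.trans (hc.next q) ?_ ?_ h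
  · induction q using OnePoint.rec with
    | infty => exact reg_fst _
    | coe q =>
      have := (reg_fst (GaSurfaces.next c (q : OnePoint K))).of_sub.mul (reg_snd _)
      refine this.congr ?_ (by simp)
      simp [next_coe, hc.snd_ne_zero]
  · induction q using OnePoint.rec with
    | infty =>
      refine ((reg_fst _).mul (reg_snd (GaSurfaces.next c ∞))).congr ?_ (by simp)
      simp [next_infty, mul_div_cancel₀ _ hc.fst_ne_zero]
    | coe q => exact reg_snd _

/-- The closed points of `𝔽_r`: the open orbit, the points of `f` and of `s` other than their
intersection, and the intersection of `f` and `s`. -/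
theorem mem_hirzebruch_iff {r : ℕ} {R : Subring (FunField K)} :
    R ∈ hirzebruch K r ↔
      (∃ a b : K, R = localRing (x K - algebraMap K _ a, y K - algebraMap K _ b)) ∨
      (∃ a : K, R = localRing (x K / y K ^ r - algebraMap K _ a, 1 / y K)) ∨
      (∃ b : K, R = localRing (1 / x K, y K - algebraMap K _ b)) ∨
      R = localRing (y K ^ r / x K, 1 / y K) := by
  have hx := x_ne_zero (K := K)
  have hy := y_ne_zero (K := K)
  have plane : ∀ a b : K, IsCoord (x K - algebraMap K _ a, y K - algebraMap K _ b) :=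
    fun a b => isCoord_x_y.sub_const a b
  have sect : ∀ a b : K, IsCoord (1 / x K - algebraMap K _ a, y K - algebraMap K _ b) :=
    fun a b => isCoord_section.sub_const a b
  have fib : ∀ a b : K, IsCoord (x K / y K ^ r - algebraMap K _ a, 1 / y K - algebraMap K _ b) :=
    fun a b => by simpa using (isCoord_fiber r 0).sub_const a b
  have corn : ∀ a b : K, IsCoord (y K ^ r / x K - algebraMap K _ a, 1 / y K - algebraMap K _ b) :=
    fun a b => (isCoord_corner r).sub_const a b
  -- the values of `1 / x` and `1 / y` at a point where `x` and `y` do not vanish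
  have h12 : ∀ a b : K, b ≠ 0 →
      localRing (x K / y K ^ r - algebraMap K _ a, 1 / y K - algebraMap K _ b) =
      localRing (x K - algebraMap K _ (a / b ^ r), y K - algebraMap K _ b⁻¹) := by
    intro a b hb
    have hx1 := (reg_fst (x K - algebraMap K _ (a / b ^ r), y K - algebraMap K _ b⁻¹)).of_sub
    have hy1 := (reg_snd (x K - algebraMap K _ (a / b ^ r), y K - algebraMap K _ b⁻¹)).of_sub
    have hx2 := (reg_fst (x K / y K ^ r - algebraMap K _ a,
      1 / y K - algebraMap K _ b)).of_sub
    have hy2 := (reg_snd (x K / y K ^ r - algebraMap K _ a,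
      1 / y K - algebraMap K _ b)).of_sub
    rw [zero_add] at hx1 hy1 hx2 hy2
    refine localRing_eq (plane _ _) (fib _ _) ?_ ?_ ?_ ?_
    · exact (hx1.div (plane _ _) (hy1.pow r) (by simp [hb])).sub_const rfl (by simp [hb])
    · exact ((reg_one _).div (plane _ _) hy1 (by simp [hb])).sub_const rfl (by simp)
    · exact (hx2.div (fib _ _) (hy2.pow r) (by simp [hb])).sub_const (by simp [hy]) rfl
    · exact (hy2.inv (fib _ _) hb).sub_const (by simp) rfl
  have h23 : ∀ a b : K, a ≠ 0 →
      localRing (y K ^ r / x K - algebraMap K _ a, 1 / y K - algebraMap K _ b) =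
      localRing (x K / y K ^ r - algebraMap K _ a⁻¹, 1 / y K - algebraMap K _ b) := by
    intro a b ha
    have hx1 := (reg_fst (x K / y K ^ r - algebraMap K _ a⁻¹,
      1 / y K - algebraMap K _ b)).of_sub
    have hx2 := (reg_fst (y K ^ r / x K - algebraMap K _ a,
      1 / y K - algebraMap K _ b)).of_sub
    rw [zero_add] at hx1 hx2
    refine localRing_eq (fib _ _) (corn _ _) ?_ (reg_snd _) ?_ (reg_snd _)
    · exact (hx1.inv (fib _ _) (inv_ne_zero ha)).sub_const (by simp) (by simp)
    · exact (hx2.inv (corn _ _) ha).sub_const (by simp) rfl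
  have h43 : ∀ b : K, b ≠ 0 →
      localRing (y K ^ r / x K - algebraMap K _ 0, 1 / y K - algebraMap K _ b) =
      localRing (1 / x K, y K - algebraMap K _ b⁻¹) := by
    intro b hb
    have hs : IsCoord (1 / x K, y K - algebraMap K _ b⁻¹) := by simpa using sect 0 b⁻¹
    have hy1 := (reg_snd (1 / x K, y K - algebraMap K _ b⁻¹)).of_sub
    have hy2 := (reg_snd (y K ^ r / x K - algebraMap K _ 0,
      1 / y K - algebraMap K _ b)).of_sub
    rw [zero_add] at hy1 hy2
    refine localRing_eq hs (corn _ _) ?_ ?_ ?_ ?_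
    · exact ((hy1.pow r).mul (reg_fst _)).congr (by simp [div_eq_mul_inv]) (by simp)
    · exact ((reg_one _).div hs hy1 (by simp [hb])).sub_const rfl (by simp)
    · exact ((reg_fst _).mul (hy2.pow r)).congr (by simp; field_simp) (by simp)
    · exact (hy2.inv (corn _ _) hb).sub_const (by simp) rfl
  have h14 : ∀ a b : K, a ≠ 0 →
      localRing (1 / x K - algebraMap K _ a, y K - algebraMap K _ b) =
      localRing (x K - algebraMap K _ a⁻¹, y K - algebraMap K _ b) := by
    intro a b ha
    have hx1 := (reg_fst (x K - algebraMap K _ a⁻¹, y K - algebraMap K _ b)).of_sub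
    have hx2 := (reg_fst (1 / x K - algebraMap K _ a, y K - algebraMap K _ b)).of_sub
    rw [zero_add] at hx1 hx2
    refine localRing_eq (plane _ _) (sect _ _) ?_ (reg_snd _) ?_ (reg_snd _)
    · exact (hx1.inv (plane _ _) (inv_ne_zero ha)).sub_const (by simp) (by simp)
    · exact (hx2.inv (sect _ _) ha).sub_const (by simp) rfl
  constructor
  · rintro ⟨c, (rfl | rfl | rfl | rfl), a, b, rfl⟩
    · exact Or.inl ⟨a, b, rfl⟩
    · by_cases hb : b = 0
      · exact Or.inr (Or.inl ⟨a, by simp [shift, hb]⟩)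
      · exact Or.inl ⟨_, _, h12 a b hb⟩
    · by_cases ha : a = 0
      · by_cases hb : b = 0
        · exact Or.inr (Or.inr (Or.inr (by simp [shift, ha, hb])))
        · exact Or.inr (Or.inr (Or.inl ⟨b⁻¹, by rw [← h43 b hb, ← ha]; rfl⟩))
      · have := h23 a b ha
        by_cases hb : b = 0
        · exact Or.inr (Or.inl ⟨a⁻¹, by simpa [shift, hb] using this⟩)
        · exact Or.inl ⟨_, _, this.trans (h12 _ b hb)⟩
    · by_cases ha : a = 0
      · exact Or.inr (Or.inr (Or.inl ⟨b, by simp [shift, ha]⟩))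
      · exact Or.inl ⟨_, _, h14 a b ha⟩
  · rintro (⟨a, b, rfl⟩ | ⟨a, rfl⟩ | ⟨b, rfl⟩ | rfl)
    · exact ⟨(x K, y K), by simp [charts], a, b, rfl⟩
    · exact ⟨(x K / y K ^ r, 1 / y K), by simp [charts], a, 0, by simp [shift]⟩
    · exact ⟨(1 / x K, y K), by simp [charts], 0, b, by simp [shift]⟩
    · exact ⟨(y K ^ r / x K, 1 / y K), by simp [charts], 0, 0, by simp [shift]⟩

theorem reg_eval {a b : K} (h1 : Reg c' c.1 a) (h2 : Reg c' c.2 b) (P : MvPolynomial (Fin 2) K) :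
    Reg c' (ev c P) (MvPolynomial.eval ![a, b] P) := by
  induction P using MvPolynomial.induction_on with
  | C a => simpa using reg_const c' a
  | add P Q hP hQ => rw [map_add, map_add]; exact hP.add hQ
  | mul_X P i hP =>
    rw [map_mul, map_mul, MvPolynomial.eval_X]
    refine hP.mul ?_
    fin_cases i
    · simpa using h1
    · simpa using h2

theorem eval_restr (a : K) (P : MvPolynomial (Fin 2) K) :
    (restr K P).eval a = MvPolynomial.eval ![a, 0] P := by
  induction P using MvPolynomial.induction_on with
  | C a => simp
  | add P Q hP hQ => simp [hP, hQ]
  | mul_X P i hP => fin_cases i <;> simp [hP]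

theorem IsCoord.sub_fst (hc : IsCoord c) (q : K) : IsCoord (c.1 - algebraMap K _ q, c.2) := by
  simpa using hc.sub_const q 0

theorem reg_fst_sub (c : FunField K × FunField K) (q : K) :
    Reg (c.1 - algebraMap K _ q, c.2) c.1 q := by
  simpa using (reg_fst (c.1 - algebraMap K _ q, c.2)).of_sub

/-- A ring that contains the local rings of infinitely many points of a curve contains the local
ring of the curve. -/
theorem divRing_le_of_infinite (hc : IsCoord c) {V : Subring (FunField K)}
    (hV : {q : K | localRing (c.1 - algebraMap K _ q, c.2) ≤ V}.Infinite) : divRing c ≤ V := by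
  rintro f ⟨P, Q, hQ, h⟩
  obtain ⟨q, hq, hq'⟩ : ∃ q, localRing (c.1 - algebraMap K _ q, c.2) ≤ V ∧
      (restr K Q).eval q ≠ 0 := by
    by_contra! h
    exact hQ (Polynomial.eq_zero_of_infinite_isRoot _ (hV.mono fun q hq => h q hq))
  rw [eval_restr] at hq'
  have h1 := reg_fst_sub c q
  have hreg := (reg_eval h1 (reg_snd _) P).div (hc.sub_fst q) (reg_eval h1 (reg_snd _) Q) hq'
  rw [← h, mul_div_cancel_right₀ _ (hc.ev_ne_zero (ne_zero_of_restr_ne_zero hQ))] at hreg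
  exact hq hreg.mem

theorem localRing_le_divRing (c : FunField K × FunField K) (q : K) :
    localRing (c.1 - algebraMap K _ q, c.2) ≤ divRing c := by
  have key : ∀ P, ev (c.1 - algebraMap K _ q, c.2) P = ev c (MvPolynomial.aeval
      ![MvPolynomial.X 0 - MvPolynomial.C q, MvPolynomial.X 1] P) := by
    intro P
    induction P using MvPolynomial.induction_on with
    | C a => simp
    | add P Q hP hQ => simp [hP, hQ]
    | mul_X P i hP => fin_cases i <;> simp [hP]
  rintro f ⟨P, Q, hQ, h⟩
  refine ⟨_, _, ?_, (congrArg _ (key Q)).symm.trans (h.trans (key P))⟩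
  intro h0
  have h1 := congrArg (Polynomial.eval q) h0
  rw [eval_restr, Polynomial.eval_zero] at h1
  apply hQ
  rw [← h1]
  clear h h0 h1 hQ
  induction Q using MvPolynomial.induction_on with
  | C a => simp
  | add P Q hP hQ => simp [hP, hQ]
  | mul_X P i hP => fin_cases i <;> simp [hP]

theorem localRing_sub_injective (hc : IsCoord c) :
    Function.Injective fun q : K => localRing (c.1 - algebraMap K _ q, c.2) := by
  intro q q' h
  exact (reg_fst_sub c q).eq_of_le (hc.sub_fst q) (hc.sub_fst q') h.le (reg_fst_sub c q')

/-- A function that vanishes at a point vanishes along the exceptional curve of the blowup. -/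
theorem Reg.ordGE_one (hc : IsCoord c) (hf : Reg c f 0) : OrdGE (c.1 / c.2, c.2) f 1 := by
  have hd := hc.div_snd
  have h1 : OrdGE (c.1 / c.2, c.2) c.1 1 :=
    (((ord_fst (c.1 / c.2, c.2)).mul hd (ord_snd _)).ge).congr
      (by simp [hc.snd_ne_zero]) (by norm_num)
  have h2 : OrdGE (c.1 / c.2, c.2) c.2 1 := (ord_snd (c.1 / c.2, c.2)).ge
  have key : ∀ P : MvPolynomial (Fin 2) K, OrdGE (c.1 / c.2, c.2)
      (GaSurfaces.ev c P - algebraMap K _ (MvPolynomial.constantCoeff P)) 1 := by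
    intro P
    induction P using MvPolynomial.induction_on with
    | C a => exact ⟨0, 1, by simp, by simp⟩
    | add P Q hP hQ => exact (hP.add hQ).congr (by simp only [map_add]; ring) rfl
    | mul_X P i hP =>
      have hi : OrdGE (c.1 / c.2, c.2) (GaSurfaces.ev c (MvPolynomial.X i)) 1 := by
        fin_cases i
        · simpa using h1
        · simpa using h2
      have hP0 : OrdGE (c.1 / c.2, c.2) (GaSurfaces.ev c P) 0 :=
        ((hP.mono hd zero_le_one).add (ordGE_const _ _)).congr (sub_add_cancel _ _).symm rfl
      exact (hP0.mul hd hi).congr (by simp) (by norm_num)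
  obtain ⟨P, Q, hQ, hP, h⟩ := hf
  have hQ' : Ord (c.1 / c.2, c.2) (GaSurfaces.ev c Q) 0 :=
    ((ord_const _ hQ).add_of_ge hd (key Q)).congr (by ring) rfl
  have hP' : OrdGE (c.1 / c.2, c.2) (GaSurfaces.ev c P) 1 :=
    (key P).congr (by rw [hP]; simp) rfl
  refine (hP'.mul hd (hQ'.inv hd).ge).congr ?_ (by norm_num)
  rw [← h, mul_inv_cancel_right₀ (hc.ev_ne_zero (ne_zero_of_constantCoeff_ne_zero hQ))]

theorem reg_one_div_y (r : ℕ) (p : CoordSeq K) : Reg (coords r p) (1 / y K) 0 := by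
  obtain ⟨q, l⟩ := p
  induction l using List.reverseRecOn with
  | nil => exact reg_snd _
  | append_singleton l a ih =>
    rw [coords_append]
    exact ih.next (isCoord_coords r _) a

/-- The curves of the boundary, given by coordinates `(u, v)` such that `v = 0` is the curve: the
section `s`, the fiber `f`, and the exceptional curves. -/
def curves (r : ℕ) (ps : List (CoordSeq K)) : Set (FunField K × FunField K) :=
  {(y K, 1 / x K), (x K / y K ^ r, 1 / y K)} ∪
    {c | ∃ s ∈ blownUp ps, c = ((coords r s).1 / (coords r s).2, (coords r s).2)}

/-- The local rings of the boundary curves, in terms of the set of the closed points only: those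
rings that contain the local rings of infinitely many closed points, but not all linear forms. -/
def boundary (B : Set (Subring (FunField K))) : Set (Subring (FunField K)) :=
  {V | (∃ a b : K, algebraMap K _ a * x K + algebraMap K _ b * y K ∉ V) ∧
    {R | R ∈ B ∧ R ≤ V}.Infinite}

theorem isCoord_of_mem_curves {r : ℕ} {ps : List (CoordSeq K)} (h : c ∈ curves r ps) :
    IsCoord c := by
  rcases h with (rfl | rfl) | ⟨s, -, rfl⟩
  · exact isCoord_section.swap
  · simpa using isCoord_fiber (K := K) r 0
  · exact (isCoord_coords r s).div_snd

theorem finite_blownUp {L : Type u} (ps : List (CoordSeq L)) : (blownUp ps).Finite := by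
  have : blownUp ps ⊆ ⋃ p ∈ {p | p ∈ ps}, (fun l => (p.1, l)) '' {l | l ∈ p.2.inits} := by
    rintro ⟨a, l⟩ ⟨p, hp, rfl, h⟩
    simp only [Set.mem_iUnion]
    exact ⟨p, hp, l, (List.mem_inits _ _).2 h, rfl⟩
  exact (Set.Finite.biUnion (List.finite_toSet ps)
    fun p _ => (List.finite_toSet p.2.inits).image _).subset this

theorem ord_one (c : FunField K × FunField K) : Ord c 1 0 := by
  simpa using ord_const c (one_ne_zero (α := K))

theorem notMem_divRing (hc : IsCoord c) (hf0 : f ≠ 0) (hf : OrdGE c (1 / f) 1) :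
    f ∉ divRing c := by
  intro h
  have h1 := hf.mul hc (mem_divRing_iff.1 h)
  rw [one_div_mul_cancel hf0] at h1
  have := (ord_one c).le_of_ge hc h1
  omega

theorem isCoord_section_sub (b : K) : IsCoord (1 / x K, y K - algebraMap K _ b) := by
  simpa using isCoord_section.sub_const 0 b

/-- The local ring of a boundary curve contains those of almost all points of the curve, and it is not
the ring of a curve in the affine plane: `x` has a pole along `s`, and `y` has a pole along `f` and
along the exceptional curves. -/
theorem divRing_mem_boundary [Infinite K] {r : ℕ} {ps : List (CoordSeq K)}
    (h : c ∈ curves r ps) : divRing c ∈ boundary (blowupPoints r ps) := by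
  have hc := isCoord_of_mem_curves h
  have hinf : (∀ q : K, localRing (c.1 - algebraMap K _ q, c.2) ∈ hirzebruch K r ∨
      ∃ s ∈ blownUp ps, ∃ q' : OnePoint K, localRing (c.1 - algebraMap K _ q, c.2) =
        localRing (next (coords r s) q')) →
      {R | R ∈ blowupPoints r ps ∧ R ≤ divRing c}.Infinite := by
    intro hq
    have h1 := Set.infinite_range_of_injective (localRing_sub_injective hc)
    have h2 := (finite_blownUp ps).image (fun s => localRing (coords r s))
    refine (h1.sdiff h2).mono ?_
    rintro _ ⟨⟨q, rfl⟩, hR⟩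
    exact ⟨⟨hq q, fun s hs he => hR ⟨s, hs, he.symm⟩⟩, localRing_le_divRing c q⟩
  rcases h with (rfl | rfl) | ⟨s, hs, rfl⟩
  · have hx : x K ∉ divRing (y K, 1 / x K) := notMem_divRing hc x_ne_zero (ord_snd _).ge
    refine ⟨⟨1, 0, ?_⟩, hinf fun q => Or.inl (mem_hirzebruch_iff.2 ?_)⟩
    · rwa [map_one, map_zero, one_mul, zero_mul, add_zero]
    · have he := localRing_swap (isCoord_section_sub q)
      exact Or.inr (Or.inr (Or.inl ⟨q, he⟩))
  · have hy : y K ∉ divRing (x K / y K ^ r, 1 / y K) :=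
      notMem_divRing hc y_ne_zero (ord_snd _).ge
    refine ⟨⟨0, 1, ?_⟩, hinf fun q => Or.inl (mem_hirzebruch_iff.2 ?_)⟩
    · rwa [map_one, map_zero, one_mul, zero_mul, zero_add]
    · exact Or.inr (Or.inl ⟨q, rfl⟩)
  · have hy : y K ∉ divRing ((coords r s).1 / (coords r s).2, (coords r s).2) :=
      notMem_divRing hc y_ne_zero ((reg_one_div_y r s).ordGE_one (isCoord_coords r s))
    refine ⟨⟨0, 1, ?_⟩, hinf fun q => Or.inr ⟨s, hs, q, rfl⟩⟩
    rwa [map_one, map_zero, one_mul, zero_mul, zero_add]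

/-- All closed points outside the open orbit lie on one of the boundary curves, up to the corner
`f ∩ s` and the point `∞` of every exceptional curve. Hence infinitely many points whose local rings
are contained in `V` lie on one and the same boundary curve. -/
theorem exists_eq_divRing_of_mem_boundary {r : ℕ} {ps : List (CoordSeq K)}
    {V : Subring (FunField K)} (h : V ∈ boundary (blowupPoints r ps)) :
    ∃ c ∈ curves r ps, V = divRing c := by
  obtain ⟨⟨a, b, hab⟩, hinf⟩ := h
  by_contra! hne
  -- otherwise `V` contains the local rings of only finitely many points of every boundary curve
  have hfin : ∀ c ∈ curves r ps,
      {q : K | localRing (c.1 - algebraMap K _ q, c.2) ≤ V}.Finite := by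
    intro c hc
    by_contra h
    have hcc := isCoord_of_mem_curves hc
    exact hne c hc (eq_divRing_of_le hcc (divRing_le_of_infinite hcc h) ⟨_, hab⟩)
  have hs := (hfin (y K, 1 / x K) (by simp [curves])).image
    fun q => localRing (y K - algebraMap K _ q, 1 / x K)
  have hf := (hfin (x K / y K ^ r, 1 / y K) (by simp [curves])).image
    fun q => localRing (x K / y K ^ r - algebraMap K _ q, 1 / y K)
  have hE : ∀ s ∈ blownUp ps, {R | (∃ q, R = localRing (next (coords r s) q)) ∧ R ≤ V}.Finite := by
    intro s hs
    have h1 := (hfin ((coords r s).1 / (coords r s).2, (coords r s).2)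
      (Or.inr ⟨s, hs, rfl⟩)).image fun q : K => localRing (next (coords r s) (q : OnePoint K))
    refine (h1.insert (localRing (next (coords r s) ∞))).subset ?_
    rintro _ ⟨⟨q, rfl⟩, hq⟩
    induction q using OnePoint.rec with
    | infty => exact Or.inl rfl
    | coe q => exact Or.inr ⟨q, hq, rfl⟩
  refine hinf (((hs.union hf).union
    (((finite_blownUp ps).biUnion hE).insert (localRing (y K ^ r / x K, 1 / y K)))).subset ?_)
  rintro R ⟨⟨hR | ⟨s, hs, q, rfl⟩, -⟩, hRV⟩
  · rcases mem_hirzebruch_iff.1 hR with ⟨α, β, rfl⟩ | ⟨α, rfl⟩ | ⟨β, rfl⟩ | rfl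
    · have hx := (reg_fst (x K - algebraMap K _ α, y K - algebraMap K _ β)).of_sub
      have hy := (reg_snd (x K - algebraMap K _ α, y K - algebraMap K _ β)).of_sub
      exact absurd (hRV (((reg_const _ a).mul hx).add ((reg_const _ b).mul hy)).mem) hab
    · exact Or.inl (Or.inr ⟨α, hRV, rfl⟩)
    · have he := localRing_swap (isCoord_section_sub β)
      exact Or.inl (Or.inl ⟨β, he.le.trans hRV, he⟩)
    · exact Or.inr (Or.inl rfl)
  · exact Or.inr (Or.inr (Set.mem_biUnion hs ⟨⟨q, rfl⟩, hRV⟩))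

theorem map_mem_boundary {B : Set (Subring (FunField K))} {V : Subring (FunField K)}
    (h : V ∈ boundary B) (M : GL (Fin 2) K) :
    V.map (linAut M : FunField K →+* FunField K) ∈ boundary (mapRings M B) := by
  obtain ⟨⟨a, b, hab⟩, hinf⟩ := h
  have hinj : Function.Injective (linAut M : FunField K →+* FunField K) := (linAut M).injective
  constructor
  · refine ⟨a * M 0 0 + b * M 1 0, a * M 0 1 + b * M 1 1, ?_⟩
    rintro ⟨f, hf, he⟩
    apply hab
    suffices h : f = algebraMap K _ a * x K + algebraMap K _ b * y K from h ▸ hf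
    apply hinj
    rw [he]
    simp only [map_add, map_mul, RingHom.coe_coe, linAut_x, linAut_y, AlgEquiv.commutes]
    ring
  · have hmap : Function.Injective fun R : Subring (FunField K) =>
        R.map (linAut M : FunField K →+* FunField K) := fun R R' h =>
      SetLike.coe_injective (hinj.image_injective (congrArg SetLike.coe h))
    refine (hinf.image hmap.injOn).mono ?_
    rintro _ ⟨R, ⟨hR, hRV⟩, rfl⟩
    exact ⟨⟨R, hR, rfl⟩, Set.image_mono hRV⟩

/-- A linear substitution that takes the closed points of a surface to those of another one takes
the boundary curves to boundary curves. -/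
theorem exists_curve [Infinite K] {r r' : ℕ} {ps ps' : List (CoordSeq K)} {M : GL (Fin 2) K}
    (h : mapRings M (blowupPoints r ps) = blowupPoints r' ps') (hc : c ∈ curves r ps) :
    ∃ c' ∈ curves r' ps', ∀ f n, Ord c' (linAut M f) n ↔ Ord c f n := by
  have h1 := map_mem_boundary (divRing_mem_boundary hc) M
  rw [h, map_divRing] at h1
  obtain ⟨c', hc', he⟩ := exists_eq_divRing_of_mem_boundary h1
  have hc1 := (isCoord_of_mem_curves hc).map (linAut M)
  have hc2 := isCoord_of_mem_curves hc'
  refine ⟨c', hc', fun f n => ?_⟩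
  rw [← ord_mapPair_iff (linAut M) (c := c)]
  exact ⟨Ord.of_divRing_eq hc2 hc1 he.symm, Ord.of_divRing_eq hc1 hc2 he⟩

end Boundary

/-! ### Orders of linear forms along the boundary curves -/

section CurveOrders

variable {K : Type u} [Field K] {c c' : FunField K × FunField K}

/-- The orders of the nonzero linear forms `a x + b y` along the curve given by `c`. -/
def linOrds (c : FunField K × FunField K) : Set ℤ :=
  {n | ∃ a b : K, Ord c (algebraMap K _ a * x K + algebraMap K _ b * y K) n}

theorem linAut_linForm (M : GL (Fin 2) K) (a b : K) :
    linAut M (algebraMap K _ a * x K + algebraMap K _ b * y K) =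
      algebraMap K _ (a * M 0 0 + b * M 1 0) * x K +
        algebraMap K _ (a * M 0 1 + b * M 1 1) * y K := by
  simp only [map_add, map_mul, linAut_x, linAut_y, AlgEquiv.commutes]
  ring

theorem linOrds_eq_of_ord_iff {M : GL (Fin 2) K}
    (h : ∀ f n, Ord c' (linAut M f) n ↔ Ord c f n) : linOrds c' = linOrds c := by
  ext n
  constructor
  · rintro ⟨a, b, hab⟩
    have hM := linAut_mul M M⁻¹ (algebraMap K _ a * x K + algebraMap K _ b * y K)
    rw [inv_mul_cancel, linAut_one, linAut_linForm] at hM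
    exact ⟨_, _, (h _ n).1 (hM ▸ hab)⟩
  · rintro ⟨a, b, hab⟩
    exact ⟨_, _, linAut_linForm M a b ▸ (h _ n).2 hab⟩

/-- All linear forms but the multiples of one of the two generators have the minimal order. -/
theorem linOrds_eq_pair (hc : IsCoord c) {k : K} {m n : ℤ}
    (hx : Ord c (x K - algebraMap K _ k * y K) m) (hy : Ord c (y K) n) (hmn : m ≠ n) :
    linOrds c = {m, n} := by
  ext l
  constructor
  · rintro ⟨a, b, hab⟩
    have e : algebraMap K (FunField K) a * x K + algebraMap K _ b * y K =
        algebraMap K _ a * (x K - algebraMap K _ k * y K) +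
          algebraMap K _ (a * k + b) * y K := by
      simp only [map_add, map_mul]
      ring
    rw [e] at hab
    by_cases ha : a = 0
    · by_cases hb : a * k + b = 0
      · rw [hb, ha] at hab
        exact absurd (by simp) (hab.ne_zero hc)
      · refine Or.inr (hab.unique hc ((hy.const_mul hc hb).congr ?_ rfl))
        simp [ha]
    · have h1 := hx.const_mul hc ha
      by_cases hb : a * k + b = 0
      · refine Or.inl (hab.unique hc (h1.congr ?_ rfl))
        simp [hb]
      · have h2 := hy.const_mul hc hb
        rcases lt_or_gt_of_ne hmn with h | h
        · exact Or.inl (hab.unique hc (h1.add_of_lt hc h2 h))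
        · rw [add_comm] at hab
          exact Or.inr (hab.unique hc (h2.add_of_lt hc h1 h))
  · rintro (rfl | rfl)
    · exact ⟨1, -k, hx.congr (by simp [sub_eq_add_neg]) rfl⟩
    · exact ⟨0, 1, hy.congr (by simp) rfl⟩

/-- The section `s`. -/
def curveS (K : Type u) [Field K] : FunField K × FunField K := (y K, 1 / x K)

/-- The fiber `f` of `𝔽_m`. -/
def curveF (K : Type u) [Field K] (m : ℕ) : FunField K × FunField K := (x K / y K ^ m, 1 / y K)

/-- The exceptional curve of the blowup of the point with local coordinates `c`. -/
def curveE (c : FunField K × FunField K) : FunField K × FunField K := (c.1 / c.2, c.2)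

theorem isCoord_curveS : IsCoord (curveS K) := isCoord_section.swap

theorem isCoord_curveF (m : ℕ) : IsCoord (curveF K m) := by
  simpa [curveF] using isCoord_fiber (K := K) m 0

theorem IsCoord.curveE (hc : IsCoord c) : IsCoord (curveE c) := hc.div_snd

theorem linOrds_curveS : linOrds (curveS K) = {-1, 0} := by
  have hx : Ord (curveS K) (x K) (-1) :=
    ((ord_snd (curveS K)).inv isCoord_curveS).congr (by simp [curveS]) rfl
  exact linOrds_eq_pair (k := 0) isCoord_curveS (hx.congr (by simp) rfl) (ord_fst (curveS K))
    (by norm_num)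

theorem ord_curveF_y (m : ℕ) : Ord (curveF K m) (y K) (-1) :=
  ((ord_snd (curveF K m)).inv (isCoord_curveF m)).congr (by simp [curveF]) rfl

theorem ord_curveF_add (m : ℕ) {a b : K} (hab : a ≠ 0 ∨ b ≠ 0) :
    Ord (curveF K m) (algebraMap K _ a * x K + algebraMap K _ b * y K ^ m) (-m) := by
  have hy := y_ne_zero (K := K)
  refine (((ord_curveF_y m).pow (isCoord_curveF m) m).mul (isCoord_curveF m)
    (ord_linear (curveF K m) hab)).congr ?_ (by ring)
  simp only [curveF]
  field_simp

theorem linOrds_curveF (m : ℕ) : linOrds (curveF K m) = {-(m : ℤ), -1} := by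
  have hy := y_ne_zero (K := K)
  have hcy := ord_curveF_y (K := K) m
  by_cases hm : m = 1
  · subst hm
    ext n
    have key : ∀ a b : K, a ≠ 0 ∨ b ≠ 0 →
        Ord (curveF K 1) (algebraMap K _ a * x K + algebraMap K _ b * y K) (-1) := fun a b hab =>
      (ord_curveF_add 1 hab).congr (by simp) (by simp)
    constructor
    · rintro ⟨a, b, hab⟩
      by_cases h0 : a ≠ 0 ∨ b ≠ 0
      · exact Or.inr (hab.unique (isCoord_curveF 1) (key a b h0))
      · push Not at h0
        exact absurd (by simp [h0]) (hab.ne_zero (isCoord_curveF 1))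
    · intro h
      have hn : n = -1 := by simpa using h
      subst hn
      exact ⟨1, 0, key 1 0 (by simp)⟩
  · refine linOrds_eq_pair (k := 0) (isCoord_curveF m) ?_ hcy (by omega)
    exact (ord_curveF_add m (a := 1) (b := 0) (by simp)).congr (by simp) rfl

/-- The local coordinates at the point `[q]` of the fiber of `𝔽_m`. -/
def fiberPt (m : ℕ) (q : K) : FunField K × FunField K :=
  (x K / y K ^ m - algebraMap K _ q, 1 / y K)

theorem isCoord_fiberPt (m : ℕ) (q : K) : IsCoord (fiberPt m q) := isCoord_fiber m q

/-- The exceptional curve of the point `[0]` of `𝔽_(m + 1)` is the fiber of `𝔽_m`: the two surfaces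
are related by an elementary transformation. -/
theorem curveE_fiberPt_zero (m : ℕ) : curveE (fiberPt (m + 1) (0 : K)) = curveF K m := by
  have hy := y_ne_zero (K := K)
  simp only [curveE, fiberPt, curveF, map_zero, sub_zero, Prod.mk.injEq, and_true, pow_succ]
  field_simp

theorem ord_curveE_fst (hc : IsCoord c) : Ord (curveE c) c.1 1 :=
  ((ord_fst (curveE c)).mul hc.curveE (ord_snd (curveE c))).congr
    (div_mul_cancel₀ _ hc.snd_ne_zero).symm rfl

theorem ord_curveE_snd (c : FunField K × FunField K) : Ord (curveE c) c.2 1 := ord_snd (curveE c)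

theorem ord_curveE_fiberPt_y (m : ℕ) (q : K) : Ord (curveE (fiberPt m q)) (y K) (-1) :=
  ((ord_curveE_snd (fiberPt m q)).inv (isCoord_fiberPt m q).curveE).congr
    (by simp [fiberPt]) rfl

/-- The order of `x - q y ^ m` jumps at the exceptional curve of the point `[q]`. -/
theorem ord_curveE_fiberPt_self (m : ℕ) (q : K) :
    Ord (curveE (fiberPt m q)) (x K - algebraMap K _ q * y K ^ m) (1 - m) := by
  have hy := y_ne_zero (K := K)
  refine ((ord_curveE_fst (isCoord_fiberPt m q)).mul (isCoord_fiberPt m q).curveE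
    ((ord_curveE_fiberPt_y m q).pow (isCoord_fiberPt m q).curveE m)).congr ?_ (by ring)
  simp only [fiberPt]
  field_simp

theorem ord_curveE_fiberPt_add (m : ℕ) (q : K) {a b : K} (h : a * q + b ≠ 0) :
    Ord (curveE (fiberPt m q)) (algebraMap K _ a * x K + algebraMap K _ b * y K ^ m) (-m) := by
  have hc := (isCoord_fiberPt m q).curveE
  have h1 := ((ord_curveE_fiberPt_y m q).pow hc m).const_mul hc h
  have h2 := (ord_curveE_fiberPt_self m q).ge.const_mul hc a
  refine (h1.add_of_ge hc (h2.congr rfl (by ring))).congr ?_ (by ring)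
  simp only [map_add, map_mul]
  ring

theorem ord_curveE_fiberPt_x (m : ℕ) {q : K} (hq : q ≠ 0) :
    Ord (curveE (fiberPt m q)) (x K) (-m) :=
  (ord_curveE_fiberPt_add m q (a := 1) (b := 0) (by simpa using hq)).congr (by simp) rfl

theorem linOrds_curveE_fiberPt {m : ℕ} (hm : m ≠ 1) {q : K} (hq : q ≠ 0) :
    linOrds (curveE (fiberPt m q)) = {-(m : ℤ), -1} :=
  linOrds_eq_pair (k := 0) (isCoord_fiberPt m q).curveE
    ((ord_curveE_fiberPt_x m hq).congr (by simp) rfl) (ord_curveE_fiberPt_y m q) (by omega)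

theorem linOrds_curveE_fiberPt_one (q : K) :
    linOrds (curveE (fiberPt 1 q)) = {0, -1} := by
  refine linOrds_eq_pair (k := q) (isCoord_fiberPt 1 q).curveE ?_ (ord_curveE_fiberPt_y 1 q)
    (by norm_num)
  exact (ord_curveE_fiberPt_self 1 q).congr (by simp) (by simp)

/-- The local coordinates at the point `[q, ∞]`. -/
def cuspPt (r : ℕ) (q : K) : FunField K × FunField K := next (fiberPt r q) ∞

theorem isCoord_cuspPt (r : ℕ) (q : K) : IsCoord (cuspPt r q) := (isCoord_fiberPt r q).next ∞

theorem cuspPt_fst (r : ℕ) (q : K) :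
    (cuspPt r q).1 = x K / y K ^ r - algebraMap K _ q := rfl

theorem y_eq_cuspPt (r : ℕ) (q : K) : y K = ((cuspPt r q).1 * (cuspPt r q).2)⁻¹ := by
  have h : (cuspPt r q).1 * (cuspPt r q).2 = 1 / y K :=
    mul_div_cancel₀ _ (isCoord_fiberPt r q).fst_ne_zero
  rw [h, inv_div, div_one]

theorem x_eq_cuspPt (r : ℕ) (q : K) :
    x K = ((cuspPt r q).1 + algebraMap K _ q) * y K ^ r := by
  rw [cuspPt_fst, sub_add_cancel, div_mul_cancel₀ _ (pow_ne_zero r y_ne_zero)]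

/-- A curve over the point `[q, ∞]` along which both coordinates have order one. -/
def OverCusp (r : ℕ) (q : K) (c : FunField K × FunField K) : Prop :=
  IsCoord c ∧ Ord c (cuspPt r q).1 1 ∧ Ord c (cuspPt r q).2 1

theorem OverCusp.ord_y {r : ℕ} {q : K} (h : OverCusp r q c) : Ord c (y K) (-2) := by
  obtain ⟨hc, h1, h2⟩ := h
  exact ((h1.mul hc h2).inv hc).congr (y_eq_cuspPt r q) rfl

theorem OverCusp.ord_x_zero {r : ℕ} (h : OverCusp r (0 : K) c) : Ord c (x K) (1 - 2 * r) :=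
  (h.2.1.mul h.1 (h.ord_y.pow h.1 r)).congr (by rw [x_eq_cuspPt r (0 : K)]; simp) (by ring)

theorem OverCusp.ord_x {r : ℕ} {q : K} (hq : q ≠ 0) (h : OverCusp r q c) :
    Ord c (x K) (-2 * r) := by
  have h1 := (ord_const c hq).add_of_ge h.1 (h.2.1.ge.congr rfl (zero_add 1))
  exact (h1.mul h.1 (h.ord_y.pow h.1 r)).congr (by rw [x_eq_cuspPt r q, add_comm]) (by ring)

theorem OverCusp.linOrds_zero {r : ℕ} (h : OverCusp r (0 : K) c) :
    linOrds c = {1 - 2 * (r : ℤ), -2} :=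
  linOrds_eq_pair (k := 0) h.1 (h.ord_x_zero.congr (by simp) rfl) h.ord_y (by omega)

theorem OverCusp.linOrds {r : ℕ} (hr : 2 ≤ r) {q : K} (hq : q ≠ 0) (h : OverCusp r q c) :
    linOrds c = {-2 * (r : ℤ), -2} :=
  linOrds_eq_pair (k := 0) h.1 ((h.ord_x hq).congr (by simp) rfl) h.ord_y (by omega)

theorem overCusp_cuspPt (r : ℕ) (q : K) : OverCusp r q (curveE (cuspPt r q)) :=
  ⟨(isCoord_cuspPt r q).curveE, ord_curveE_fst (isCoord_cuspPt r q), ord_curveE_snd _⟩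

theorem overCusp_of_ord (hc : IsCoord c) {r : ℕ} {q w : K} (hw : w ≠ 0)
    (h1 : OrdGE c ((cuspPt r q).1 / (cuspPt r q).2 - algebraMap K _ w) 1)
    (h2 : Ord c (cuspPt r q).2 1) : OverCusp r q c := by
  refine ⟨hc, ?_, h2⟩
  have h3 := (ord_const c hw).add_of_ge hc h1
  exact (h3.mul hc h2).congr (by rw [add_sub_cancel, div_mul_cancel₀ _
    (isCoord_cuspPt r q).snd_ne_zero]) rfl

theorem ord_curveE_next_cuspPt (r : ℕ) (q w : K) :
    Ord (curveE (next (cuspPt r q) w)) ((cuspPt r q).1 / (cuspPt r q).2 - algebraMap K _ w) 1 :=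
  ord_curveE_fst ((isCoord_cuspPt r q).next w)

theorem overCusp_next (r : ℕ) (q : K) {w : K} (hw : w ≠ 0) :
    OverCusp r q (curveE (next (cuspPt r q) w)) :=
  overCusp_of_ord ((isCoord_cuspPt r q).next w).curveE hw
    (ord_curveE_next_cuspPt r q w).ge (ord_snd (curveE (next (cuspPt r q) w)))

/-- Along the last exceptional curve over `[q, ∞, w, p]`, the function `u / v - w`, where `u, v` are
the coordinates at `[q, ∞]`, is equal to `p v` up to higher order terms. -/
theorem ordGE_curveE_next_next (r : ℕ) (q w p : K) :
    OrdGE (curveE (next (next (cuspPt r q) w) p))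
      ((cuspPt r q).1 / (cuspPt r q).2 - algebraMap K _ w - algebraMap K _ p * (cuspPt r q).2)
      2 := by
  have hc := ((isCoord_cuspPt r q).next w).next p
  have h := ((ord_curveE_fst hc).mul hc.curveE (ord_curveE_snd _)).ge
  refine h.congr ?_ (by norm_num)
  have := (isCoord_cuspPt r q).snd_ne_zero
  simp only [next_coe]
  field_simp

theorem overCusp_next_next (r : ℕ) (q p : K) {w : K} (hw : w ≠ 0) :
    OverCusp r q (curveE (next (next (cuspPt r q) w) p)) := by
  have hc := (((isCoord_cuspPt r q).next w).next p).curveE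
  have h2 : Ord (curveE (next (next (cuspPt r q) w) p)) (cuspPt r q).2 1 := ord_snd _
  refine overCusp_of_ord hc hw ?_ h2
  refine (((ordGE_curveE_next_next r q w p).mono hc (by norm_num)).add
    (h2.ge.const_mul hc p)).congr ?_ rfl
  ring

end CurveOrders

/-! ### The points that are blown up -/

section BlownUpPoints

variable {K : Type u} [Field K]

theorem curves_eq (r : ℕ) (ps : List (CoordSeq K)) :
    curves r ps = {curveS K, curveF K r} ∪ (curveE '' (coords r '' blownUp ps)) := by
  rw [curves, Set.image_image]
  congr 1
  ext c
  exact ⟨fun ⟨s, hs, h⟩ => ⟨s, hs, h.symm⟩, fun ⟨s, hs, h⟩ => ⟨s, hs, h.symm⟩⟩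

/-- The points of the exceptional curve of the point `[0]` of `𝔽_(m + 1)` are those of the fiber
of `𝔽_m`. -/
theorem next_fiberPt_zero (m : ℕ) (q : K) :
    next (fiberPt (m + 1) (0 : K)) (q : OnePoint K) = fiberPt m q := by
  have hy := y_ne_zero (K := K)
  simp only [next_coe, fiberPt, map_zero, sub_zero, Prod.mk.injEq, and_true, pow_succ]
  field_simp

theorem coords_replicate {r j : ℕ} (hj : j + 1 ≤ r) :
    coords r ((0 : K), List.replicate j ((0 : K) : OnePoint K)) = fiberPt (r - j) 0 := by
  induction j with
  | zero => rfl
  | succ j ih =>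
    rw [List.replicate_succ', coords_append, ih (by omega),
      show r - j = r - (j + 1) + 1 by omega, next_fiberPt_zero]

/-- Blowing up `[0_(k)]` on `𝔽_r` makes the fiber of `𝔽_(r - k)` appear. -/
theorem coords_zerosPt {r k : ℕ} (hk : k + 1 ≤ r) (q : K) :
    coords r (zerosPt k q) = fiberPt (r - k) q := by
  cases k with
  | zero => rfl
  | succ k =>
    rw [zerosPt, coords_append, coords_replicate (by omega),
      show r - k = r - (k + 1) + 1 by omega, next_fiberPt_zero]

theorem mem_blownUp_pair {L : Type u} {p p' s : CoordSeq L} :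
    s ∈ blownUp [p, p'] ↔ s ∈ blownUp [p] ∨ s ∈ blownUp [p'] := by
  simp [blownUp]

theorem mem_blownUp_pt {L : Type u} {a : L} {s : CoordSeq L} : s ∈ blownUp [pt a] ↔ s = pt a := by
  obtain ⟨b, l⟩ := s
  simp [blownUp, pt]

theorem mem_blownUp_zerosPt {k : ℕ} {a : K} {s : CoordSeq K} :
    s ∈ blownUp [zerosPt k a] ↔
      s = zerosPt k a ∨ ∃ j < k, s = (0, List.replicate j ((0 : K) : OnePoint K)) := by
  cases k with
  | zero =>
    have h : zerosPt 0 a = pt a := rfl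
    simp [h, mem_blownUp_pt]
  | succ k =>
    obtain ⟨b, l⟩ := s
    simp only [blownUp, zerosPt, List.mem_singleton, exists_eq_left, Set.mem_ofPred_eq,
      List.prefix_concat_iff, Prod.mk.injEq, List.prefix_replicate_iff]
    constructor
    · rintro ⟨rfl, rfl | ⟨h1, h2⟩⟩
      · exact Or.inl ⟨rfl, rfl⟩
      · exact Or.inr ⟨l.length, by omega, rfl, h2⟩
    · rintro (⟨rfl, rfl⟩ | ⟨j, hj, rfl, rfl⟩)
      · exact ⟨rfl, Or.inl rfl⟩
      · exact ⟨rfl, Or.inr (by simp; omega)⟩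

theorem image_coords_zerosPt {r k : ℕ} (hk : k + 1 ≤ r) (a b : K) :
    coords r '' blownUp [zerosPt k a, pt b] =
      {fiberPt (r - k) a, fiberPt r b} ∪ {c | ∃ j < k, c = fiberPt (r - j) 0} := by
  ext c
  constructor
  · rintro ⟨s, hs, rfl⟩
    rw [mem_blownUp_pair, mem_blownUp_zerosPt, mem_blownUp_pt] at hs
    rcases hs with (rfl | ⟨j, hj, rfl⟩) | rfl
    · exact Or.inl (Or.inl (coords_zerosPt hk a))
    · exact Or.inr ⟨j, hj, coords_replicate (by omega)⟩
    · exact Or.inl (Or.inr rfl)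
  · rintro ((rfl | rfl) | ⟨j, hj, rfl⟩)
    · exact ⟨zerosPt k a, mem_blownUp_pair.2 (Or.inl (mem_blownUp_zerosPt.2 (Or.inl rfl))),
        coords_zerosPt hk a⟩
    · exact ⟨pt b, mem_blownUp_pair.2 (Or.inr (mem_blownUp_pt.2 rfl)), rfl⟩
    · exact ⟨_, mem_blownUp_pair.2 (Or.inl (mem_blownUp_zerosPt.2 (Or.inr ⟨j, hj, rfl⟩))),
        coords_replicate (by omega)⟩

theorem image_coords_pt (r : ℕ) (a b : K) :
    coords r '' blownUp [pt a, pt b] = {fiberPt r a, fiberPt r b} := by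
  ext c
  constructor
  · rintro ⟨s, hs, rfl⟩
    rw [mem_blownUp_pair, mem_blownUp_pt, mem_blownUp_pt] at hs
    rcases hs with rfl | rfl
    · exact Or.inl rfl
    · exact Or.inr rfl
  · rintro (rfl | rfl)
    · exact ⟨pt a, mem_blownUp_pair.2 (Or.inl (mem_blownUp_pt.2 rfl)), rfl⟩
    · exact ⟨pt b, mem_blownUp_pair.2 (Or.inr (mem_blownUp_pt.2 rfl)), rfl⟩

theorem mem_blownUp_ptInf {L : Type u} {q w : L} {s : CoordSeq L} :
    s ∈ blownUp [ptInf q w] ↔ s = (q, []) ∨ s = (q, [∞]) ∨ s = ptInf q w := by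
  obtain ⟨b, l⟩ := s
  have : [∞, (w : OnePoint L)] = [∞] ++ [(w : OnePoint L)] := rfl
  simp only [blownUp, ptInf, List.mem_singleton, exists_eq_left, Set.mem_ofPred_eq,
    Prod.mk.injEq]
  rw [this, List.prefix_concat_iff, ← List.nil_append [(∞ : OnePoint L)],
    List.prefix_concat_iff, List.prefix_nil]
  tauto

theorem mem_blownUp_ptInf' {L : Type u} {q w p : L} {s : CoordSeq L} :
    s ∈ blownUp [ptInf' q w p] ↔
      s = (q, []) ∨ s = (q, [∞]) ∨ s = ptInf q w ∨ s = ptInf' q w p := by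
  have h := mem_blownUp_ptInf (q := q) (w := w) (s := s)
  obtain ⟨b, l⟩ := s
  have : [∞, (w : OnePoint L), (p : OnePoint L)] = [∞, (w : OnePoint L)] ++ [(p : OnePoint L)] :=
    rfl
  simp only [blownUp, ptInf', ptInf, List.mem_singleton, exists_eq_left, Set.mem_ofPred_eq,
    Prod.mk.injEq] at h ⊢
  rw [this, List.prefix_concat_iff]
  tauto

theorem image_coords_ptInf (r : ℕ) (q w : K) :
    coords r '' blownUp [ptInf q w] = {fiberPt r q, cuspPt r q, next (cuspPt r q) w} := by
  ext c
  constructor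
  · rintro ⟨s, hs, rfl⟩
    rcases mem_blownUp_ptInf.1 hs with rfl | rfl | rfl
    · exact Or.inl rfl
    · exact Or.inr (Or.inl rfl)
    · exact Or.inr (Or.inr rfl)
  · rintro (rfl | rfl | rfl)
    · exact ⟨(q, []), mem_blownUp_ptInf.2 (Or.inl rfl), rfl⟩
    · exact ⟨(q, [∞]), mem_blownUp_ptInf.2 (Or.inr (Or.inl rfl)), rfl⟩
    · exact ⟨ptInf q w, mem_blownUp_ptInf.2 (Or.inr (Or.inr rfl)), rfl⟩

theorem image_coords_ptInf' (r : ℕ) (q w p : K) :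
    coords r '' blownUp [ptInf' q w p] =
      {fiberPt r q, cuspPt r q, next (cuspPt r q) w, next (next (cuspPt r q) w) p} := by
  ext c
  constructor
  · rintro ⟨s, hs, rfl⟩
    rcases mem_blownUp_ptInf'.1 hs with rfl | rfl | rfl | rfl
    · exact Or.inl rfl
    · exact Or.inr (Or.inl rfl)
    · exact Or.inr (Or.inr (Or.inl rfl))
    · exact Or.inr (Or.inr (Or.inr rfl))
  · rintro (rfl | rfl | rfl | rfl)
    · exact ⟨(q, []), mem_blownUp_ptInf'.2 (Or.inl rfl), rfl⟩
    · exact ⟨(q, [∞]), mem_blownUp_ptInf'.2 (Or.inr (Or.inl rfl)), rfl⟩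
    · exact ⟨ptInf q w, mem_blownUp_ptInf'.2 (Or.inr (Or.inr (Or.inl rfl))), rfl⟩
    · exact ⟨ptInf' q w p, mem_blownUp_ptInf'.2 (Or.inr (Or.inr (Or.inr rfl))), rfl⟩

end BlownUpPoints

/-! ### Types of the boundary curves of the normal forms -/

section Types

variable {K : Type u} [Field K]

namespace NormalForm

/-- The number `r` such that the normal form is a blowup of `𝔽_r`. -/
def r : NormalForm K → ℕ
  | i => 1
  | ii r _ => r
  | iii r _ => r
  | iv r => r
  | v r => r
  | vi r => r

/-- The points that are blown up. -/
def pts : NormalForm K → List (CoordSeq K)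
  | i => [pt 0, pt 1]
  | ii _ q => [pt 1, pt q]
  | iii _ k => [zerosPt k 1, pt 1]
  | iv _ => [ptInf' 0 1 0]
  | v _ => [ptInf' 0 1 1]
  | vi _ => [ptInf 1 1]

theorem isIso_iff (e : NormalForm K) (S : GaSurface K) : e.IsIso S ↔ S.IsoBl e.r e.pts := by
  cases e <;> rfl

/-- `e.HasType m n`, where `n ≤ m`, says that the linear forms have the orders `-m` and `-n` along
some boundary curve of the normal form `e`. -/
def HasType : NormalForm K → ℤ → ℤ → Prop
  | i, m, n => m = 1 ∧ n = 0 ∨ m = 1 ∧ n = 1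
  | ii r q, m, n => m = 1 ∧ n = 0 ∨ m = r ∧ n = 1 ∨ q = 0 ∧ m = r - 1 ∧ n = 1
  | iii r k, m, n => m = 1 ∧ n = 0 ∨ (r - k ≤ m ∧ m ≤ r) ∧ n = 1
  | iv r, m, n => m = 1 ∧ n = 0 ∨ m = r ∧ n = 1 ∨ m = r - 1 ∧ n = 1 ∨ m = 2 * r - 1 ∧ n = 2
  | v r, m, n => m = 1 ∧ n = 0 ∨ m = r ∧ n = 1 ∨ m = r - 1 ∧ n = 1 ∨ m = 2 * r - 1 ∧ n = 2
  | vi r, m, n => m = 1 ∧ n = 0 ∨ m = r ∧ n = 1 ∨ m = 2 * r ∧ n = 2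

theorem HasType.le {e : NormalForm K} (he : e.Valid) {m n : ℤ} (h : e.HasType m n) : n ≤ m := by
  cases e <;> simp only [Valid, HasType] at he h <;> omega

/-- The boundary curves of `Bl(𝔽_r, [0, ∞, 1, p])`. -/
theorem mem_curves_ptInf' {r : ℕ} {p : K} {c : FunField K × FunField K} :
    c ∈ curves r [ptInf' 0 1 p] ↔ c = curveS K ∨ c = curveF K r ∨ c = curveE (fiberPt r 0) ∨
      c = curveE (cuspPt r 0) ∨ c = curveE (next (cuspPt r 0) (1 : K)) ∨
      c = curveE (next (next (cuspPt r 0) (1 : K)) p) := by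
  rw [curves_eq, image_coords_ptInf']
  simp only [Set.image_insert_eq, Set.image_singleton, Set.mem_union, Set.mem_insert_iff,
    Set.mem_singleton_iff]
  tauto

theorem linOrds_curves_ptInf' {r : ℕ} (hr : 2 ≤ r) {p : K} {c : FunField K × FunField K}
    (hc : c ∈ curves r [ptInf' 0 1 p]) : c = curveS K ∨ linOrds c = {-(r : ℤ), -1} ∨
      linOrds c = {-(r - 1 : ℤ), -1} ∨ OverCusp r 0 c := by
  rcases mem_curves_ptInf'.1 hc with rfl | rfl | rfl | rfl | rfl | rfl
  · exact Or.inl rfl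
  · exact Or.inr (Or.inl (linOrds_curveF r))
  · obtain ⟨r, rfl⟩ : ∃ r', r = r' + 1 := ⟨r - 1, by omega⟩
    rw [curveE_fiberPt_zero, linOrds_curveF]
    exact Or.inr (Or.inr (Or.inl (by simp)))
  · exact Or.inr (Or.inr (Or.inr (overCusp_cuspPt r 0)))
  · exact Or.inr (Or.inr (Or.inr (overCusp_next r 0 one_ne_zero)))
  · exact Or.inr (Or.inr (Or.inr (overCusp_next_next r 0 p one_ne_zero)))

theorem linOrds_ptInf'_iff {r : ℕ} (hr : 2 ≤ r) {p : K} :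
    (∀ c ∈ curves r [ptInf' 0 1 p], ∃ m n, (iv r : NormalForm K).HasType m n ∧
      linOrds c = {-m, -n}) ∧ ∀ m n, (iv r : NormalForm K).HasType m n →
        ∃ c ∈ curves r [ptInf' 0 1 p], linOrds c = {-m, -n} := by
  constructor
  · intro c hc
    rcases linOrds_curves_ptInf' hr hc with rfl | h | h | h
    · exact ⟨1, 0, Or.inl ⟨rfl, rfl⟩, by rw [linOrds_curveS]; simp⟩
    · exact ⟨r, 1, by simp [HasType], h⟩
    · exact ⟨r - 1, 1, by simp [HasType], h⟩
    · exact ⟨2 * r - 1, 2, by simp [HasType], by rw [h.linOrds_zero]; congr 1; ring⟩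
  · rintro m n (⟨rfl, rfl⟩ | ⟨rfl, rfl⟩ | ⟨rfl, rfl⟩ | ⟨rfl, rfl⟩)
    · exact ⟨curveS K, mem_curves_ptInf'.2 (by simp), by rw [linOrds_curveS]; simp⟩
    · exact ⟨curveF K r, mem_curves_ptInf'.2 (by simp), linOrds_curveF r⟩
    · obtain ⟨r, rfl⟩ : ∃ r', r = r' + 1 := ⟨r - 1, by omega⟩
      refine ⟨curveE (fiberPt (r + 1) 0), mem_curves_ptInf'.2 (by simp), ?_⟩
      rw [curveE_fiberPt_zero, linOrds_curveF]
      simp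
    · refine ⟨curveE (cuspPt r 0), mem_curves_ptInf'.2 (by simp), ?_⟩
      rw [(overCusp_cuspPt r 0).linOrds_zero]
      congr 1
      ring

theorem mem_curves_ptInf {r : ℕ} {c : FunField K × FunField K} :
    c ∈ curves r [ptInf (1 : K) 1] ↔ c = curveS K ∨ c = curveF K r ∨ c = curveE (fiberPt r 1) ∨
      c = curveE (cuspPt r 1) ∨ c = curveE (next (cuspPt r 1) (1 : K)) := by
  rw [curves_eq, image_coords_ptInf]
  simp only [Set.image_insert_eq, Set.image_singleton, Set.mem_union, Set.mem_insert_iff,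
    Set.mem_singleton_iff]
  tauto

theorem mem_curves_pt {r : ℕ} {a b : K} {c : FunField K × FunField K} :
    c ∈ curves r [pt a, pt b] ↔ c = curveS K ∨ c = curveF K r ∨ c = curveE (fiberPt r a) ∨
      c = curveE (fiberPt r b) := by
  rw [curves_eq, image_coords_pt]
  simp only [Set.image_insert_eq, Set.image_singleton, Set.mem_union, Set.mem_insert_iff,
    Set.mem_singleton_iff]
  tauto

theorem mem_curves_zerosPt {r k : ℕ} (hk : k + 1 ≤ r) {a b : K} {c : FunField K × FunField K} :
    c ∈ curves r [zerosPt k a, pt b] ↔ c = curveS K ∨ c = curveE (fiberPt (r - k) a) ∨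
      c = curveE (fiberPt r b) ∨ ∃ j ≤ k, c = curveF K (r - j) := by
  rw [curves_eq, image_coords_zerosPt hk]
  constructor
  · rintro ((rfl | rfl) | ⟨_, (rfl | rfl) | ⟨j, hj, rfl⟩, rfl⟩)
    · simp
    · exact Or.inr (Or.inr (Or.inr ⟨0, by omega, rfl⟩))
    · simp
    · simp
    · refine Or.inr (Or.inr (Or.inr ⟨j + 1, by omega, ?_⟩))
      rw [show r - j = r - (j + 1) + 1 by omega, curveE_fiberPt_zero]
  · rintro (rfl | rfl | rfl | ⟨j, hj, rfl⟩)
    · simp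
    · exact Or.inr ⟨_, Or.inl (Or.inl rfl), rfl⟩
    · exact Or.inr ⟨_, Or.inl (Or.inr rfl), rfl⟩
    · cases j with
      | zero => simp
      | succ j =>
        refine Or.inr ⟨_, Or.inr ⟨j, by omega, rfl⟩, ?_⟩
        rw [show r - j = r - (j + 1) + 1 by omega, curveE_fiberPt_zero]

/-- The types in `HasType` are precisely those of the boundary curves. -/
theorem linOrds_curves_iff {e : NormalForm K} (he : e.Valid) :
    (∀ c ∈ curves e.r e.pts, ∃ m n, e.HasType m n ∧ linOrds c = {-m, -n}) ∧
      ∀ m n, e.HasType m n → ∃ c ∈ curves e.r e.pts, linOrds c = {-m, -n} := by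
  have hS : linOrds (curveS K) = {-1, -0} := by rw [linOrds_curveS]; simp
  have h1 : linOrds (curveE (fiberPt 1 (1 : K))) = {-1, -0} := by
    rw [linOrds_curveE_fiberPt_one, Set.pair_comm]; simp
  cases e with
  | i =>
    have h0 : linOrds (curveE (fiberPt 1 (0 : K))) = {-1, -0} := by
      rw [linOrds_curveE_fiberPt_one, Set.pair_comm]; simp
    constructor
    · intro c hc
      rcases mem_curves_pt.1 hc with rfl | rfl | rfl | rfl
      · exact ⟨1, 0, by simp [HasType], hS⟩
      · exact ⟨1, 1, by simp [HasType], linOrds_curveF 1⟩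
      · exact ⟨1, 0, by simp [HasType], h0⟩
      · exact ⟨1, 0, by simp [HasType], h1⟩
    · rintro m n (⟨rfl, rfl⟩ | ⟨rfl, rfl⟩)
      · exact ⟨_, mem_curves_pt.2 (Or.inl rfl), hS⟩
      · exact ⟨_, mem_curves_pt.2 (Or.inr (Or.inl rfl)), linOrds_curveF 1⟩
  | ii r q =>
    have hr : 2 ≤ r := he.1
    change (∀ c ∈ curves r [pt 1, pt q], _) ∧ ∀ m n, _ → ∃ c ∈ curves r [pt 1, pt q], _
    constructor
    · intro c hc
      rcases mem_curves_pt.1 hc with rfl | rfl | rfl | rfl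
      · exact ⟨1, 0, by simp [HasType], hS⟩
      · exact ⟨r, 1, by simp [HasType], linOrds_curveF r⟩
      · exact ⟨r, 1, by simp [HasType], linOrds_curveE_fiberPt (by omega) one_ne_zero⟩
      · by_cases hq : q = 0
        · obtain ⟨r, rfl⟩ : ∃ r', r = r' + 1 := ⟨r - 1, by omega⟩
          refine ⟨r, 1, by simp [HasType, hq], ?_⟩
          rw [hq, curveE_fiberPt_zero, linOrds_curveF]
        · exact ⟨r, 1, by simp [HasType], linOrds_curveE_fiberPt (by omega) hq⟩
    · rintro m n (⟨rfl, rfl⟩ | ⟨rfl, rfl⟩ | ⟨rfl, rfl, rfl⟩)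
      · exact ⟨_, mem_curves_pt.2 (Or.inl rfl), hS⟩
      · exact ⟨_, mem_curves_pt.2 (Or.inr (Or.inl rfl)), linOrds_curveF r⟩
      · obtain ⟨r, rfl⟩ : ∃ r', r = r' + 1 := ⟨r - 1, by omega⟩
        refine ⟨_, mem_curves_pt.2 (Or.inr (Or.inr (Or.inr rfl))), ?_⟩
        rw [curveE_fiberPt_zero, linOrds_curveF]
        simp
  | iii r k =>
    obtain ⟨hr, hk, hkr⟩ := he
    change (∀ c ∈ curves r [zerosPt k 1, pt 1], _) ∧
      ∀ m n, _ → ∃ c ∈ curves r [zerosPt k 1, pt 1], _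
    constructor
    · intro c hc
      rcases (mem_curves_zerosPt hkr).1 hc with rfl | rfl | rfl | ⟨j, hj, rfl⟩
      · exact ⟨1, 0, by simp [HasType], hS⟩
      · by_cases h : r - k = 1
        · exact ⟨1, 0, by simp [HasType], by rw [h, h1]⟩
        · refine ⟨(r - k : ℕ), 1, Or.inr ⟨by omega, rfl⟩,
            linOrds_curveE_fiberPt h one_ne_zero⟩
      · exact ⟨r, 1, by simp [HasType], linOrds_curveE_fiberPt (by omega) one_ne_zero⟩
      · exact ⟨(r - j : ℕ), 1, Or.inr ⟨by omega, rfl⟩, linOrds_curveF _⟩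
    · rintro m n (⟨rfl, rfl⟩ | ⟨⟨h1, h2⟩, rfl⟩)
      · exact ⟨_, (mem_curves_zerosPt hkr).2 (Or.inl rfl), hS⟩
      · refine ⟨_, (mem_curves_zerosPt hkr).2 (Or.inr (Or.inr (Or.inr
          ⟨r - m.toNat, by omega, rfl⟩))), ?_⟩
        rw [linOrds_curveF]
        congr 2
        omega
  | iv r => exact linOrds_ptInf'_iff he
  | v r => exact linOrds_ptInf'_iff ((by norm_num : 2 ≤ 3).trans he)
  | vi r =>
    have hr : 2 ≤ r := he
    have hcusp : ∀ c : FunField K × FunField K, OverCusp r (1 : K) c →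
        linOrds c = {-(2 * r : ℤ), -2} := by
      intro c hc
      rw [hc.linOrds hr one_ne_zero, neg_mul]
    change (∀ c ∈ curves r [ptInf 1 1], _) ∧ ∀ m n, _ → ∃ c ∈ curves r [ptInf 1 1], _
    constructor
    · intro c hc
      rcases mem_curves_ptInf.1 hc with rfl | rfl | rfl | rfl | rfl
      · exact ⟨1, 0, by simp [HasType], hS⟩
      · exact ⟨r, 1, by simp [HasType], linOrds_curveF r⟩
      · exact ⟨r, 1, by simp [HasType], linOrds_curveE_fiberPt (by omega) one_ne_zero⟩
      · exact ⟨2 * r, 2, by simp [HasType], hcusp _ (overCusp_cuspPt r 1)⟩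
      · exact ⟨2 * r, 2, by simp [HasType], hcusp _ (overCusp_next r 1 one_ne_zero)⟩
    · rintro m n (⟨rfl, rfl⟩ | ⟨rfl, rfl⟩ | ⟨rfl, rfl⟩)
      · exact ⟨_, mem_curves_ptInf.2 (Or.inl rfl), hS⟩
      · exact ⟨_, mem_curves_ptInf.2 (Or.inr (Or.inl rfl)), linOrds_curveF r⟩
      · exact ⟨curveE (cuspPt r 1), mem_curves_ptInf.2 (by simp),
          hcusp _ (overCusp_cuspPt r 1)⟩

theorem neg_pair_inj {m n m' n' : ℤ} (h : ({-m, -n} : Set ℤ) = {-m', -n'}) (hm : n ≤ m)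
    (hm' : n' ≤ m') : m = m' ∧ n = n' := by
  have h1 : -m ∈ ({-m', -n'} : Set ℤ) := h ▸ Or.inl rfl
  have h2 : -n ∈ ({-m', -n'} : Set ℤ) := h ▸ Or.inr rfl
  have h3 : -m' ∈ ({-m, -n} : Set ℤ) := h ▸ Or.inl rfl
  have h4 : -n' ∈ ({-m, -n} : Set ℤ) := h ▸ Or.inr rfl
  simp only [Set.mem_insert_iff, Set.mem_singleton_iff] at h1 h2 h3 h4
  omega

/-- The types of the boundary curves are invariants. -/
theorem HasType.of_mapRings_eq [Infinite K] {e e' : NormalForm K} (he : e.Valid) (he' : e'.Valid)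
    {M : GL (Fin 2) K} (h : mapRings M (blowupPoints e.r e.pts) = blowupPoints e'.r e'.pts)
    {m n : ℤ} (hmn : e.HasType m n) : e'.HasType m n := by
  obtain ⟨c, hc, hcmn⟩ := (linOrds_curves_iff he).2 m n hmn
  obtain ⟨c', hc', hcc'⟩ := exists_curve h hc
  obtain ⟨m', n', h', hcmn'⟩ := (linOrds_curves_iff he').1 c' hc'
  rw [linOrds_eq_of_ord_iff hcc', hcmn] at hcmn'
  obtain ⟨rfl, rfl⟩ := neg_pair_inj hcmn' (hmn.le he) (h'.le he')
  exact h'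

end NormalForm

end Types

/-! ### Uniqueness of the normal form -/

section Uniqueness

variable {K : Type u} [Field K] {c c' : FunField K × FunField K}

theorem curveS_mem_curves (r : ℕ) (ps : List (CoordSeq K)) : curveS K ∈ curves r ps := by
  rw [curves_eq]
  exact Or.inl (Or.inl rfl)

/-- If the section `s` is the only boundary curve along which some linear form has order zero, then
it is preserved. Among the linear forms, only the multiples of `y` have order zero along `s`, so the
linear substitution is triangular. -/
theorem triangular_of_section [Infinite K] {r r' : ℕ} {ps ps' : List (CoordSeq K)}
    {M : GL (Fin 2) K} (h : mapRings M (blowupPoints r ps) = blowupPoints r' ps')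
    (hs : ∀ c ∈ curves r' ps', 0 ∈ linOrds c → c = curveS K) :
    M 1 0 = 0 ∧ M 0 0 ≠ 0 ∧ M 1 1 ≠ 0 ∧ Ord (curveS K) (linAut M (y K)) 0 := by
  obtain ⟨c, hc, hcS⟩ := exists_curve h (curveS_mem_curves r ps)
  have h0 : (0 : ℤ) ∈ linOrds c := by
    rw [linOrds_eq_of_ord_iff hcS, linOrds_curveS]
    simp
  have hS := isCoord_curveS (K := K)
  rw [hs c hc h0] at hcS
  have hy : Ord (curveS K) (linAut M (y K)) 0 := (hcS _ _).2 (ord_fst (curveS K))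
  have h10 : M 1 0 = 0 := by
    by_contra hne
    have hx : Ord (curveS K) (x K) (-1) :=
      ((ord_snd (curveS K)).inv hS).congr (by simp [curveS]) rfl
    have := (hx.const_mul hS hne).add_of_ge hS
      (((ord_fst (curveS K)).ge.const_mul hS (M 1 1)).congr rfl (by norm_num))
    rw [linAut_y] at hy
    have := this.unique hS hy
    norm_num at this
  have hdet : M.det.val ≠ 0 := M.det.ne_zero
  rw [Matrix.GeneralLinearGroup.val_det_apply, Matrix.det_fin_two, h10, mul_zero,
    sub_zero] at hdet
  exact ⟨h10, left_ne_zero_of_mul hdet, right_ne_zero_of_mul hdet, hy⟩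

/-- The image of `x - p y ^ m` under a triangular substitution. -/
theorem linAut_sub {M : GL (Fin 2) K} (h10 : M 1 0 = 0) (p : K) (m : ℕ) :
    linAut M (x K - algebraMap K _ p * y K ^ m) =
      algebraMap K _ (M 0 0) * x K + algebraMap K _ (-(p * M 1 1 ^ m)) * y K ^ m +
        algebraMap K _ (M 0 1) * y K := by
  simp only [map_sub, map_mul, map_pow, linAut_x, linAut_y, AlgEquiv.commutes, h10, map_neg,
    map_zero, zero_mul, zero_add]
  ring

/-- The pole of order `m` of `x - p y ^ m` along the fiber of `𝔽_m` persists under triangular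
substitutions, as these change the function by a scaling and by a multiple of `y` only. -/
theorem ord_curveF_linAut {M : GL (Fin 2) K} (h10 : M 1 0 = 0) (h00 : M 0 0 ≠ 0) (p : K) {m : ℕ}
    (hm : 2 ≤ m) : Ord (curveF K m) (linAut M (x K - algebraMap K _ p * y K ^ m)) (-m) := by
  rw [linAut_sub h10]
  refine (ord_curveF_add m (Or.inl h00)).add_of_ge (isCoord_curveF m) ?_
  exact ((ord_curveF_y m).ge.const_mul (isCoord_curveF m) _).mono (isCoord_curveF m) (by omega)

/-- A triangular substitution acts on the fiber of `𝔽_m`, for `m ≥ 2`, by a scaling. So the order of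
the image of `x - p y ^ m` can jump at the exceptional curve of one point of the fiber only. -/
theorem ord_curveE_linAut {M : GL (Fin 2) K} (h10 : M 1 0 = 0) {p p' : K} {m : ℕ}
    (hm : 2 ≤ m) (h : M 0 0 * p' ≠ p * M 1 1 ^ m) :
    Ord (curveE (fiberPt m p')) (linAut M (x K - algebraMap K _ p * y K ^ m)) (-m) := by
  rw [linAut_sub h10]
  have hc := (isCoord_fiberPt m p').curveE
  refine (ord_curveE_fiberPt_add m p' ?_).add_of_ge hc ?_
  · rwa [← sub_eq_add_neg, sub_ne_zero]
  · exact ((ord_curveE_fiberPt_y m p').ge.const_mul hc _).mono hc (by omega)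

namespace NormalForm

/-- The surfaces `Bl(𝔽_r, [1], [q])` with `q ≠ 0, 1` are classified by the unordered pair of the
points `1, q` up to scaling. -/
theorem eq_or_eq_inv_of_mapRings_eq [Infinite K] {r : ℕ} (hr : 2 ≤ r) {q q' : K} (hq0 : q ≠ 0)
    (hq1 : q ≠ 1) (hq0' : q' ≠ 0) {M : GL (Fin 2) K}
    (h : mapRings M (blowupPoints r [pt 1, pt q]) = blowupPoints r [pt 1, pt q']) :
    q' = q ∨ q' = q⁻¹ := by
  have hlin : ∀ p : K, p ≠ 0 → linOrds (curveE (fiberPt r p)) = {-(r : ℤ), -1} := fun p hp =>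
    linOrds_curveE_fiberPt (by omega) hp
  obtain ⟨h10, h00, h11, -⟩ := triangular_of_section h (by
    intro c hc h0
    rcases mem_curves_pt.1 hc with rfl | rfl | rfl | rfl
    · rfl
    · rw [linOrds_curveF] at h0
      simp at h0
      omega
    · rw [hlin 1 one_ne_zero] at h0
      simp at h0
      omega
    · rw [hlin q' hq0'] at h0
      simp at h0
      omega)
  -- the exceptional curve of `[p]` goes to the one of `[p']`, where `p'` is a fixed multiple of `p`
  have key : ∀ p : K, p ≠ 0 → curveE (fiberPt r p) ∈ curves r [pt 1, pt q] →
      ∃ p', (p' = 1 ∨ p' = q') ∧ M 0 0 * p' = p * M 1 1 ^ r := by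
    intro p hp hpc
    obtain ⟨c, hc, hcp⟩ := exists_curve h hpc
    have hcoord := isCoord_of_mem_curves hc
    have h1 := (hcp _ _).2 (ord_curveE_fiberPt_self r p)
    have hE : ∀ p', c = curveE (fiberPt r p') → M 0 0 * p' = p * M 1 1 ^ r := by
      rintro p' rfl
      by_contra hne
      have := h1.unique hcoord (ord_curveE_linAut h10 hr hne)
      omega
    rcases mem_curves_pt.1 hc with rfl | rfl | hc | hc
    · have h2 := linOrds_eq_of_ord_iff hcp
      rw [hlin p hp, linOrds_curveS] at h2
      have h3 : (0 : ℤ) ∈ ({-1, 0} : Set ℤ) := by simp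
      rw [h2] at h3
      simp at h3
      omega
    · have := h1.unique hcoord (ord_curveF_linAut h10 h00 p hr)
      omega
    · exact ⟨1, Or.inl rfl, hE 1 hc⟩
    · exact ⟨q', Or.inr rfl, hE q' hc⟩
  obtain ⟨p₁, hp₁, e₁⟩ := key 1 one_ne_zero (mem_curves_pt.2 (by simp))
  obtain ⟨p₂, hp₂, e₂⟩ := key q hq0 (mem_curves_pt.2 (by simp))
  have e : p₂ = q * p₁ := by
    refine mul_left_cancel₀ h00 ?_
    linear_combination e₂ - q * e₁
  rcases hp₁ with rfl | rfl <;> rcases hp₂ with rfl | rfl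
  · exact absurd (by simpa using e.symm) hq1
  · exact Or.inl (by simpa using e)
  · exact Or.inr (eq_inv_of_mul_eq_one_right e.symm)
  · exact absurd (mul_right_cancel₀ hq0' (by rw [one_mul]; exact e.symm)) hq1

/-- The surfaces `Bl(𝔽_r, [0, 1], [1])` and `Bl(𝔽_r, [1], [0])` have boundary curves of the same
types. For `r ≥ 3`, they differ in the curve of type `r - 1, 1`: along this curve of the first
surface, `x - y ^ (r - 1)` has a larger order than `y ^ (r - 1)`, but its triangular images do not
along the fiber of `𝔽_(r - 1)`, the curve of this type in the second surface. For `r = 2`, the first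
surface has two curves of type `1, 0`, and the second one has only one. -/
theorem not_mapRings_eq_zerosPt [Infinite K] {r : ℕ} (hr : 2 ≤ r) {M : GL (Fin 2) K} :
    mapRings M (blowupPoints r [zerosPt 1 1, pt 1]) ≠ blowupPoints r [pt (1 : K), pt 0] := by
  intro h
  obtain ⟨r, rfl⟩ : ∃ r', r = r' + 1 := ⟨r - 1, by omega⟩
  have hmem : ∀ c, c ∈ curves (r + 1) [pt (1 : K), pt 0] ↔ c = curveS K ∨ c = curveF K (r + 1) ∨
      c = curveE (fiberPt (r + 1) 1) ∨ c = curveF K r := fun c => by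
    rw [mem_curves_pt, curveE_fiberPt_zero]
  have hlin : linOrds (curveE (fiberPt (r + 1) (1 : K))) = {-((r + 1 : ℕ) : ℤ), -1} :=
    linOrds_curveE_fiberPt (by omega) one_ne_zero
  have hS : ∀ c ∈ curves (r + 1) [pt (1 : K), pt 0], 0 ∈ linOrds c → c = curveS K := by
    intro c hc h0
    rcases (hmem c).1 hc with rfl | rfl | rfl | rfl
    · rfl
    · rw [linOrds_curveF] at h0
      simp at h0
      omega
    · rw [hlin] at h0
      simp at h0
      omega
    · rw [linOrds_curveF] at h0
      simp at h0
      omega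
  obtain ⟨h10, h00, h11, hy⟩ := triangular_of_section h hS
  obtain ⟨c, hc, hcp⟩ := exists_curve h (c := curveE (fiberPt r 1))
    ((mem_curves_zerosPt (by omega)).2 (Or.inr (Or.inl rfl)))
  have hcoord := isCoord_of_mem_curves hc
  have h2 := linOrds_eq_of_ord_iff hcp
  -- over the fiber of `𝔽₁`, the function `x - y` is itself a linear form
  by_cases hr1 : r = 1
  · subst hr1
    rw [linOrds_curveE_fiberPt_one] at h2
    have h3 := hS c hc (by rw [h2]; simp)
    subst h3
    have := ((hcp _ _).2 (ord_curveE_fiberPt_y 1 1)).unique hcoord hy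
    norm_num at this
  · rw [linOrds_curveE_fiberPt hr1 one_ne_zero] at h2
    have h3 := (hcp _ _).2 (ord_curveE_fiberPt_self r 1)
    rcases (hmem c).1 hc with rfl | rfl | rfl | rfl
    · have h4 : (0 : ℤ) ∈ linOrds (curveS K) := by rw [linOrds_curveS]; simp
      rw [h2] at h4
      simp at h4
      omega
    · have h4 : -((r + 1 : ℕ) : ℤ) ∈ linOrds (curveF K (r + 1)) := by rw [linOrds_curveF]; simp
      rw [h2] at h4
      simp at h4
      omega
    · have h4 : -((r + 1 : ℕ) : ℤ) ∈ linOrds (curveE (fiberPt (r + 1) (1 : K))) := by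
        rw [hlin]; simp
      rw [h2] at h4
      simp at h4
      omega
    · have := h3.unique hcoord (ord_curveF_linAut h10 h00 1 (by omega))
      omega

/-- If `u, v` are the coordinates at `[0, ∞]`, then `u / v = x ^ 2 / y ^ (2 * r - 1)`. -/
theorem fst_div_snd_cuspPt (r : ℕ) :
    (cuspPt r (0 : K)).1 / (cuspPt r (0 : K)).2 * y K ^ (2 * r) = x K ^ 2 * y K := by
  have hx := x_ne_zero (K := K)
  have hy := y_ne_zero (K := K)
  have : cuspPt r (0 : K) = (x K / y K ^ r, 1 / y K / (x K / y K ^ r)) := by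
    simp [cuspPt, fiberPt, next_infty]
  rw [this, mul_comm 2 r, pow_mul]
  field_simp

/-- The function `x ^ 2 / y ^ (2 * r - 1) - 1` vanishes to order at least two along the last
exceptional curve over `[0, ∞, 1, 0]`. No triangular substitution takes it to a function that does so
along a curve over `[0, ∞, 1, 1]`. The assumption `r ≥ 3` is needed: for `r = 2`, the two surfaces
are isomorphic by a shear. -/
theorem not_mapRings_eq_ptInf' [Infinite K] {r : ℕ} (hr : 3 ≤ r) {M : GL (Fin 2) K} :
    mapRings M (blowupPoints r [ptInf' (0 : K) 1 0]) ≠ blowupPoints r [ptInf' (0 : K) 1 1] := by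
  intro h
  have hcases := fun c hc => linOrds_curves_ptInf' (K := K) (r := r) (p := 1) (c := c)
    (by omega) hc
  obtain ⟨h10, h00, h11, -⟩ := triangular_of_section h (by
    intro c hc h0
    rcases hcases c hc with h1 | h1 | h1 | h1
    · exact h1
    · rw [h1] at h0
      simp at h0
      omega
    · rw [h1] at h0
      simp at h0
      omega
    · rw [h1.linOrds_zero] at h0
      simp at h0
      omega)
  set e : FunField K × FunField K := curveE (next (next (cuspPt r 0) (1 : K)) (0 : K)) with he
  have hec : OverCusp r 0 e := overCusp_next_next r 0 0 one_ne_zero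
  obtain ⟨c, hc, hcp⟩ := exists_curve h (c := e) (mem_curves_ptInf'.2 (by simp [he]))
  have h2 := linOrds_eq_of_ord_iff hcp
  rw [hec.linOrds_zero] at h2
  have hx := x_ne_zero (K := K)
  have hy := y_ne_zero (K := K)
  -- the curve `x ^ 2 = y ^ (2 * r - 1)`, multiplied by `y` to avoid the subtraction
  have hF : OrdGE e (x K ^ 2 * y K - y K ^ (2 * r)) (2 - 4 * r) := by
    have h3 := ordGE_curveE_next_next r 0 (1 : K) 0
    refine (h3.mul hec.1 (hec.ord_y.pow hec.1 (2 * r)).ge).congr ?_ (by push_cast; ring)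
    rw [← fst_div_snd_cuspPt]
    simp only [map_one, map_zero]
    ring
  have hcF : OrdGE c (linAut M (x K ^ 2 * y K - y K ^ (2 * r))) (2 - 4 * r) := by
    by_cases h0 : x K ^ 2 * y K - y K ^ (2 * r) = 0
    · rw [h0, map_zero]
      exact ⟨0, 1, by simp, by simp⟩
    · obtain ⟨n, hn⟩ := exists_ord hec.1 h0
      exact ((hcp _ _).2 hn).ge.mono (isCoord_of_mem_curves hc) (hn.le_of_ge hec.1 hF)
  have hmem := mem_curves_ptInf'.1 hc
  have hcusp : OverCusp r 0 c := by
    rcases hcases c hc with h1 | h1 | h1 | h1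
    · rw [h1, linOrds_curveS] at h2
      have h3 : (0 : ℤ) ∈ ({-1, 0} : Set ℤ) := by simp
      rw [h2] at h3
      simp at h3
      omega
    · rw [h1] at h2
      have h3 : (-1 : ℤ) ∈ ({-(r : ℤ), -1} : Set ℤ) := by simp
      rw [h2] at h3
      simp at h3
      omega
    · rw [h1] at h2
      have h3 : (-1 : ℤ) ∈ ({-(r - 1 : ℤ), -1} : Set ℤ) := by simp
      rw [h2] at h3
      simp at h3
      omega
    · exact h1
  have hcc := hcusp.1
  -- the terms that come from the summand `y` of the image of `x` are small
  have hsmall : OrdGE c (algebraMap K _ (M 1 1) * y K *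
      (algebraMap K _ (2 * M 0 0 * M 0 1) * (x K * y K) +
        algebraMap K _ (M 0 1 ^ 2) * y K ^ 2)) (2 - 4 * r) := by
    refine ((hcusp.ord_y.const_mul hcc h11).ge.mul hcc (n := -1 - 2 * r) (.add ?_ ?_)).mono hcc
      (by omega)
    · exact ((hcusp.ord_x_zero.mul hcc hcusp.ord_y).ge.const_mul hcc _).congr rfl (by ring)
    · exact ((hcusp.ord_y.pow hcc 2).ge.const_mul hcc _).mono hcc (by norm_num; omega)
  set t : FunField K := (cuspPt r (0 : K)).1 / (cuspPt r (0 : K)).2 with ht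
  have hmain : OrdGE c (algebraMap K _ (M 0 0 ^ 2 * M 1 1) * t +
      algebraMap K _ (-(M 1 1 ^ (2 * r)))) 2 := by
    refine ((hcF.add hsmall.neg).mul hcc ((hcusp.ord_y.pow hcc (2 * r)).inv hcc).ge).congr ?_
      (by push_cast; ring)
    rw [← div_eq_mul_inv, eq_div_iff (pow_ne_zero _ hy), add_mul, mul_assoc, ht,
      fst_div_snd_cuspPt]
    simp only [map_sub, map_mul, map_pow, linAut_x, linAut_y, h10, map_neg, map_zero,
      zero_mul, zero_add, map_ofNat]
    ring
  have hne : M 0 0 ^ 2 * M 1 1 ≠ 0 := mul_ne_zero (pow_ne_zero 2 h00) h11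
  -- `t - 1` has order exactly one along both curves over `[0, ∞, 1]`
  have hone : Ord c (t - algebraMap K _ 1) 1 → False := by
    intro h1
    have h3 := h1.const_mul hcc hne
    have e : algebraMap K (FunField K) (M 0 0 ^ 2 * M 1 1) * t +
        algebraMap K _ (-(M 1 1 ^ (2 * r))) =
      algebraMap K _ (M 0 0 ^ 2 * M 1 1 - M 1 1 ^ (2 * r)) +
        algebraMap K _ (M 0 0 ^ 2 * M 1 1) * (t - algebraMap K _ 1) := by
      simp only [map_sub, map_neg, map_one]
      ring
    rw [e] at hmain
    by_cases h0 : M 0 0 ^ 2 * M 1 1 - M 1 1 ^ (2 * r) = 0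
    · rw [h0, map_zero, zero_add] at hmain
      have := h3.le_of_ge hcc hmain
      norm_num at this
    · have := ((ord_const c h0).add_of_ge hcc (h3.ge.congr rfl (zero_add 1))).le_of_ge hcc hmain
      norm_num at this
  -- the order `-2` of `y` excludes the first three curves, and `t` is not constant along the fourth
  rcases hmem with rfl | rfl | rfl | rfl | rfl | rfl
  · have := (ord_fst (curveS K)).unique hcc hcusp.ord_y
    norm_num at this
  · have := (ord_curveF_y r).unique hcc hcusp.ord_y
    norm_num at this
  · have := (ord_curveE_fiberPt_y r (0 : K)).unique hcc hcusp.ord_y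
    norm_num at this
  · have := (ord_linear (curveE (cuspPt r (0 : K))) (Or.inl hne)).le_of_ge hcc hmain
    norm_num at this
  · exact hone (ord_curveE_next_cuspPt r 0 1)
  · refine hone ((hcusp.2.2.add_of_ge hcc ((ordGE_curveE_next_next r 0 (1 : K) 1).congr rfl
      (by norm_num))).congr ?_ rfl)
    simp only [map_one]
    ring

/-- Surfaces of the list whose boundary curves have the same types belong to the same family, up to
two exceptions. -/
theorem eq_or_of_hasType_iff {e e' : NormalForm K} (he : e.Valid) (he' : e'.Valid)
    (h : ∀ m n, e.HasType m n ↔ e'.HasType m n) :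
    e' = e ∨
      (∃ r q q', 2 ≤ r ∧ q ≠ 0 ∧ q ≠ 1 ∧ q' ≠ 0 ∧ e = ii r q ∧ e' = ii r q') ∨
      (∃ r, 2 ≤ r ∧ (e = iii r 1 ∧ e' = ii r 0 ∨ e = ii r 0 ∧ e' = iii r 1)) ∨
      ∃ r, 3 ≤ r ∧ (e = iv r ∧ e' = v r ∨ e = v r ∧ e' = iv r) := by
  -- `r` is the largest number `m` such that the type `m, 1` occurs
  have hr : e.r = e'.r := by
    have hmax : ∀ {e : NormalForm K}, e.Valid → e.HasType e.r 1 := by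
      intro e he
      cases e <;> simp [HasType, NormalForm.r]
    have hle : ∀ {e : NormalForm K} {m : ℤ}, e.Valid → e.HasType m 1 → m ≤ e.r := by
      intro e m he h
      cases e <;> simp only [Valid, HasType, NormalForm.r] at he h ⊢ <;> omega
    have h1 := hle he' ((h _ _).1 (hmax he))
    have h2 := hle he ((h _ _).2 (hmax he'))
    omega
  -- the types which distinguish the families
  have h1 := h (e.r - 1) 1
  have h2 := h (2 * e.r - 1) 2
  have h3 := h (2 * e.r) 2
  have ht : ∀ r k : ℕ, ∀ m : ℤ,
      (iii r k : NormalForm K).HasType m 1 ↔ (r - k : ℤ) ≤ m ∧ m ≤ r := fun r k m => by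
    simp [HasType]
  have hq : ∀ {r : ℕ} {q : K}, (ii r q).Valid → ((ii r q).HasType (r - 1) 1 ↔ q = 0) := by
    intro r q hv
    simp [HasType]
  have hq' : ∀ {r : ℕ} {m : ℤ}, (ii r 0 : NormalForm K).HasType m 1 ↔ m = r ∨ m = r - 1 := by
    intro r m
    simp [HasType]
  cases e <;> cases e' <;> simp only [NormalForm.r] at hr h1 h2 h3 <;> try subst hr
  all_goals first
    | exact Or.inl rfl
    | exact Or.inr (Or.inr (Or.inr ⟨_, he, Or.inr ⟨rfl, rfl⟩⟩))
    | exact Or.inr (Or.inr (Or.inr ⟨_, he', Or.inl ⟨rfl, rfl⟩⟩))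
    | (exfalso; clear h1; simp [HasType, Valid] at h2 h3 he he'; done)
    | skip
  case ii.ii r q q' =>
    have h0 : q = 0 ↔ q' = 0 := by
      rw [← hq he, ← hq he', h1]
    by_cases hq0 : q = 0
    · rw [hq0, h0.1 hq0]
      exact Or.inl rfl
    · exact Or.inr (Or.inl ⟨r, q, q', he.1, hq0, he.2, fun h => hq0 (h0.2 h), rfl, rfl⟩)
  case ii.iii r q k =>
    have hk := he'.2.1
    have hq0 : q = 0 := (hq he).1 (h1.2 ((ht _ _ _).2 (by omega)))
    subst hq0
    have e := h (r - k) 1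
    rw [ht, hq'] at e
    have : k = 1 := by omega
    exact Or.inr (Or.inr (Or.inl ⟨r, he.1, Or.inr ⟨rfl, by rw [this]⟩⟩))
  case iii.ii r k q =>
    have hk := he.2.1
    have hq0 : q = 0 := (hq he').1 (h1.1 ((ht _ _ _).2 (by omega)))
    subst hq0
    have e := h (r - k) 1
    rw [ht, hq'] at e
    have : k = 1 := by omega
    exact Or.inr (Or.inr (Or.inl ⟨r, he.1, Or.inl ⟨by rw [this], rfl⟩⟩))
  case iii.iii r k k' =>
    have e1 := h (r - k) 1
    have e2 := h (r - k') 1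
    rw [ht, ht] at e1 e2
    left
    congr 1
    omega

/-- Surfaces of the list which a linear substitution takes to each other are the same. -/
theorem Same.of_mapRings_eq [Infinite K] {e e' : NormalForm K} (he : e.Valid) (he' : e'.Valid)
    {M : GL (Fin 2) K} (h : mapRings M (blowupPoints e.r e.pts) = blowupPoints e'.r e'.pts) :
    e.Same e' := by
  have h' := ((mapRings_eq_iff _ _ _).1 h).symm
  have ht : ∀ m n, e.HasType m n ↔ e'.HasType m n := fun m n =>
    ⟨HasType.of_mapRings_eq he he' h, HasType.of_mapRings_eq he' he h'⟩
  rcases eq_or_of_hasType_iff he he' ht with rfl | ⟨r, q, q', hr, hq, hq1, hq', rfl, rfl⟩ |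
      ⟨r, hr, ⟨rfl, rfl⟩ | ⟨rfl, rfl⟩⟩ | ⟨r, hr, ⟨rfl, rfl⟩ | ⟨rfl, rfl⟩⟩
  · exact Or.inl rfl
  · rcases eq_or_eq_inv_of_mapRings_eq hr hq hq1 hq' h with rfl | rfl
    · exact Or.inl rfl
    · exact Or.inr ⟨r, q, hq, rfl, rfl⟩
  · exact absurd h (not_mapRings_eq_zerosPt hr)
  · exact absurd h' (not_mapRings_eq_zerosPt hr)
  · exact absurd h (not_mapRings_eq_ptInf' hr)
  · exact absurd h' (not_mapRings_eq_ptInf' hr)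

end NormalForm

end Uniqueness

/-! ### Adapted coordinates -/

section AdaptedCoordinates

variable {K : Type u} [Field K] {c c' c'' : FunField K × FunField K} {f : FunField K} {a b d k : K}

theorem Reg.ne_zero (hc : IsCoord c) (h : Reg c f k) (hk : k ≠ 0) : f ≠ 0 := by
  rintro rfl
  exact hk (h.unique hc ((reg_const c 0).congr (map_zero _).symm rfl))

/-- A function that vanishes at a point is divisible by the equation `v` of the exceptional curve at
the points with coordinate `q ≠ ∞` of this curve. -/
theorem exists_reg_div_snd (hc : IsCoord c) (h : Reg c f 0) (q : K) :
    ∃ b, Reg (next c (q : OnePoint K)) (f / c.2) b := by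
  have hn := hc.next q
  have hv := hc.snd_ne_zero
  have key : ∀ P, ∃ b, Reg (next c (q : OnePoint K))
      ((ev c P - algebraMap K _ (MvPolynomial.constantCoeff P)) / c.2) b := by
    intro P
    induction P using MvPolynomial.induction_on with
    | C a => exact ⟨0, (reg_const _ 0).congr (by simp) rfl⟩
    | add P Q hP hQ =>
      obtain ⟨b, hb⟩ := hP
      obtain ⟨b', hb'⟩ := hQ
      refine ⟨_, (hb.add hb').congr ?_ rfl⟩
      simp only [map_add]
      ring
    | mul_X P i hP =>
      have h1 : Reg (next c (q : OnePoint K)) (ev c P) (MvPolynomial.constantCoeff P) :=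
        Reg.next hc (Reg.ev (reg_fst c) (reg_snd c) P) q
      have h2 : ∃ b, Reg (next c (q : OnePoint K)) (ev c (MvPolynomial.X i) / c.2) b := by
        fin_cases i
        · exact ⟨_, (reg_fst (next c (q : OnePoint K))).of_sub.congr (by simp) rfl⟩
        · exact ⟨1, (reg_one _).congr (by simp [hv]) rfl⟩
      obtain ⟨b, hb⟩ := h2
      refine ⟨_, (h1.mul hb).congr ?_ rfl⟩
      simp [mul_div_assoc]
  obtain ⟨P, Q, hQ, hP, h⟩ := h
  obtain ⟨b, hb⟩ := key P
  rw [hP, zero_mul, map_zero, sub_zero, ← h] at hb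
  have h1 : Reg (next c (q : OnePoint K)) (ev c Q) (MvPolynomial.constantCoeff Q) :=
    Reg.next hc (Reg.ev (reg_fst c) (reg_snd c) Q) q
  refine ⟨_, (hb.div hn h1 hQ).congr ?_ rfl⟩
  have := h1.ne_zero hn hQ
  field_simp

/-- The pairs `c = (u, v)` and `c' = (u', v')` are local coordinates at the same point, where
`u' = A u + B v` and `v' = D v` with functions `A, B, D` whose values at the point are `a, b, d`. In
particular the distinguished directions `v = 0` agree. -/
def Adapted (c c' : FunField K × FunField K) (a b d : K) : Prop :=
  IsCoord c ∧ IsCoord c' ∧ localRing c = localRing c' ∧ a ≠ 0 ∧ d ≠ 0 ∧ ∃ A B D : FunField K,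
    Reg c A a ∧ Reg c B b ∧ Reg c D d ∧ c'.1 = A * c.1 + B * c.2 ∧ c'.2 = D * c.2

theorem Adapted.symm (h : Adapted c c' a b d) : Adapted c' c a⁻¹ (-(b / (a * d))) d⁻¹ := by
  obtain ⟨hc, hc', he, ha, hd, A, B, D, hA, hB, hD, h1, h2⟩ := h
  have hA0 := hA.ne_zero hc ha
  have hD0 := hD.ne_zero hc hd
  refine ⟨hc', hc, he.symm, inv_ne_zero ha, inv_ne_zero hd, A⁻¹, -(B / (A * D)), D⁻¹,
    (hA.inv hc ha).of_localRing_eq hc hc' he,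
    (hB.div hc (hA.mul hD) (mul_ne_zero ha hd)).neg.of_localRing_eq hc hc' he,
    (hD.inv hc hd).of_localRing_eq hc hc' he, ?_, ?_⟩
  · rw [h1, h2]
    field_simp
    ring
  · rw [h2, inv_mul_cancel_left₀ hD0]

theorem Adapted.div_sub (h : Adapted c c' a b d) {A B D : FunField K}
    (hD0 : D ≠ 0) (h1 : c'.1 = A * c.1 + B * c.2) (h2 : c'.2 = D * c.2) (q q' : K) :
    c'.1 / c'.2 - algebraMap K _ q' = A / D * (c.1 / c.2 - algebraMap K _ q) +
      ((A * algebraMap K _ q + B) / D - algebraMap K _ q') := by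
  have := h.1.snd_ne_zero
  rw [h1, h2]
  field_simp
  ring

theorem Adapted.localRing_next_le (h : Adapted c c' a b d) (q : K) :
    localRing (next c' ((a * q + b) / d : K)) ≤ localRing (next c (q : OnePoint K)) := by
  have h' := h
  obtain ⟨hc, hc', he, ha, hd, A, B, D, hA, hB, hD, h1, h2⟩ := h
  have hD0 := hD.ne_zero hc hd
  refine localRing_le (hc.next q) ?_ ?_
  · have hA' := Reg.next hc hA q
    have hB' := Reg.next hc hB q
    have hD' := Reg.next hc hD q
    refine (((hA'.div (hc.next q) hD' hd).mul (reg_fst _)).add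
      ((((hA'.mul (reg_const _ q)).add hB').div (hc.next q) hD' hd).sub
        (reg_const _ ((a * q + b) / d)))).congr ?_ (by ring)
    exact h'.div_sub hD0 h1 h2 q _
  · exact ((Reg.next hc hD q).mul (reg_snd _)).congr h2 (mul_zero d).symm

theorem Adapted.localRing_next_infty_le (h : Adapted c c' a b d) :
    localRing (next c' ∞) ≤ localRing (next c ∞) := by
  obtain ⟨hc, hc', he, ha, hd, A, B, D, hA, hB, hD, h1, h2⟩ := h
  have hn := hc.next ∞
  have hu := hc.fst_ne_zero
  have hA' := Reg.next hc hA ∞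
  have hB' := Reg.next hc hB ∞
  have hD' := Reg.next hc hD ∞
  have hv : Reg (next c ∞) (c.2 / c.1) 0 := reg_snd (next c ∞)
  have hE : Reg (next c ∞) (A + B * (c.2 / c.1)) a :=
    (hA'.add (hB'.mul hv)).congr rfl (by ring)
  have hE0 := hE.ne_zero hn ha
  have e1 : c'.1 = (A + B * (c.2 / c.1)) * c.1 := by
    rw [h1]
    field_simp
  refine localRing_le hn ?_ ?_
  · exact (hE.mul (reg_fst (next c ∞))).congr e1 (mul_zero a).symm
  · refine ((hD'.mul hv).div hn hE ha).congr ?_ (by simp)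
    change c'.2 / c'.1 = _
    rw [e1, h2, div_mul_eq_div_div_swap, mul_div_assoc]

theorem Adapted.localRing_next_eq (h : Adapted c c' a b d) (q : K) :
    localRing (next c' ((a * q + b) / d : K)) = localRing (next c (q : OnePoint K)) := by
  refine (h.localRing_next_le q).antisymm ?_
  have hle := h.symm.localRing_next_le ((a * q + b) / d)
  obtain ⟨-, -, -, ha, hd, -⟩ := h
  convert hle using 3
  congr 1
  field_simp
  ring

theorem Adapted.localRing_next_infty_eq (h : Adapted c c' a b d) :
    localRing (next c' ∞) = localRing (next c ∞) :=
  h.localRing_next_infty_le.antisymm h.symm.localRing_next_infty_le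

theorem Adapted.exists_localRing_next_eq (h : Adapted c c' a b d) (q : OnePoint K) :
    ∃ q', localRing (next c' q') = localRing (next c q) := by
  induction q using OnePoint.rec with
  | infty => exact ⟨_, h.localRing_next_infty_eq⟩
  | coe q => exact ⟨_, h.localRing_next_eq q⟩

/-- Adapted coordinates remain adapted at the points of the exceptional curve away from the
point `∞`. -/
theorem Adapted.next (h : Adapted c c' a b d) (q : K) :
    ∃ b', Adapted (next c (q : OnePoint K)) (next c' ((a * q + b) / d : K)) (a / d) b' d := by
  have h' := h
  have heq := h.localRing_next_eq q
  obtain ⟨hc, hc', he, ha, hd, A, B, D, hA, hB, hD, h1, h2⟩ := h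
  have hD0 := hD.ne_zero hc hd
  have hG : Reg c ((A * algebraMap K _ q + B) / D - algebraMap K _ ((a * q + b) / d)) 0 :=
    ((((hA.mul (reg_const _ q)).add hB).div hc hD hd).sub (reg_const _ ((a * q + b) / d))).congr
      rfl (by ring)
  obtain ⟨b', hb'⟩ := exists_reg_div_snd hc hG q
  refine ⟨b', hc.next q, hc'.next _, heq.symm, div_ne_zero ha hd, hd, _, _, D,
    (Reg.next hc hA q).div (hc.next q) (Reg.next hc hD q) hd, hb', Reg.next hc hD q, ?_, h2⟩
  change c'.1 / c'.2 - algebraMap K _ ((a * q + b) / d) = _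
  rw [h'.div_sub hD0 h1 h2 q]
  congr 1
  exact (div_mul_cancel₀ _ hc.snd_ne_zero).symm

theorem adapted_scale (hc : IsCoord c) (ha : a ≠ 0) (hd : d ≠ 0) :
    Adapted c (algebraMap K _ a * c.1, algebraMap K _ d * c.2) a 0 d := by
  have ha' : algebraMap K (FunField K) a ≠ 0 := by simpa using ha
  have hd' : algebraMap K (FunField K) d ≠ 0 := by simpa using hd
  have hc' : IsCoord (algebraMap K _ a * c.1, algebraMap K _ d * c.2) := hc.of_mem
    fun E h1 h2 => by
      have e1 := E.mul_mem (E.inv_mem (E.algebraMap_mem a)) h1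
      have e2 := E.mul_mem (E.inv_mem (E.algebraMap_mem d)) h2
      rw [inv_mul_cancel_left₀ ha'] at e1
      rw [inv_mul_cancel_left₀ hd'] at e2
      exact ⟨e1, e2⟩
  refine ⟨hc, hc', (localRing_eq hc hc' ?_ ?_ ?_ ?_).symm, ha, hd, algebraMap K _ a, 0,
    algebraMap K _ d, reg_const c a, (reg_const c 0).congr (map_zero _).symm rfl, reg_const c d,
    by simp, rfl⟩
  · exact ((reg_const c a).mul (reg_fst c)).congr rfl (by ring)
  · exact ((reg_const c d).mul (reg_snd c)).congr rfl (by ring)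
  · exact ((reg_const _ a⁻¹).mul (reg_fst (algebraMap K _ a * c.1, algebraMap K _ d * c.2))).congr
      (by simp [ha']) (by ring)
  · exact ((reg_const _ d⁻¹).mul (reg_snd (algebraMap K _ a * c.1, algebraMap K _ d * c.2))).congr
      (by simp [hd']) (by ring)

end AdaptedCoordinates

/-! ### Blowups as sets of local rings -/

section Blow

variable {K : Type u} [Field K]

/-- The set of the local rings of the blowup of the points with local coordinates in `C` on (a
blowup of) the surface with the set `H` of local rings. -/
def blow (H : Set (Subring (FunField K))) (C : Set (FunField K × FunField K)) :
    Set (Subring (FunField K)) :=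
  {R | (R ∈ H ∨ ∃ c ∈ C, ∃ q : OnePoint K, R = localRing (next c q)) ∧ ∀ c ∈ C, R ≠ localRing c}

theorem blowupPoints_eq_blow (r : ℕ) (ps : List (CoordSeq K)) :
    blowupPoints r ps = blow (hirzebruch K r) (coords r '' blownUp ps) := by
  simp only [blowupPoints, blow, Set.exists_mem_image, Set.forall_mem_image]

/-- The coordinates `c` and `c'` are adapted to each other. -/
def Near (c c' : FunField K × FunField K) : Prop := ∃ a b d, Adapted c c' a b d

theorem blow_subset {H : Set (Subring (FunField K))} {C C' : Set (FunField K × FunField K)}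
    (h1 : ∀ c ∈ C, ∃ c' ∈ C', Near c c') (h2 : ∀ c' ∈ C', ∃ c ∈ C, Near c c') :
    blow H C ⊆ blow H C' := by
  rintro R ⟨hR, hne⟩
  constructor
  · rcases hR with hR | ⟨c, hc, q, rfl⟩
    · exact Or.inl hR
    · obtain ⟨c', hc', a, b, d, h⟩ := h1 c hc
      obtain ⟨q', hq'⟩ := h.exists_localRing_next_eq q
      exact Or.inr ⟨c', hc', q', hq'.symm⟩
  · intro c' hc'
    obtain ⟨c, hc, a, b, d, h⟩ := h2 c' hc'
    exact h.2.2.1 ▸ hne c hc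

theorem Near.symm {c c' : FunField K × FunField K} (h : Near c c') : Near c' c := by
  obtain ⟨a, b, d, h⟩ := h
  exact ⟨_, _, _, h.symm⟩

/-- The points of the exceptional curves do not change if local coordinates are replaced by adapted
ones. -/
theorem blow_congr {H : Set (Subring (FunField K))} {C C' : Set (FunField K × FunField K)}
    (h1 : ∀ c ∈ C, ∃ c' ∈ C', Near c c') (h2 : ∀ c' ∈ C', ∃ c ∈ C, Near c c') :
    blow H C = blow H C' :=
  (blow_subset h1 h2).antisymm (blow_subset
    (fun c' hc' => (h2 c' hc').imp fun _ h => ⟨h.1, h.2.symm⟩)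
    (fun c hc => (h1 c hc).imp fun _ h => ⟨h.1, h.2.symm⟩))

theorem mapPair_next (σ : FunField K ≃ₐ[K] FunField K) (c : FunField K × FunField K)
    (q : OnePoint K) : mapPair σ (next c q) = next (mapPair σ c) q := by
  induction q using OnePoint.rec with
  | infty => simp [next_infty, mapPair]
  | coe q => simp [next_coe, mapPair]

theorem mapRings_blow (M : GL (Fin 2) K) (H : Set (Subring (FunField K)))
    (C : Set (FunField K × FunField K)) :
    mapRings M (blow H C) = blow (mapRings M H) (mapPair (linAut M) '' C) := by
  have hinj : Function.Injective
      (fun R : Subring (FunField K) => R.map (linAut M : FunField K →+* FunField K)) :=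
    fun R S h => SetLike.coe_injective
      ((linAut M).injective.image_injective (congrArg SetLike.coe h))
  ext R
  constructor
  · rintro ⟨R, ⟨hR, hne⟩, rfl⟩
    refine ⟨?_, ?_⟩
    · rcases hR with hR | ⟨c, hc, q, rfl⟩
      · exact Or.inl ⟨R, hR, rfl⟩
      · exact Or.inr ⟨_, ⟨c, hc, rfl⟩, q, by rw [← mapPair_next]; exact map_localRing _ _⟩
    · rintro _ ⟨c, hc, rfl⟩ h
      rw [← map_localRing] at h
      exact hne c hc (hinj h)
  · rintro ⟨hR, hne⟩
    rcases hR with ⟨R, hR, rfl⟩ | ⟨_, ⟨c, hc, rfl⟩, q, rfl⟩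
    · refine ⟨R, ⟨Or.inl hR, ?_⟩, rfl⟩
      rintro c hc rfl
      exact hne _ ⟨c, hc, rfl⟩ (map_localRing _ _)
    · refine ⟨localRing (next c q), ⟨Or.inr ⟨c, hc, q, rfl⟩, ?_⟩, ?_⟩
      · intro c' hc' h
        refine hne _ ⟨c', hc', rfl⟩ ?_
        rw [← mapPair_next, ← map_localRing, h, map_localRing]
      · exact (map_localRing _ _).trans (by rw [mapPair_next])

end Blow

/-! ### Triangular substitutions -/

section Triangular

variable {K : Type u} [Field K] {σ : FunField K ≃ₐ[K] FunField K} {α β δ : K}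

/-- The substitution `x ↦ α x + β y`, `y ↦ δ y`. -/
structure IsTri (σ : FunField K ≃ₐ[K] FunField K) (α β δ : K) : Prop where
  map_x : σ (x K) = algebraMap K _ α * x K + algebraMap K _ β * y K
  map_y : σ (y K) = algebraMap K _ δ * y K
  left_ne : α ≠ 0
  right_ne : δ ≠ 0

theorem exists_isTri (hα : α ≠ 0) (β : K) (hδ : δ ≠ 0) :
    ∃ M : GL (Fin 2) K, IsTri (linAut M) α β δ := by
  have hdet : (!![α, β; 0, δ] : Matrix (Fin 2) (Fin 2) K).det ≠ 0 := by
    rw [Matrix.det_fin_two_of]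
    simp [hα, hδ]
  exact ⟨Matrix.GeneralLinearGroup.mkOfDetNeZero _ hdet,
    ⟨by rw [linAut_x]; rfl, by rw [linAut_y]; simp [Matrix.GeneralLinearGroup.mkOfDetNeZero],
      hα, hδ⟩⟩

theorem IsTri.symm (h : IsTri σ α β δ) : IsTri σ.symm α⁻¹ (-(β / (α * δ))) δ⁻¹ := by
  obtain ⟨hx, hy, hα, hδ⟩ := h
  have hα' : algebraMap K (FunField K) α ≠ 0 := by simpa using hα
  have hδ' : algebraMap K (FunField K) δ ≠ 0 := by simpa using hδ
  refine ⟨?_, ?_, inv_ne_zero hα, inv_ne_zero hδ⟩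
  · rw [AlgEquiv.symm_apply_eq]
    simp only [map_add, map_mul, map_neg, map_div₀, map_inv₀, AlgEquiv.commutes, hx, hy]
    field_simp
    ring
  · rw [AlgEquiv.symm_apply_eq]
    simp only [map_mul, map_inv₀, AlgEquiv.commutes, hy]
    field_simp

theorem localRing_le_mapPair {c c' : FunField K × FunField K}
    (h : localRing (mapPair σ.symm c') ≤ localRing c) : localRing c' ≤ localRing (mapPair σ c) := by
  have h1 : (localRing (mapPair σ.symm c')).map (σ : FunField K →+* FunField K) ≤
      (localRing c).map (σ : FunField K →+* FunField K) := Set.image_mono h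
  rw [map_localRing, map_localRing] at h1
  simpa [mapPair] using h1

theorem IsTri.map_fiber (h : IsTri σ α β δ) (n : ℕ) :
    σ (x K / y K ^ (n + 1)) = algebraMap K _ (α / δ ^ (n + 1)) * (x K / y K ^ (n + 1)) +
      algebraMap K _ (β / δ ^ (n + 1)) * (1 / y K) ^ n := by
  have hy := y_ne_zero (K := K)
  have hδ' : algebraMap K (FunField K) δ ≠ 0 := by simpa using h.right_ne
  simp only [map_div₀, map_pow, h.map_x, h.map_y, mul_pow, one_div, inv_pow]
  field_simp
  ring

theorem IsTri.map_one_div_y (h : IsTri σ α β δ) :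
    σ (1 / y K) = algebraMap K _ δ⁻¹ * (1 / y K) := by
  rw [map_div₀, h.map_y, map_one, map_inv₀]
  field_simp

/-- A triangular substitution acts on the coordinate `x / y ^ m` of the fiber of `𝔽_m`, where
`m = n + 1`, by a scaling, and for `m = 1` also by a translation. The factor `0 ^ n`, which is `1` if
`n = 0` and `0` otherwise, covers both cases. -/
theorem IsTri.localRing_fiberPt_le (h : IsTri σ α β δ) {n : ℕ} {p q : K}
    (hpq : α * p + β * 0 ^ n = δ ^ (n + 1) * q) :
    localRing (mapPair σ (fiberPt (n + 1) q)) ≤ localRing (fiberPt (n + 1) p) := by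
  have hδ := h.right_ne
  have hv : Reg (fiberPt (n + 1) p) (1 / y K) 0 := reg_snd (fiberPt (n + 1) p)
  have hx : Reg (fiberPt (n + 1) p) (x K / y K ^ (n + 1)) p :=
    (reg_fst (fiberPt (n + 1) p)).of_sub.congr rfl (zero_add p).symm
  refine localRing_le (isCoord_fiberPt _ _) ?_ ?_
  · refine ((((reg_const _ (α / δ ^ (n + 1))).mul hx).add
      ((reg_const _ (β / δ ^ (n + 1))).mul (hv.pow n))).sub (reg_const _ q)).congr ?_ ?_
    · rw [← h.map_fiber, ← σ.commutes, ← map_sub]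
      rfl
    · field_simp
      linear_combination -hpq
  · exact ((reg_const _ δ⁻¹).mul hv).congr h.map_one_div_y (by ring)

theorem IsTri.localRing_fiberPt (h : IsTri σ α β δ) {n : ℕ} {p q : K}
    (hpq : α * p + β * 0 ^ n = δ ^ (n + 1) * q) :
    localRing (mapPair σ (fiberPt (n + 1) q)) = localRing (fiberPt (n + 1) p) := by
  refine (h.localRing_fiberPt_le hpq).antisymm (localRing_le_mapPair ?_)
  refine h.symm.localRing_fiberPt_le ?_
  have hα := h.left_ne
  have hδ := h.right_ne
  cases n with
  | zero =>
    simp only [pow_zero, zero_add, pow_one] at hpq ⊢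
    field_simp
    linear_combination -hpq
  | succ n =>
    simp only [ne_eq, Nat.succ_ne_zero, not_false_eq_true, zero_pow, mul_zero, add_zero] at hpq ⊢
    rw [inv_pow]
    field_simp
    linear_combination -hpq

/-- The coordinates at the points of the fiber of `𝔽_m` remain adapted under triangular
substitutions. -/
theorem IsTri.adapted_fiberPt (h : IsTri σ α β δ) {n : ℕ} {p q : K}
    (hpq : α * p + β * 0 ^ n = δ ^ (n + 1) * q) :
    ∃ b, Adapted (fiberPt (n + 1) p) (mapPair σ (fiberPt (n + 1) q)) (α / δ ^ (n + 1)) b δ⁻¹ := by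
  have hα := h.left_ne
  have hδ := h.right_ne
  have hv : Reg (fiberPt (n + 1) p) (1 / y K) 0 := reg_snd (fiberPt (n + 1) p)
  obtain ⟨B, b, hB, hBv⟩ : ∃ B b, Reg (fiberPt (n + 1) p) B b ∧
      (1 / y K) ^ n - algebraMap K _ (0 ^ n) = B * (1 / y K) := by
    cases n with
    | zero => exact ⟨0, 0, (reg_const _ 0).congr (map_zero _).symm rfl, by simp⟩
    | succ n => exact ⟨_, _, hv.pow n, by simp [pow_succ]⟩
  refine ⟨_, isCoord_fiberPt _ _, (isCoord_fiberPt _ _).map σ, (h.localRing_fiberPt hpq).symm,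
    div_ne_zero hα (pow_ne_zero _ hδ), inv_ne_zero hδ, _, _, _, reg_const _ _,
    (reg_const _ (β / δ ^ (n + 1))).mul hB, reg_const _ _, ?_, h.map_one_div_y⟩
  have hq : q = α / δ ^ (n + 1) * p + β / δ ^ (n + 1) * 0 ^ n := by
    field_simp
    linear_combination -hpq
  change σ (x K / y K ^ (n + 1) - algebraMap K _ q) = _ * (x K / y K ^ (n + 1) - _) + _ * _
  rw [map_sub, h.map_fiber, AlgEquiv.commutes, hq, map_add, map_mul, map_mul, mul_assoc]
  change _ = _ + _ * (B * (1 / y K))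
  rw [← hBv]
  ring

theorem IsTri.localRing_affine_le (h : IsTri σ α β δ) {a b a' b' : K}
    (ha : α * a' + β * b' = a) (hb : δ * b' = b) :
    localRing (mapPair σ (x K - algebraMap K _ a, y K - algebraMap K _ b)) ≤
      localRing (x K - algebraMap K _ a', y K - algebraMap K _ b') := by
  have hx := (reg_fst (x K - algebraMap K _ a', y K - algebraMap K _ b')).of_sub
  have hy := (reg_snd (x K - algebraMap K _ a', y K - algebraMap K _ b')).of_sub
  refine localRing_le (isCoord_x_y.sub_const a' b') ?_ ?_
  · refine ((((reg_const _ α).mul hx).add ((reg_const _ β).mul hy)).sub (reg_const _ a)).congr ?_ ?_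
    · rw [← h.map_x]
      exact (map_sub σ _ _).trans (by rw [AlgEquiv.commutes])
    · linear_combination -ha
  · refine (((reg_const _ δ).mul hy).sub (reg_const _ b)).congr ?_ ?_
    · rw [← h.map_y]
      exact (map_sub σ _ _).trans (by rw [AlgEquiv.commutes])
    · linear_combination -hb

theorem IsTri.localRing_section_le (h : IsTri σ α β δ) {b b' : K} (hb : δ * b' = b) :
    localRing (mapPair σ (1 / x K, y K - algebraMap K _ b)) ≤
      localRing (1 / x K, y K - algebraMap K _ b') := by
  have hx := reg_fst (1 / x K, y K - algebraMap K _ b')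
  have hy := (reg_snd (1 / x K, y K - algebraMap K _ b')).of_sub
  have hc := isCoord_section_sub b'
  refine localRing_le hc ?_ ?_
  · have h1 := (reg_const _ α).add (((reg_const _ β).mul hy).mul hx)
    refine (hx.div hc h1 (by simpa using h.left_ne)).congr ?_ (by simp)
    have := x_ne_zero (K := K)
    change σ (1 / x K) = 1 / x K / (_ + _ * _ * (1 / x K))
    rw [map_div₀, map_one, h.map_x]
    field_simp
  · refine (((reg_const _ δ).mul hy).sub (reg_const _ b)).congr ?_ ?_
    · rw [← h.map_y]
      exact (map_sub σ _ _).trans (by rw [AlgEquiv.commutes])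
    · linear_combination -hb

theorem IsTri.localRing_corner_le (h : IsTri σ α β δ) (n : ℕ) :
    localRing (mapPair σ (y K ^ (n + 1) / x K, 1 / y K)) ≤
      localRing (y K ^ (n + 1) / x K, 1 / y K) := by
  have hu := reg_fst (y K ^ (n + 1) / x K, 1 / y K)
  have hv := reg_snd (y K ^ (n + 1) / x K, 1 / y K)
  have hc := isCoord_corner (K := K) (n + 1)
  refine localRing_le hc ?_ ?_
  · have h1 := (reg_const _ α).add ((reg_const _ β).mul (hu.mul (hv.pow n)))
    refine (((reg_const _ (δ ^ (n + 1))).mul hu).div hc h1 (by simpa using h.left_ne)).congr ?_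
      (by simp)
    have hx := x_ne_zero (K := K)
    have hy := y_ne_zero (K := K)
    change σ (y K ^ (n + 1) / x K) = _ * (y K ^ (n + 1) / x K) /
      (_ + _ * (y K ^ (n + 1) / x K * (1 / y K) ^ n))
    rw [map_div₀, map_pow, h.map_x, h.map_y, map_pow, one_div, inv_pow, mul_pow]
    have e : algebraMap K (FunField K) α + algebraMap K _ β *
        (y K ^ (n + 1) / x K * (y K ^ n)⁻¹) =
        (algebraMap K _ α * x K + algebraMap K _ β * y K) / x K := by
      field_simp
      ring
    rw [e, ← mul_div_assoc, div_div_div_cancel_right₀ hx]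
  · exact ((reg_const _ δ⁻¹).mul hv).congr h.map_one_div_y (by ring)

/-- Triangular substitutions are automorphisms of the surface `𝔽_r`. -/
theorem IsTri.map_mem_hirzebruch (h : IsTri σ α β δ) {n : ℕ} {R : Subring (FunField K)}
    (hR : R ∈ hirzebruch K (n + 1)) :
    R.map (σ : FunField K →+* FunField K) ∈ hirzebruch K (n + 1) := by
  have hα := h.left_ne
  have hδ := h.right_ne
  rw [mem_hirzebruch_iff] at hR ⊢
  rcases hR with ⟨a, b, rfl⟩ | ⟨a, rfl⟩ | ⟨b, rfl⟩ | rfl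
  · refine Or.inl ⟨(a - β * (b / δ)) / α, b / δ, ?_⟩
    rw [map_localRing]
    refine (h.localRing_affine_le ?_ ?_).antisymm (localRing_le_mapPair
      (h.symm.localRing_affine_le ?_ ?_)) <;> field_simp <;> ring
  · refine Or.inr (Or.inl ⟨(δ ^ (n + 1) * a - β * 0 ^ n) / α, ?_⟩)
    rw [map_localRing]
    exact h.localRing_fiberPt (by field_simp; ring)
  · refine Or.inr (Or.inr (Or.inl ⟨b / δ, ?_⟩))
    rw [map_localRing]
    exact (h.localRing_section_le (by field_simp)).antisymm (localRing_le_mapPair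
      (h.symm.localRing_section_le (by field_simp)))
  · refine Or.inr (Or.inr (Or.inr ?_))
    rw [map_localRing]
    exact (h.localRing_corner_le n).antisymm (localRing_le_mapPair (h.symm.localRing_corner_le n))

theorem mapRings_hirzebruch {M : GL (Fin 2) K} (h : IsTri (linAut M) α β δ) {r : ℕ} (hr : 1 ≤ r) :
    mapRings M (hirzebruch K r) = hirzebruch K r := by
  obtain ⟨n, rfl⟩ : ∃ n, r = n + 1 := ⟨r - 1, by omega⟩
  apply Set.Subset.antisymm
  · rintro _ ⟨R, hR, rfl⟩
    exact h.map_mem_hirzebruch hR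
  · intro R hR
    refine ⟨_, h.symm.map_mem_hirzebruch hR, ?_⟩
    change Subring.map _ (Subring.map _ R) = R
    rw [Subring.map_map]
    convert R.map_id
    ext f
    simp

/-- A triangular substitution takes one blowup of `𝔽_r` to another one, if the points match. -/
theorem mapRings_blowupPoints {M : GL (Fin 2) K} (h : IsTri (linAut M) α β δ) {r : ℕ} (hr : 1 ≤ r)
    {ps ps' : List (CoordSeq K)}
    (h1 : ∀ c ∈ coords r '' blownUp ps, ∃ c' ∈ coords r '' blownUp ps',
      Near c' (mapPair (linAut M) c))
    (h2 : ∀ c' ∈ coords r '' blownUp ps', ∃ c ∈ coords r '' blownUp ps,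
      Near c' (mapPair (linAut M) c)) :
    mapRings M (blowupPoints r ps) = blowupPoints r ps' := by
  rw [blowupPoints_eq_blow, blowupPoints_eq_blow, mapRings_blow, mapRings_hirzebruch h hr]
  refine blow_congr ?_ ?_
  · rintro _ ⟨c, hc, rfl⟩
    exact (h1 c hc).imp fun _ h => ⟨h.1, h.2.symm⟩
  · intro c' hc'
    obtain ⟨c, hc, hn⟩ := h2 c' hc'
    exact ⟨_, ⟨c, hc, rfl⟩, hn.symm⟩

end Triangular

/-! ### Normalization of the coordinate sequences -/

section Normalization

variable {K : Type u} [Field K] {σ : FunField K ≃ₐ[K] FunField K} {α β δ : K}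

theorem IsTri.near_fiberPt (h : IsTri σ α β δ) {m : ℕ} (hm : 1 ≤ m) {p q : K}
    (hpq : α * p + β * 0 ^ (m - 1) = δ ^ m * q) :
    Near (fiberPt m p) (mapPair σ (fiberPt m q)) := by
  obtain ⟨n, rfl⟩ : ∃ n, m = n + 1 := ⟨m - 1, by omega⟩
  obtain ⟨b, hb⟩ := h.adapted_fiberPt hpq
  exact ⟨_, _, _, hb⟩

/-- The effect of a triangular substitution on the coordinate sequences `[0_(k), q₁]` and `[q₂]`. The
summand of `β` is present in the first condition only if `k = r - 1`, and in the second one only if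
`r = 1`. -/
theorem IsTri.mapRings_zerosPt {M : GL (Fin 2) K} (h : IsTri (linAut M) α β δ) {r k : ℕ}
    (hk : k + 1 ≤ r) {q₁ q₂ p₁ p₂ : K}
    (h₁ : α * p₁ + β * 0 ^ (r - k - 1) = δ ^ (r - k) * q₁)
    (h₂ : α * p₂ + β * 0 ^ (r - 1) = δ ^ r * q₂) :
    mapRings M (blowupPoints r [zerosPt k q₁, pt q₂]) =
      blowupPoints r [zerosPt k p₁, pt p₂] := by
  have h0 : ∀ j < k, Near (fiberPt (r - j) (0 : K))
      (mapPair (linAut M) (fiberPt (r - j) (0 : K))) := fun j hj => by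
    refine h.near_fiberPt (by omega) ?_
    rw [zero_pow (by omega)]
    ring
  have hn₁ := h.near_fiberPt (m := r - k) (by omega) h₁
  have hn₂ := h.near_fiberPt (m := r) (by omega) h₂
  refine mapRings_blowupPoints h (by omega) ?_ ?_ <;>
    rw [image_coords_zerosPt hk, image_coords_zerosPt hk]
  · rintro _ ((rfl | rfl) | ⟨j, hj, rfl⟩)
    · exact ⟨_, Or.inl (Or.inl rfl), hn₁⟩
    · exact ⟨_, Or.inl (Or.inr rfl), hn₂⟩
    · exact ⟨_, Or.inr ⟨j, hj, rfl⟩, h0 j hj⟩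
  · rintro _ ((rfl | rfl) | ⟨j, hj, rfl⟩)
    · exact ⟨_, Or.inl (Or.inl rfl), hn₁⟩
    · exact ⟨_, Or.inl (Or.inr rfl), hn₂⟩
    · exact ⟨_, Or.inr ⟨j, hj, rfl⟩, h0 j hj⟩

/-- The pair `(a u, d v)`, where `c = (u, v)`. -/
def scale (a d : K) (c : FunField K × FunField K) : FunField K × FunField K :=
  (algebraMap K _ a * c.1, algebraMap K _ d * c.2)

theorem near_scale {c : FunField K × FunField K} (hc : IsCoord c) {a d : K} (ha : a ≠ 0)
    (hd : d ≠ 0) : Near c (scale a d c) :=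
  ⟨_, _, _, adapted_scale hc ha hd⟩

theorem next_scale_infty {a : K} (d : K) (c : FunField K × FunField K) (ha : a ≠ 0) :
    next (scale a (a * d) c) ∞ = scale a d (next c ∞) := by
  have : algebraMap K (FunField K) a ≠ 0 := by simpa using ha
  simp only [next_infty, scale, map_mul, Prod.mk.injEq, true_and]
  field_simp

theorem next_scale (a : K) {d : K} (c : FunField K × FunField K) (hd : d ≠ 0) (q : K) :
    next (scale a d c) (a / d * q : K) = scale (a / d) d (next c (q : OnePoint K)) := by
  have : algebraMap K (FunField K) d ≠ 0 := by simpa using hd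
  simp only [next_coe, scale, map_mul, map_div₀, Prod.mk.injEq, and_true]
  field_simp

/-- Scaling the coordinates `x` and `y` scales the coordinate sequences. -/
theorem mapRings_ptInf {r : ℕ} (hr : 1 ≤ r) {a d : K} (ha : a ≠ 0) (hd : d ≠ 0) (q w : K) :
    ∃ M : GL (Fin 2) K, mapRings M (blowupPoints r [ptInf (a * q) (a / d * w)]) =
        blowupPoints r [ptInf q w] ∧
      ∀ p : K, mapRings M (blowupPoints r [ptInf' (a * q) (a / d * w) (a / d / d * p)]) =
        blowupPoints r [ptInf' q w p] := by
  -- chosen such that the coordinates at `[q, ∞]` are scaled by `a` and `d`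
  obtain ⟨M, hM⟩ := exists_isTri (K := K) (α := a * (a * d)⁻¹ ^ r) (by positivity) 0
    (inv_ne_zero (mul_ne_zero ha hd))
  refine ⟨M, ?_⟩
  have ha' : algebraMap K (FunField K) a ≠ 0 := by simpa using ha
  have hd' : algebraMap K (FunField K) d ≠ 0 := by simpa using hd
  have e0 : mapPair (linAut M) (fiberPt r (a * q)) = scale a (a * d) (fiberPt r q) := by
    have hy := y_ne_zero (K := K)
    simp only [mapPair, fiberPt, scale, map_sub, map_div₀, map_pow, hM.map_x, hM.map_y, map_mul,
      map_inv₀, map_one, AlgEquiv.commutes, map_zero, zero_mul, add_zero, inv_pow, mul_pow]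
    congr 1
    · field_simp
    · field_simp
  have e1 : mapPair (linAut M) (cuspPt r (a * q)) = scale a d (cuspPt r q) := by
    rw [cuspPt, mapPair_next, e0, next_scale_infty d _ ha, cuspPt]
  have e2 : mapPair (linAut M) (next (cuspPt r (a * q)) (a / d * w : K)) =
      scale (a / d) d (next (cuspPt r q) (w : OnePoint K)) := by
    rw [mapPair_next, e1, next_scale a _ hd]
  have e3 : ∀ p, mapPair (linAut M) (next (next (cuspPt r (a * q)) (a / d * w : K))
      (a / d / d * p : K)) =
      scale (a / d / d) d (next (next (cuspPt r q) (w : OnePoint K)) (p : OnePoint K)) := by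
    intro p
    rw [mapPair_next, e2, next_scale _ _ hd]
  have n0 := e0 ▸ near_scale (isCoord_fiberPt r q) ha (mul_ne_zero ha hd)
  have n1 := e1 ▸ near_scale (isCoord_cuspPt r q) ha hd
  have n2 := e2 ▸ near_scale ((isCoord_cuspPt r q).next w) (div_ne_zero ha hd) hd
  have n3 := fun p : K => e3 p ▸ near_scale (((isCoord_cuspPt r q).next w).next p)
    (div_ne_zero (div_ne_zero ha hd) hd) hd
  constructor
  · refine mapRings_blowupPoints hM hr ?_ ?_ <;>
      rw [image_coords_ptInf, image_coords_ptInf]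
    · rintro _ (rfl | rfl | rfl)
      exacts [⟨_, Or.inl rfl, n0⟩,
          ⟨_, Or.inr (Or.inl rfl), n1⟩,
          ⟨_, Or.inr (Or.inr rfl), n2⟩]
    · rintro _ (rfl | rfl | rfl)
      exacts [⟨_, Or.inl rfl, n0⟩,
          ⟨_, Or.inr (Or.inl rfl), n1⟩,
          ⟨_, Or.inr (Or.inr rfl), n2⟩]
  · intro p
    have n3 := n3 p
    refine mapRings_blowupPoints hM hr ?_ ?_ <;>
      rw [image_coords_ptInf', image_coords_ptInf']
    · rintro _ (rfl | rfl | rfl | rfl)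
      exacts [⟨_, Or.inl rfl, n0⟩,
          ⟨_, Or.inr (Or.inl rfl), n1⟩,
          ⟨_, Or.inr (Or.inr (Or.inl rfl)), n2⟩,
          ⟨_, Or.inr (Or.inr (Or.inr rfl)), n3⟩]
    · rintro _ (rfl | rfl | rfl | rfl)
      exacts [⟨_, Or.inl rfl, n0⟩,
          ⟨_, Or.inr (Or.inl rfl), n1⟩,
          ⟨_, Or.inr (Or.inr (Or.inl rfl)), n2⟩,
          ⟨_, Or.inr (Or.inr (Or.inr rfl)), n3⟩]

/-- On `𝔽₂`, the shear `x ↦ x + β y` fixes the point `[0, ∞, 1]` and translates the points of its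
exceptional curve. -/
theorem mapRings_shear_two (β p : K) :
    ∃ M : GL (Fin 2) K, mapRings M (blowupPoints 2 [ptInf' 0 1 (p + 2 * β)]) =
      blowupPoints 2 [ptInf' 0 1 p] := by
  obtain ⟨M, hM⟩ := exists_isTri (K := K) one_ne_zero β one_ne_zero
  refine ⟨M, ?_⟩
  have hx := x_ne_zero (K := K)
  have hy := y_ne_zero (K := K)
  obtain ⟨b₀, a0⟩ := hM.adapted_fiberPt (n := 1) (p := 0) (q := 0) (by simp)
  simp only [Nat.reduceAdd, one_pow, div_one, inv_one] at a0
  have hc1 := isCoord_cuspPt 2 (0 : K)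
  obtain ⟨u, v, huv⟩ : ∃ u v, cuspPt 2 (0 : K) = (u, v) := ⟨_, _, rfl⟩
  have hu : u ≠ 0 := by
    have := hc1.fst_ne_zero
    rwa [huv] at this
  have hv : v ≠ 0 := by
    have := hc1.snd_ne_zero
    rwa [huv] at this
  have hH : Reg (cuspPt 2 (0 : K)) (1 + algebraMap K _ β * v) 1 := by
    have := (reg_one (cuspPt 2 (0 : K))).add ((reg_const _ β).mul (reg_snd (cuspPt 2 (0 : K))))
    rw [huv] at this ⊢
    exact this.congr rfl (by ring)
  -- the shear takes the coordinates `u, v` at `[0, ∞]` to `H u, v / H`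
  set H : FunField K := 1 + algebraMap K _ β * v with hHdef
  have hH0 : H ≠ 0 := hH.ne_zero hc1 one_ne_zero
  have hHi : Reg (cuspPt 2 (0 : K)) (1 / H) 1 := ((reg_one _).div hc1 hH one_ne_zero).congr rfl
    (by norm_num)
  have e1 : mapPair (linAut M) (cuspPt 2 0) = (H * u, 1 / H * v) := by
    have hxu : u = x K / y K ^ 2 := by
      have := congrArg Prod.fst huv
      simpa [cuspPt_fst] using this.symm
    have hyv : v = y K / x K := by
      have h1 := congrArg Prod.snd huv
      simp only [cuspPt, fiberPt, next_infty, map_zero, sub_zero] at h1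
      rw [← h1]
      field_simp
    have hσu : linAut M u = H * u := by
      rw [hHdef, hyv, hxu]
      simp only [map_div₀, map_pow, hM.map_x, hM.map_y, map_one, one_mul]
      field_simp
    rw [huv]
    refine Prod.ext hσu ?_
    change linAut M v = _
    have huv' : v = 1 / (u * y K) := by
      rw [hyv, hxu]
      field_simp
    rw [huv', map_div₀, map_mul, map_one, hσu, hM.map_y, map_one, one_mul]
    field_simp
  have a1 : Adapted (cuspPt 2 (0 : K)) (mapPair (linAut M) (cuspPt 2 0)) 1 0 1 := by
    refine ⟨hc1, hc1.map _, ?_, one_ne_zero, one_ne_zero, H, 0, 1 / H, hH,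
      (reg_const _ 0).congr (map_zero _).symm rfl, hHi, ?_, ?_⟩
    · rw [cuspPt, mapPair_next]
      exact a0.localRing_next_infty_eq.symm
    · rw [e1, huv, zero_mul, add_zero]
    · rw [e1, huv]
  -- `u / v` goes to `H ^ 2 u / v`, and `H ^ 2 = 1 + 2 β v + β ^ 2 v ^ 2`
  have hc2 := hc1.next (1 : K)
  have a2 : Adapted (next (cuspPt 2 (0 : K)) (1 : K))
      (mapPair (linAut M) (next (cuspPt 2 (0 : K)) (1 : K))) 1 (2 * β) 1 := by
    refine ⟨hc2, hc2.map _, ?_, one_ne_zero, one_ne_zero, H ^ 2,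
      algebraMap K _ (2 * β) + algebraMap K _ (β ^ 2) * v, 1 / H,
      ((Reg.next hc1 hH (1 : K)).pow 2).congr rfl (by norm_num), ?_, Reg.next hc1 hHi (1 : K),
      ?_, ?_⟩
    · have := a1.localRing_next_eq 1
      rw [mapPair_next, ← this]
      norm_num
    · have := (reg_const _ (2 * β)).add ((reg_const _ (β ^ 2)).mul
        (reg_snd (next (cuspPt 2 (0 : K)) (1 : K))))
      rw [next_coe, huv] at this ⊢
      exact this.congr rfl (by ring)
    · rw [mapPair_next, e1, huv, next_coe, next_coe]
      simp only [map_one, map_mul, map_pow, map_ofNat, hHdef] at hH0 ⊢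
      field_simp
      ring
    · rw [mapPair_next, e1, huv, next_coe, next_coe]
  obtain ⟨b₃, a3⟩ := a2.next p
  have e3 : (1 * p + 2 * β) / 1 = p + 2 * β := by ring
  rw [e3, ← mapPair_next] at a3
  have n0 : Near _ _ := ⟨_, _, _, a0⟩
  have n1 : Near _ _ := ⟨_, _, _, a1⟩
  have n2 : Near _ _ := ⟨_, _, _, a2⟩
  have n3 : Near _ _ := ⟨_, _, _, a3⟩
  refine mapRings_blowupPoints hM (by norm_num) ?_ ?_ <;>
    rw [image_coords_ptInf', image_coords_ptInf']
  · rintro _ (rfl | rfl | rfl | rfl)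
    exacts [⟨_, Or.inl rfl, n0⟩,
        ⟨_, Or.inr (Or.inl rfl), n1⟩,
        ⟨_, Or.inr (Or.inr (Or.inl rfl)), n2⟩,
        ⟨_, Or.inr (Or.inr (Or.inr rfl)), n3⟩]
  · rintro _ (rfl | rfl | rfl | rfl)
    exacts [⟨_, Or.inl rfl, n0⟩,
        ⟨_, Or.inr (Or.inl rfl), n1⟩,
        ⟨_, Or.inr (Or.inr (Or.inl rfl)), n2⟩,
        ⟨_, Or.inr (Or.inr (Or.inr rfl)), n3⟩]

end Normalization

/-! ### A common toric blowup of the first two Hirzebruch surfaces -/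

section Swap

variable {K : Type u} [Field K] {c c' : FunField K × FunField K} {f : FunField K} {k l : K}

theorem localRing_ne (hc : IsCoord c) (hc' : IsCoord c') (h : Reg c f k) (h' : Reg c' f l)
    (hkl : k ≠ l) : localRing c ≠ localRing c' := fun e =>
  hkl ((h.of_localRing_eq hc hc' e).unique hc' h')

theorem localRing_ne_of_inv (hc : IsCoord c) (hc' : IsCoord c') (hf : f ≠ 0) (h : Reg c f k)
    (h' : Reg c' f⁻¹ 0) : localRing c ≠ localRing c' := fun e => by
  have h1 := ((h.of_localRing_eq hc hc' e).mul h').congr (mul_inv_cancel₀ hf).symm rfl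
  exact one_ne_zero ((reg_one c').unique hc' (h1.congr rfl (mul_zero k).symm))

theorem not_reg_fst_div_snd (hc : IsCoord c) : ¬ Reg c (c.1 / c.2) k := fun h => by
  have h1 : c.1 / c.2 ∈ divRing c := localRing_le_divRing c 0 (by simpa using h.mem)
  have h2 := ((ord_fst c).div hc (ord_snd c)).le_of_ge hc (mem_divRing_iff.1 h1)
  norm_num at h2

/-- A blown up point is strictly dominated by the points of its exceptional curve, so that these are
different from the point itself. -/
theorem localRing_lt_next (hc : IsCoord c) (q : OnePoint K) :
    localRing c < localRing (next c q) := by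
  refine lt_of_le_of_ne (fun f hf => ?_) fun e => ?_
  · obtain ⟨k, hk⟩ := mem_localRing_iff.1 hf
    exact (Reg.next hc hk q).mem
  · have hn := hc.next q
    induction q using OnePoint.rec with
    | infty =>
      have h1 := (reg_snd (next c ∞)).of_localRing_eq hn hc e.symm
      have h2 := localRing_swap hc
      exact not_reg_fst_div_snd hc.swap (h1.of_localRing_eq hc hc.swap h2.symm)
    | coe q =>
      have h1 := (reg_fst (next c (q : OnePoint K))).of_localRing_eq hn hc e.symm
      rw [next_coe] at h1
      exact not_reg_fst_div_snd hc h1.of_sub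

/-- If `T` consists of the points of the blowup of the points in `C`, then the blowup of one further
point is a blowup of `T`. -/
theorem blow_insert {H T : Set (Subring (FunField K))} {C : Set (FunField K × FunField K)}
    (h₁ : ∀ R ∈ H, R ∈ T ∨ ∃ c ∈ C, R = localRing c)
    (h₂ : ∀ c ∈ C, ∀ q, localRing (next c q) ∈ T ∨ ∃ c' ∈ C, localRing (next c q) = localRing c')
    (h₃ : ∀ R ∈ T, R ∈ H ∨ ∃ c ∈ C, ∃ q, R = localRing (next c q))
    (h₄ : ∀ R ∈ T, ∀ c ∈ C, R ≠ localRing c)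
    (h₅ : ∀ q, ∀ c' ∈ C, localRing (next c q) ≠ localRing c') :
    blow H (insert c C) = blow T {c} := by
  ext R
  constructor
  · rintro ⟨hR, hne⟩
    have hc : R ≠ localRing c := hne c (Set.mem_insert c C)
    have hC : ∀ c' ∈ C, R ≠ localRing c' := fun c' h => hne c' (Set.mem_insert_of_mem c h)
    refine ⟨?_, fun c' hc' => by rwa [hc']⟩
    rcases hR with hR | ⟨c', rfl | hc', q, rfl⟩
    · rcases h₁ R hR with h | ⟨c', hc', h⟩
      · exact Or.inl h
      · exact absurd h (hC c' hc')
    · exact Or.inr ⟨_, rfl, q, rfl⟩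
    · rcases h₂ c' hc' q with h | ⟨c'', hc'', h⟩
      · exact Or.inl h
      · exact absurd h (hC c'' hc'')
  · rintro ⟨hR, hne⟩
    have hc : R ≠ localRing c := hne c rfl
    rcases hR with hR | ⟨c', rfl, q, rfl⟩
    · refine ⟨?_, ?_⟩
      · rcases h₃ R hR with h | ⟨c', hc', q, h⟩
        · exact Or.inl h
        · exact Or.inr ⟨c', Set.mem_insert_of_mem c hc', q, h⟩
      · rintro c' (rfl | hc')
        · exact hc
        · exact h₄ R hR c' hc'
    · refine ⟨Or.inr ⟨_, Set.mem_insert _ C, q, rfl⟩, ?_⟩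
      rintro c'' (rfl | hc'')
      · exact hc
      · exact h₅ q c'' hc''

theorem localRing_sub_inv {g : FunField K} {q : K} (hq : q ≠ 0)
    (hc : IsCoord (f - algebraMap K _ q, g)) :
    IsCoord (f⁻¹ - algebraMap K _ q⁻¹, g) ∧
      localRing (f⁻¹ - algebraMap K _ q⁻¹, g) = localRing (f - algebraMap K _ q, g) := by
  have hc' : IsCoord (f⁻¹ - algebraMap K _ q⁻¹, g) := hc.of_mem fun E h1 h2 => by
    have := E.inv_mem (E.add_mem h1 (E.algebraMap_mem q⁻¹))
    rw [sub_add_cancel, inv_inv] at this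
    exact ⟨E.sub_mem this (E.algebraMap_mem q), h2⟩
  have h1 : Reg (f - algebraMap K _ q, g) f q :=
    (reg_fst (f - algebraMap K _ q, g)).of_sub.congr rfl (zero_add q).symm
  have h2 : Reg (f⁻¹ - algebraMap K _ q⁻¹, g) f⁻¹ q⁻¹ :=
    (reg_fst (f⁻¹ - algebraMap K _ q⁻¹, g)).of_sub.congr rfl (zero_add _).symm
  refine ⟨hc', localRing_eq hc hc' ((h1.inv hc hq).sub_const rfl rfl)
    (reg_snd (f - algebraMap K _ q, g)) ?_ (reg_snd (f⁻¹ - algebraMap K _ q⁻¹, g))⟩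
  exact (h2.inv hc' (inv_ne_zero hq)).sub_const (inv_inv f).symm (inv_inv q).symm

/-- The points of a toric surface, which is a blowup of both `𝔽₁` and `𝔽₂`. -/
def toricPoints (K : Type u) [Field K] : Set (Subring (FunField K)) :=
  {R | (∃ a b : K, R = localRing (x K - algebraMap K _ a, y K - algebraMap K _ b)) ∨
    (∃ a : K, a ≠ 0 ∧ R = localRing (x K / y K - algebraMap K _ a, 1 / y K)) ∨
    (∃ b : K, R = localRing (1 / x K, y K - algebraMap K _ b)) ∨
    R = localRing (y K / x K, 1 / y K) ∨
    (∃ a : K, R = localRing (x K - algebraMap K _ a, 1 / y K)) ∨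
    (∃ a : K, R = localRing (x K ^ 2 / y K - algebraMap K _ a, 1 / x K)) ∨
    R = localRing (x K / y K, y K / x K ^ 2)}

theorem isCoord_ratio (a : K) : IsCoord (x K / y K - algebraMap K _ a, 1 / y K) := by
  simpa using isCoord_fiber (K := K) 1 a

theorem next_ratio_coe (a : K) : next (x K / y K, 1 / y K) (a : OnePoint K) =
    (x K - algebraMap K _ a, 1 / y K) := by
  have hy := y_ne_zero (K := K)
  simp only [next_coe]
  congr 2
  field_simp

theorem next_ratio_infty : next (x K / y K, 1 / y K) ∞ = (x K / y K, 1 / x K) := by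
  have hy := y_ne_zero (K := K)
  simp only [next_infty]
  congr 1
  field_simp

theorem next_next_ratio_coe (a : K) : next (x K / y K, 1 / x K) (a : OnePoint K) =
    (x K ^ 2 / y K - algebraMap K _ a, 1 / x K) := by
  have hx := x_ne_zero (K := K)
  simp only [next_coe]
  congr 2
  field_simp

theorem next_next_ratio_infty :
    next (x K / y K, 1 / x K) ∞ = (x K / y K, y K / x K ^ 2) := by
  have hx := x_ne_zero (K := K)
  simp only [next_infty]
  congr 1
  field_simp

/-- In `Bl(𝔽₁, [0, ∞, 1])`, the points `[0]` and `[0, ∞]` are torus-fixed, and their blowup is the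
toric surface. The remaining point is the one with `x ^ 2 / y = 1`. -/
theorem blowupPoints_one_eq :
    blowupPoints 1 [ptInf (0 : K) 1] =
      blow (toricPoints K) {(x K ^ 2 / y K - algebraMap K _ 1, 1 / x K)} := by
  have hx := x_ne_zero (K := K)
  have hy := y_ne_zero (K := K)
  have hc₁ : IsCoord (x K / y K, 1 / y K) := by simpa using isCoord_ratio (0 : K)
  have hc₂ : IsCoord (x K / y K, 1 / x K) := next_ratio_infty (K := K) ▸ hc₁.next ∞
  have hc₃ := next_next_ratio_coe (1 : K) ▸ hc₂.next (1 : K)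
  have e₁ : fiberPt 1 (0 : K) = (x K / y K, 1 / y K) := by simp [fiberPt]
  have e₂ : cuspPt 1 (0 : K) = (x K / y K, 1 / x K) := by rw [cuspPt, e₁, next_ratio_infty]
  have lt₁ : localRing (x K / y K, 1 / y K) < localRing (x K / y K, 1 / x K) :=
    next_ratio_infty (K := K) ▸ localRing_lt_next hc₁ ∞
  have lt₂ := fun q => localRing_lt_next hc₂ q
  have lt₃ := fun q => localRing_lt_next hc₃ q
  have lt₂' : localRing (x K / y K, 1 / x K) <
    localRing (x K ^ 2 / y K - algebraMap K _ 1, 1 / x K) := next_next_ratio_coe (1 : K) ▸ lt₂ _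
  have hset : ({fiberPt 1 0, cuspPt 1 0, next (cuspPt 1 0) (1 : K)} :
      Set (FunField K × FunField K)) = insert (x K ^ 2 / y K - algebraMap K _ 1, 1 / x K)
        {(x K / y K, 1 / y K), (x K / y K, 1 / x K)} := by
    rw [e₂, e₁, next_next_ratio_coe]
    ext c
    simp only [Set.mem_insert_iff, Set.mem_singleton_iff]
    tauto
  rw [blowupPoints_eq_blow, image_coords_ptInf, hset]
  refine blow_insert ?_ ?_ ?_ ?_ ?_
  · intro R hR
    rw [mem_hirzebruch_iff] at hR
    simp only [pow_one] at hR
    rcases hR with h | ⟨a, rfl⟩ | h | h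
    · exact Or.inl (Or.inl h)
    · by_cases ha : a = 0
      · exact Or.inr ⟨_, Or.inl rfl, by simp [ha]⟩
      · exact Or.inl (Or.inr (Or.inl ⟨a, ha, rfl⟩))
    · exact Or.inl (Or.inr (Or.inr (Or.inl h)))
    · exact Or.inl (Or.inr (Or.inr (Or.inr (Or.inl h))))
  · rintro c (rfl | rfl) q
    · induction q using OnePoint.rec with
      | infty => exact Or.inr ⟨_, Or.inr rfl, by rw [next_ratio_infty]⟩
      | coe q => exact Or.inl (Or.inr (Or.inr (Or.inr (Or.inr (Or.inl
          ⟨q, by rw [next_ratio_coe]⟩)))))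
    · induction q using OnePoint.rec with
      | infty => exact Or.inl (Or.inr (Or.inr (Or.inr (Or.inr (Or.inr (Or.inr
          (by rw [next_next_ratio_infty])))))))
      | coe q => exact Or.inl (Or.inr (Or.inr (Or.inr (Or.inr (Or.inr (Or.inl
          ⟨q, by rw [next_next_ratio_coe]⟩))))))
  · intro R hR
    rw [mem_hirzebruch_iff]
    simp only [pow_one]
    rcases hR with h | ⟨a, -, h⟩ | h | h | ⟨a, h⟩ | ⟨a, h⟩ | h
    · exact Or.inl (Or.inl h)
    · exact Or.inl (Or.inr (Or.inl ⟨a, h⟩))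
    · exact Or.inl (Or.inr (Or.inr (Or.inl h)))
    · exact Or.inl (Or.inr (Or.inr (Or.inr h)))
    · exact Or.inr ⟨_, Or.inl rfl, a, by rw [h, next_ratio_coe]⟩
    · exact Or.inr ⟨_, Or.inr rfl, a, by rw [h, next_next_ratio_coe]⟩
    · exact Or.inr ⟨_, Or.inr rfl, ∞, by rw [h, next_next_ratio_infty]⟩
  · have r₁ := reg_fst (x K / y K, 1 / y K)
    have r₁' : Reg (x K / y K, 1 / y K) (y K)⁻¹ 0 :=
      (reg_snd (x K / y K, 1 / y K)).congr (one_div _).symm rfl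
    have r₂ := reg_fst (x K / y K, 1 / x K)
    have r₂' : Reg (x K / y K, 1 / x K) (x K)⁻¹ 0 :=
      (reg_snd (x K / y K, 1 / x K)).congr (one_div _).symm rfl
    have r₂'' : Reg (x K / y K, 1 / x K) (y K)⁻¹ 0 :=
      (r₂.mul r₂').congr (by field_simp) (mul_zero 0).symm
    rintro R hR c (rfl | rfl)
    · rcases hR with ⟨a, b, rfl⟩ | ⟨a, ha, rfl⟩ | ⟨b, rfl⟩ | rfl | ⟨a, rfl⟩ | ⟨a, rfl⟩ | rfl
      · exact localRing_ne_of_inv (isCoord_x_y.sub_const a b) hc₁ hy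
          (reg_snd (x K - algebraMap K _ a, y K - algebraMap K _ b)).of_sub r₁'
      · exact localRing_ne (isCoord_ratio a) hc₁
          (reg_fst (x K / y K - algebraMap K _ a, 1 / y K)).of_sub r₁ (by simpa using ha)
      · exact localRing_ne_of_inv (isCoord_section_sub b) hc₁ hy
          (reg_snd (1 / x K, y K - algebraMap K _ b)).of_sub r₁'
      · exact localRing_ne_of_inv (by simpa using isCoord_corner (K := K) 1) hc₁
          (div_ne_zero hy hx) (reg_fst (y K / x K, 1 / y K)) (r₁.congr (inv_div _ _) rfl)
      · exact (next_ratio_coe a ▸ localRing_lt_next hc₁ a).ne'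
      · exact (next_next_ratio_coe a ▸ lt₁.trans (lt₂ a)).ne'
      · exact (next_next_ratio_infty (K := K) ▸ lt₁.trans (lt₂ ∞)).ne'
    · rcases hR with ⟨a, b, rfl⟩ | ⟨a, ha, rfl⟩ | ⟨b, rfl⟩ | rfl | ⟨a, rfl⟩ | ⟨a, rfl⟩ | rfl
      · exact localRing_ne_of_inv (isCoord_x_y.sub_const a b) hc₂ hx
          (reg_fst (x K - algebraMap K _ a, y K - algebraMap K _ b)).of_sub r₂'
      · exact localRing_ne (isCoord_ratio a) hc₂
          (reg_fst (x K / y K - algebraMap K _ a, 1 / y K)).of_sub r₂ (by simpa using ha)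
      · exact localRing_ne_of_inv (isCoord_section_sub b) hc₂ hy
          (reg_snd (1 / x K, y K - algebraMap K _ b)).of_sub r₂''
      · exact localRing_ne_of_inv (by simpa using isCoord_corner (K := K) 1) hc₂
          (div_ne_zero hy hx) (reg_fst (y K / x K, 1 / y K)) (r₂.congr (inv_div _ _) rfl)
      · exact localRing_ne_of_inv (next_ratio_coe a ▸ hc₁.next a) hc₂ hx
          (reg_fst (x K - algebraMap K _ a, 1 / y K)).of_sub r₂'
      · exact (next_next_ratio_coe a ▸ lt₂ a).ne'
      · exact (next_next_ratio_infty (K := K) ▸ lt₂ ∞).ne'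
  · rintro q c (rfl | rfl)
    · exact (lt₁.trans (lt₂'.trans (lt₃ q))).ne'
    · exact (lt₂'.trans (lt₃ q)).ne'

/-- The substitution which swaps the coordinates `x` and `y`. -/
def swapGL (K : Type u) [Field K] : GL (Fin 2) K :=
  Matrix.GeneralLinearGroup.mkOfDetNeZero !![0, 1; 1, 0] (by simp)

@[simp] theorem linAut_swapGL_x : linAut (swapGL K) (x K) = y K := by
  rw [linAut_x]
  simp [swapGL, Matrix.GeneralLinearGroup.mkOfDetNeZero]

@[simp] theorem linAut_swapGL_y : linAut (swapGL K) (y K) = x K := by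
  rw [linAut_y]
  simp [swapGL, Matrix.GeneralLinearGroup.mkOfDetNeZero]

theorem mem_mapRings_swapGL_hirzebruch {r : ℕ} {R : Subring (FunField K)} :
    R ∈ mapRings (swapGL K) (hirzebruch K r) ↔
      (∃ a b : K, R = localRing (y K - algebraMap K _ a, x K - algebraMap K _ b)) ∨
      (∃ a : K, R = localRing (y K / x K ^ r - algebraMap K _ a, 1 / x K)) ∨
      (∃ b : K, R = localRing (1 / y K, x K - algebraMap K _ b)) ∨
      R = localRing (x K ^ r / y K, 1 / x K) := by
  have key : ∀ c, (localRing c).map (linAut (swapGL K) : FunField K →+* FunField K) =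
      localRing (linAut (swapGL K) c.1, linAut (swapGL K) c.2) := fun c => map_localRing _ c
  constructor
  · rintro ⟨R, hR, rfl⟩
    rw [mem_hirzebruch_iff] at hR
    rcases hR with ⟨a, b, rfl⟩ | ⟨a, rfl⟩ | ⟨b, rfl⟩ | rfl
    · exact Or.inl ⟨a, b, by simp [key]⟩
    · exact Or.inr (Or.inl ⟨a, by simp [key]⟩)
    · exact Or.inr (Or.inr (Or.inl ⟨b, by simp [key]⟩))
    · exact Or.inr (Or.inr (Or.inr (by simp [key])))
  · rintro (⟨a, b, rfl⟩ | ⟨a, rfl⟩ | ⟨b, rfl⟩ | rfl)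
    · exact ⟨_, mem_hirzebruch_iff.2 (Or.inl ⟨a, b, rfl⟩), by simp [key]⟩
    · exact ⟨_, mem_hirzebruch_iff.2 (Or.inr (Or.inl ⟨a, rfl⟩)), by simp [key]⟩
    · exact ⟨_, mem_hirzebruch_iff.2 (Or.inr (Or.inr (Or.inl ⟨b, rfl⟩))), by simp [key]⟩
    · exact ⟨_, mem_hirzebruch_iff.2 (Or.inr (Or.inr (Or.inr rfl))), by simp [key]⟩

end Swap

/-! ### The toric surface as a blowup of the second Hirzebruch surface -/

section Toric

variable {K : Type u} [Field K]

theorem localRing_pair_swap {f g : FunField K} (h : IsCoord (f, g)) :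
    localRing (g, f) = localRing (f, g) := by
  have h' := localRing_swap h
  exact h'

theorem isCoord_corner_two : IsCoord (y K / x K ^ 2, 1 / x K) := by
  simpa [mapPair] using (isCoord_fiberPt 2 (0 : K)).map (linAut (swapGL K)) |>.of_mem
    fun E h1 h2 => by simpa [mapPair, fiberPt] using And.intro h1 h2

theorem next_corner_two_coe (a : K) : next (y K / x K ^ 2, 1 / x K) (a : OnePoint K) =
    (y K / x K - algebraMap K _ a, 1 / x K) := by
  have hx := x_ne_zero (K := K)
  simp only [next_coe]
  congr 2
  field_simp

theorem next_corner_two_infty :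
    next (y K / x K ^ 2, 1 / x K) ∞ = (y K / x K ^ 2, x K / y K) := by
  have hx := x_ne_zero (K := K)
  simp only [next_infty]
  congr 1
  field_simp

theorem next_inv_ratio_coe (a : K) : next (y K / x K, 1 / x K) (a : OnePoint K) =
    (y K - algebraMap K _ a, 1 / x K) := by
  have hx := x_ne_zero (K := K)
  simp only [next_coe]
  congr 2
  field_simp

theorem next_inv_ratio_infty :
    next (y K / x K, 1 / x K) ∞ = (y K / x K, 1 / y K) := by
  have hx := x_ne_zero (K := K)
  simp only [next_infty]
  congr 1
  field_simp

theorem localRing_inv_ratio {a : K} (ha : a ≠ 0) :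
    localRing (y K / x K - algebraMap K _ a⁻¹, 1 / x K) =
      localRing (x K / y K - algebraMap K _ a, 1 / y K) := by
  have hx := x_ne_zero (K := K)
  have hy := y_ne_zero (K := K)
  have hc := isCoord_ratio a
  have hc' : IsCoord (y K / x K - algebraMap K _ a⁻¹, 1 / x K) :=
    next_corner_two_coe a⁻¹ ▸ isCoord_corner_two.next _
  have h1 : Reg (x K / y K - algebraMap K _ a, 1 / y K) (y K / x K) a⁻¹ :=
    ((reg_fst (x K / y K - algebraMap K _ a, 1 / y K)).of_sub.inv hc (by simpa using ha)).congr
      (inv_div _ _).symm (by simp)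
  have h2 : Reg (y K / x K - algebraMap K _ a⁻¹, 1 / x K) (x K / y K) a :=
    ((reg_fst (y K / x K - algebraMap K _ a⁻¹, 1 / x K)).of_sub.inv hc'
      (by simpa using ha)).congr (inv_div _ _).symm (by simp)
  refine localRing_eq hc hc' (h1.sub_const rfl rfl) ?_ (h2.sub_const rfl rfl) ?_
  · exact (h1.mul (reg_snd (x K / y K - algebraMap K _ a, 1 / y K))).congr (by field_simp)
      (mul_zero _).symm
  · exact (h2.mul (reg_snd (y K / x K - algebraMap K _ a⁻¹, 1 / x K))).congr (by field_simp)
      (mul_zero _).symm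

theorem isCoord_x_one_div_y (a : K) : IsCoord (x K - algebraMap K _ a, 1 / y K) := by
  have h := (isCoord_ratio (0 : K)).next a
  rwa [map_zero, sub_zero, next_ratio_coe] at h

theorem isCoord_conic (a : K) : IsCoord (x K ^ 2 / y K - algebraMap K _ a, 1 / x K) := by
  have h := ((isCoord_ratio (0 : K)).next ∞).next (a : OnePoint K)
  rwa [map_zero, sub_zero, next_ratio_infty, next_next_ratio_coe] at h

theorem localRing_inv_conic {a : K} (ha : a ≠ 0) :
    IsCoord (y K / x K ^ 2 - algebraMap K _ a⁻¹, 1 / x K) ∧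
      localRing (y K / x K ^ 2 - algebraMap K _ a⁻¹, 1 / x K) =
        localRing (x K ^ 2 / y K - algebraMap K _ a, 1 / x K) := by
  have h := localRing_sub_inv ha (isCoord_conic a)
  rwa [inv_div] at h

/-- In `Bl(𝔽₂, [0, 0], [1])`, the points `[0]` and `[0, 0]` are torus-fixed, and their blowup is the
same toric surface with `x` and `y` exchanged. The remaining point is again the one with
`x ^ 2 / y = 1`. -/
theorem mapRings_swapGL_blowupPoints_two :
    mapRings (swapGL K) (blowupPoints 2 [zerosPt 1 0, pt 1]) =
      blow (toricPoints K) {(y K / x K ^ 2 - algebraMap K _ 1, 1 / x K)} := by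
  have hx := x_ne_zero (K := K)
  have hy := y_ne_zero (K := K)
  have hc₁ := isCoord_corner_two (K := K)
  have e₁ : next (y K / x K ^ 2, 1 / x K) ((0 : K) : OnePoint K) = (y K / x K, 1 / x K) := by
    rw [next_corner_two_coe, map_zero, sub_zero]
  have hc₂ : IsCoord (y K / x K, 1 / x K) := e₁ ▸ hc₁.next (0 : K)
  have hc₃ : IsCoord (y K / x K ^ 2 - algebraMap K _ 1, 1 / x K) := hc₁.sub_fst 1
  have lt₁ : localRing (y K / x K ^ 2, 1 / x K) < localRing (y K / x K, 1 / x K) :=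
    e₁ ▸ localRing_lt_next hc₁ (0 : K)
  have hset : mapPair (linAut (swapGL K)) '' ({fiberPt (2 - 1) 0, fiberPt 2 1} ∪
      {c | ∃ j < 1, c = fiberPt (2 - j) 0}) = insert (y K / x K ^ 2 - algebraMap K _ 1, 1 / x K)
        {(y K / x K ^ 2, 1 / x K), (y K / x K, 1 / x K)} := by
    have : {c | ∃ j < 1, c = fiberPt (2 - j) (0 : K)} = {fiberPt 2 0} := by
      ext c
      simp
    rw [this, Set.image_union, Set.image_pair, Set.image_singleton]
    simp only [mapPair, fiberPt, map_sub, map_div₀, map_pow, map_zero, map_one, sub_zero,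
      linAut_swapGL_x, linAut_swapGL_y, Nat.reduceSub, pow_one]
    ext c
    simp only [Set.mem_insert_iff, Set.mem_singleton_iff, Set.mem_union]
    tauto
  have r₁ := reg_fst (y K / x K ^ 2, 1 / x K)
  have r₁' : Reg (y K / x K ^ 2, 1 / x K) (x K)⁻¹ 0 :=
    (reg_snd (y K / x K ^ 2, 1 / x K)).congr (one_div _).symm rfl
  have r₂ := reg_fst (y K / x K, 1 / x K)
  have r₂' : Reg (y K / x K, 1 / x K) (x K)⁻¹ 0 :=
    (reg_snd (y K / x K, 1 / x K)).congr (one_div _).symm rfl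
  have r₂'' : Reg (y K / x K, 1 / x K) (y K / x K ^ 2) 0 :=
    (r₂.mul r₂').congr (by field_simp) (mul_zero 0).symm
  rw [blowupPoints_eq_blow, image_coords_zerosPt (by norm_num), mapRings_blow, hset]
  refine blow_insert ?_ ?_ ?_ ?_ ?_
  · intro R hR
    rcases mem_mapRings_swapGL_hirzebruch.1 hR with ⟨a, b, rfl⟩ | ⟨a, rfl⟩ | ⟨b, rfl⟩ | rfl
    · exact Or.inl (Or.inl ⟨b, a, localRing_pair_swap (isCoord_x_y.sub_const b a)⟩)
    · by_cases ha : a = 0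
      · exact Or.inr ⟨_, Or.inl rfl, by simp [ha]⟩
      · have h := (localRing_inv_conic (inv_ne_zero ha)).2
        rw [inv_inv] at h
        exact Or.inl (Or.inr (Or.inr (Or.inr (Or.inr (Or.inr (Or.inl ⟨_, h⟩))))))
    · have h' := localRing_pair_swap (isCoord_x_one_div_y b)
      exact Or.inl (Or.inr (Or.inr (Or.inr (Or.inr (Or.inl ⟨b, h'⟩)))))
    · exact Or.inl (Or.inr (Or.inr (Or.inr (Or.inr (Or.inr (Or.inl ⟨0, by simp⟩))))))
  · rintro c (rfl | rfl) q
    · induction q using OnePoint.rec with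
      | infty =>
        have h := localRing_pair_swap (f := y K / x K ^ 2) (g := x K / y K)
          (next_corner_two_infty (K := K) ▸ hc₁.next ∞)
        rw [next_corner_two_infty]
        exact Or.inl (Or.inr (Or.inr (Or.inr (Or.inr (Or.inr (Or.inr h.symm))))))
      | coe q =>
        rw [next_corner_two_coe]
        by_cases hq : q = 0
        · exact Or.inr ⟨_, Or.inr rfl, by simp [hq]⟩
        · have h := localRing_inv_ratio (inv_ne_zero hq)
          rw [inv_inv] at h
          exact Or.inl (Or.inr (Or.inl ⟨_, inv_ne_zero hq, h⟩))
    · induction q using OnePoint.rec with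
      | infty =>
        rw [next_inv_ratio_infty]
        exact Or.inl (Or.inr (Or.inr (Or.inr (Or.inl rfl))))
      | coe q =>
        have h := localRing_pair_swap (isCoord_section_sub q)
        rw [next_inv_ratio_coe]
        exact Or.inl (Or.inr (Or.inr (Or.inl ⟨q, h⟩)))
  · intro R hR
    rw [mem_mapRings_swapGL_hirzebruch]
    rcases hR with ⟨a, b, rfl⟩ | ⟨a, ha, rfl⟩ | ⟨b, rfl⟩ | rfl | ⟨a, rfl⟩ | ⟨a, rfl⟩ | rfl
    · exact Or.inl (Or.inl ⟨b, a, (localRing_pair_swap (isCoord_x_y.sub_const a b)).symm⟩)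
    · exact Or.inr ⟨_, Or.inl rfl, (a⁻¹ : K), by rw [next_corner_two_coe, localRing_inv_ratio ha]⟩
    · have h := localRing_pair_swap (isCoord_section_sub b)
      exact Or.inr ⟨_, Or.inr rfl, b, by rw [next_inv_ratio_coe]; exact h.symm⟩
    · exact Or.inr ⟨_, Or.inr rfl, ∞, by rw [next_inv_ratio_infty]⟩
    · have h' := localRing_pair_swap (isCoord_x_one_div_y a)
      exact Or.inl (Or.inr (Or.inr (Or.inl ⟨a, h'.symm⟩)))
    · by_cases ha : a = 0
      · exact Or.inl (Or.inr (Or.inr (Or.inr (by simp [ha]))))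
      · exact Or.inl (Or.inr (Or.inl ⟨a⁻¹, (localRing_inv_conic ha).2.symm⟩))
    · have h := localRing_pair_swap (f := y K / x K ^ 2) (g := x K / y K)
        (next_corner_two_infty (K := K) ▸ hc₁.next ∞)
      exact Or.inr ⟨_, Or.inl rfl, ∞, by rw [next_corner_two_infty]; exact h⟩
  · rintro R hR c (rfl | rfl)
    · rcases hR with ⟨a, b, rfl⟩ | ⟨a, ha, rfl⟩ | ⟨b, rfl⟩ | rfl | ⟨a, rfl⟩ | ⟨a, rfl⟩ | rfl
      · exact localRing_ne_of_inv (isCoord_x_y.sub_const a b) hc₁ hx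
          (reg_fst (x K - algebraMap K _ a, y K - algebraMap K _ b)).of_sub r₁'
      · rw [← localRing_inv_ratio ha, ← next_corner_two_coe]
        exact (localRing_lt_next hc₁ _).ne'
      · rw [← localRing_pair_swap (isCoord_section_sub b), ← next_inv_ratio_coe]
        exact (lt₁.trans (localRing_lt_next hc₂ _)).ne'
      · rw [← next_inv_ratio_infty]
        exact (lt₁.trans (localRing_lt_next hc₂ _)).ne'
      · exact localRing_ne_of_inv (isCoord_x_one_div_y a) hc₁ hx
          (reg_fst (x K - algebraMap K _ a, 1 / y K)).of_sub r₁'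
      · exact localRing_ne_of_inv (isCoord_conic a) hc₁ (div_ne_zero (pow_ne_zero 2 hx) hy)
          (reg_fst (x K ^ 2 / y K - algebraMap K _ a, 1 / x K)).of_sub (r₁.congr (inv_div _ _) rfl)
      · rw [localRing_pair_swap (next_corner_two_infty (K := K) ▸ hc₁.next ∞),
          ← next_corner_two_infty]
        exact (localRing_lt_next hc₁ _).ne'
    · rcases hR with ⟨a, b, rfl⟩ | ⟨a, ha, rfl⟩ | ⟨b, rfl⟩ | rfl | ⟨a, rfl⟩ | ⟨a, rfl⟩ | rfl
      · exact localRing_ne_of_inv (isCoord_x_y.sub_const a b) hc₂ hx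
          (reg_fst (x K - algebraMap K _ a, y K - algebraMap K _ b)).of_sub r₂'
      · exact localRing_ne_of_inv (isCoord_ratio a) hc₂ (div_ne_zero hx hy)
          (reg_fst (x K / y K - algebraMap K _ a, 1 / y K)).of_sub (r₂.congr (inv_div _ _) rfl)
      · rw [← localRing_pair_swap (isCoord_section_sub b), ← next_inv_ratio_coe]
        exact (localRing_lt_next hc₂ _).ne'
      · rw [← next_inv_ratio_infty]
        exact (localRing_lt_next hc₂ _).ne'
      · exact localRing_ne_of_inv (isCoord_x_one_div_y a) hc₂ hx
          (reg_fst (x K - algebraMap K _ a, 1 / y K)).of_sub r₂'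
      · exact localRing_ne_of_inv (isCoord_conic a) hc₂ (div_ne_zero (pow_ne_zero 2 hx) hy)
          (reg_fst (x K ^ 2 / y K - algebraMap K _ a, 1 / x K)).of_sub (r₂''.congr (inv_div _ _) rfl)
      · have h : IsCoord (x K / y K, y K / x K ^ 2) := by
          have h := ((isCoord_ratio (0 : K)).next ∞).next ∞
          rwa [map_zero, sub_zero, next_ratio_infty, next_next_ratio_infty] at h
        exact localRing_ne_of_inv h hc₂ (div_ne_zero hx hy)
          (reg_fst (x K / y K, y K / x K ^ 2)) (r₂.congr (inv_div _ _) rfl)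
  · rintro q c (rfl | rfl)
    · exact localRing_ne (hc₃.next q) hc₁ (Reg.next hc₃
        (reg_fst (y K / x K ^ 2 - algebraMap K _ 1, 1 / x K)).of_sub q) r₁ (by simp)
    · exact localRing_ne (hc₃.next q) hc₂ (Reg.next hc₃
        (reg_fst (y K / x K ^ 2 - algebraMap K _ 1, 1 / x K)).of_sub q) r₂'' (by simp)

end Toric

/-! ### The classification -/

section Classification

variable {K : Type u} [Field K]

/-- A linear substitution takes the closed points of `Bl(𝔽_r, ps)` to those of `Bl(𝔽_r', ps')`. -/
def LinRel (r : ℕ) (ps : List (CoordSeq K)) (r' : ℕ) (ps' : List (CoordSeq K)) : Prop :=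
  ∃ M : GL (Fin 2) K, mapRings M (blowupPoints r ps) = blowupPoints r' ps'

theorem LinRel.symm {r r' : ℕ} {ps ps' : List (CoordSeq K)} (h : LinRel r ps r' ps') :
    LinRel r' ps' r ps := by
  obtain ⟨M, hM⟩ := h
  exact ⟨M⁻¹, ((mapRings_eq_iff _ _ _).1 hM).symm⟩

theorem LinRel.trans {r r' r'' : ℕ} {ps ps' ps'' : List (CoordSeq K)} (h : LinRel r ps r' ps')
    (h' : LinRel r' ps' r'' ps'') : LinRel r ps r'' ps'' := by
  obtain ⟨M, hM⟩ := h
  obtain ⟨N, hN⟩ := h'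
  exact ⟨M * N, by rw [mapRings_mul, hM, hN]⟩

theorem LinRel.isoBl [CharZero K] {S : GaSurface K} {r r' : ℕ} {ps ps' : List (CoordSeq K)}
    (h : LinRel r ps r' ps') (hS : S.IsoBl r ps) : S.IsoBl r' ps' :=
  (GaSurface.isoBl_iff_of_isoBl hS).2 h

theorem linRel_zerosPt {r k : ℕ} (hk : k + 1 ≤ r) {q₁ q₂ p₁ p₂ α δ : K} (β : K) (hα : α ≠ 0)
    (hδ : δ ≠ 0) (h₁ : α * p₁ + β * 0 ^ (r - k - 1) = δ ^ (r - k) * q₁)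
    (h₂ : α * p₂ + β * 0 ^ (r - 1) = δ ^ r * q₂) :
    LinRel r [zerosPt k q₁, pt q₂] r [zerosPt k p₁, pt p₂] := by
  obtain ⟨M, hM⟩ := exists_isTri hα β hδ
  exact ⟨M, hM.mapRings_zerosPt hk h₁ h₂⟩

theorem blowupPoints_pair_comm (r : ℕ) (p p' : CoordSeq K) :
    blowupPoints r [p, p'] = blowupPoints r [p', p] := by
  have : blownUp [p, p'] = blownUp [p', p] := by
    ext s
    rw [mem_blownUp_pair, mem_blownUp_pair, or_comm]
  rw [blowupPoints, blowupPoints, this]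

theorem near_refl {c : FunField K × FunField K} (hc : IsCoord c) : Near c c := by
  have := near_scale hc (one_ne_zero (α := K)) one_ne_zero
  simpa [scale] using this

/-- On `𝔽₁`, the shear `x ↦ x + β y` translates the points of the fiber. -/
theorem linRel_shear_one (q β w : K) : LinRel 1 [ptInf (q + β) w] 1 [ptInf q w] := by
  obtain ⟨M, hM⟩ := exists_isTri (K := K) one_ne_zero β one_ne_zero
  have e0 : mapPair (linAut M) (fiberPt 1 (q + β)) = fiberPt 1 q := by
    have hy := y_ne_zero (K := K)
    simp only [mapPair, fiberPt, map_sub, map_div₀, hM.map_x, hM.map_y, map_one,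
      one_mul, pow_one, AlgEquiv.commutes, map_add]
    congr 1
    field_simp
    ring
  have n0 : Near (fiberPt 1 q) (mapPair (linAut M) (fiberPt 1 (q + β))) :=
    e0.symm ▸ near_refl (isCoord_fiberPt 1 q)
  have n1 : Near (cuspPt 1 q) (mapPair (linAut M) (cuspPt 1 (q + β))) := by
    rw [cuspPt, cuspPt, mapPair_next, e0]
    exact near_refl (isCoord_cuspPt 1 q)
  have n2 : Near (next (cuspPt 1 q) (w : OnePoint K))
      (mapPair (linAut M) (next (cuspPt 1 (q + β)) (w : OnePoint K))) := by
    rw [cuspPt, cuspPt, mapPair_next, mapPair_next, e0]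
    exact near_refl ((isCoord_cuspPt 1 q).next w)
  refine ⟨M, mapRings_blowupPoints hM le_rfl ?_ ?_⟩ <;>
    rw [image_coords_ptInf, image_coords_ptInf]
  · rintro _ (rfl | rfl | rfl)
    exacts [⟨_, Or.inl rfl, n0⟩, ⟨_, Or.inr (Or.inl rfl), n1⟩, ⟨_, Or.inr (Or.inr rfl), n2⟩]
  · rintro _ (rfl | rfl | rfl)
    exacts [⟨_, Or.inl rfl, n0⟩, ⟨_, Or.inr (Or.inl rfl), n1⟩, ⟨_, Or.inr (Or.inr rfl), n2⟩]

/-- The surfaces `Bl(𝔽₂, [0, 0], [1])` and `Bl(𝔽₁, [0, ∞, 1])` are blowups of one and the same point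
of the toric surface, in the local coordinates `y / x ^ 2 - 1` and `x ^ 2 / y - 1`, respectively. -/
theorem linRel_two_one : LinRel 2 [zerosPt 1 (0 : K), pt 1] 1 [ptInf 0 1] := by
  refine ⟨swapGL K, ?_⟩
  rw [mapRings_swapGL_blowupPoints_two, blowupPoints_one_eq]
  have hx := x_ne_zero (K := K)
  have hy := y_ne_zero (K := K)
  have hc := isCoord_conic (1 : K)
  have hinv := localRing_inv_conic (one_ne_zero (α := K))
  rw [inv_one] at hinv
  -- with `t = x ^ 2 / y`, the identity `1 / t - 1 = - (1 / t) (t - 1)`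
  have hA := ((reg_fst (x K ^ 2 / y K - algebraMap K _ 1, 1 / x K)).of_sub.inv hc
    (by simp)).neg
  have h : Near (x K ^ 2 / y K - algebraMap K _ 1, 1 / x K)
      (y K / x K ^ 2 - algebraMap K _ 1, 1 / x K) := by
    refine ⟨_, _, _, hc, hinv.1, hinv.2.symm, ?_, one_ne_zero, _, _, _, hA,
      (reg_const _ 0).congr (map_zero _).symm rfl, reg_one _, ?_, (one_mul _).symm⟩
    · simp
    · simp only [map_one]
      field_simp
      ring
  refine blow_congr ?_ ?_
  · rintro _ rfl
    exact ⟨_, rfl, h.symm⟩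
  · rintro _ rfl
    exact ⟨_, rfl, h.symm⟩

/-- The surfaces `Bl(𝔽₁, [1, ∞, 1])` and `Bl(𝔽₂, [0, 1], [1])` are isomorphic. -/
theorem linRel_one_two : LinRel 1 [ptInf (1 : K) 1] 2 [zerosPt 1 1, pt 1] := by
  have h1 : LinRel 1 [ptInf (1 : K) 1] 1 [ptInf 0 1] := by
    simpa using linRel_shear_one (0 : K) 1 1
  refine h1.trans (linRel_two_one.symm.trans ?_)
  exact linRel_zerosPt le_rfl (α := 1) (δ := 1) (-1) one_ne_zero one_ne_zero (by simp) (by simp)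

namespace NormalForm

theorem exists_linRel_caseA [IsAlgClosed K] {r k : ℕ} {q₁ q₂ : K} (hk : k + 1 ≤ r)
    (h₁ : k + 1 < r → q₁ ≠ 0) (h₂ : k = 0 → q₂ ≠ q₁) (h₃ : 0 < k → q₂ ≠ 0) :
    ∃ e : NormalForm K, e.Valid ∧ LinRel r [zerosPt k q₁, pt q₂] e.r e.pts := by
  rcases Nat.eq_zero_or_pos k with rfl | hk0
  · rcases Nat.lt_or_ge 1 r with hr | hr
    · -- scale `x` such that `[q₁]` becomes `[1]`
      have hq₁ := h₁ hr
      refine ⟨ii r (q₂ / q₁), ⟨hr, fun h => h₂ rfl ((div_eq_one_iff_eq hq₁).1 h)⟩, ?_⟩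
      refine linRel_zerosPt hk (α := q₁) (δ := 1) 0 hq₁ one_ne_zero (by simp) ?_
      field_simp
      ring
    · -- on `𝔽₁`, all affine transformations of the fiber are available
      obtain rfl : r = 1 := by omega
      refine ⟨i, trivial, ?_⟩
      exact linRel_zerosPt le_rfl (α := q₂ - q₁) (δ := 1) q₁ (sub_ne_zero.2 (h₂ rfl)) one_ne_zero
        (by simp) (by simp)
  · have hq₂ := h₃ hk0
    refine ⟨iii r k, ⟨by omega, hk0, hk⟩, ?_⟩
    rcases hk.lt_or_eq with hkr | rfl
    · -- scale `x` by `α` and `y` by `δ`: both points become `1` if `δ ^ k = q₁ / q₂`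
      obtain ⟨δ, hδ⟩ := IsAlgClosed.exists_pow_nat_eq (q₁ / q₂) hk0
      have hδ0 : δ ≠ 0 := by
        rintro rfl
        rw [zero_pow hk0.ne'] at hδ
        exact div_ne_zero (h₁ hkr) hq₂ hδ.symm
      refine linRel_zerosPt hk (α := δ ^ r * q₂) (δ := δ) 0
        (mul_ne_zero (pow_ne_zero r hδ0) hq₂) hδ0 ?_ (by ring)
      have : δ ^ r = δ ^ (r - k) * δ ^ k := by rw [← pow_add]; congr 1; omega
      rw [this, hδ]
      field_simp
      ring
    · -- for `k = r - 1`, a shear moves the last point freely and keeps `[q₂]` fixed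
      refine linRel_zerosPt le_rfl (α := q₂) (δ := 1) (q₁ - q₂) hq₂ one_ne_zero ?_ ?_
      · simp
      · simp [hk0.ne']

theorem exists_linRel_caseC [CharZero K] {r : ℕ} {w q : K} (hr : 1 < r) (hw : w ≠ 0) :
    ∃ e : NormalForm K, e.Valid ∧ LinRel r [ptInf' 0 w q] e.r e.pts := by
  have h : ∀ {a d : K} (p : K), a ≠ 0 → d ≠ 0 → a / d = w → w / d * p = q →
      LinRel r [ptInf' 0 w q] r [ptInf' 0 1 p] := by
    rintro a d p ha hd rfl rfl
    obtain ⟨M, -, hM⟩ := mapRings_ptInf hr.le ha hd 0 1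
    have := hM p
    rw [mul_zero, mul_one] at this
    exact ⟨M, this⟩
  rcases Nat.lt_or_ge 2 r with hr2 | hr2
  · by_cases hq : q = 0
    · exact ⟨iv r, hr, h 0 hw one_ne_zero (div_one w) (by rw [mul_zero, hq])⟩
    · exact ⟨v r, hr2, h (a := w ^ 2 / q) (d := w / q) 1 (by positivity) (by positivity)
        (by field_simp) (by field_simp)⟩
  · -- on `𝔽₂`, a shear makes the last coordinate zero
    obtain rfl : r = 2 := by omega
    refine ⟨iv 2, le_refl 2, (h (q / w) hw one_ne_zero (div_one w) (by field_simp)).trans ?_⟩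
    obtain ⟨M, hM⟩ := mapRings_shear_two (q / w / 2) 0
    rw [zero_add, mul_div_cancel₀ _ two_ne_zero] at hM
    exact ⟨M, hM⟩

theorem exists_linRel_caseE {r : ℕ} {q w : K} (hr : 1 ≤ r) (hq : q ≠ 0) (hw : w ≠ 0) :
    ∃ e : NormalForm K, e.Valid ∧ LinRel r [ptInf q w] e.r e.pts := by
  have h : LinRel r [ptInf q w] r [ptInf 1 1] := by
    obtain ⟨M, hM, -⟩ := mapRings_ptInf hr hq (div_ne_zero hq hw) 1 1
    rw [mul_one, mul_one, div_div_cancel₀ hq] at hM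
    exact ⟨M, hM⟩
  rcases Nat.lt_or_ge 1 r with hr1 | hr1
  · exact ⟨vi r, hr1, h⟩
  · obtain rfl : r = 1 := by omega
    exact ⟨iii 2 1, ⟨le_rfl, le_rfl, le_rfl⟩, h.trans linRel_one_two⟩

theorem linRel_of_same {e e' : NormalForm K} (he : e.Valid) (h : e.Same e') :
    LinRel e.r e.pts e'.r e'.pts := by
  rcases h with rfl | ⟨r, q, hq, rfl, rfl⟩
  · exact ⟨1, mapRings_one _⟩
  · have hr : 2 ≤ r := he.1
    change LinRel r [pt 1, pt q] r [pt 1, pt q⁻¹]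
    have h1 : LinRel r [pt 1, pt q] r [pt q⁻¹, pt 1] :=
      linRel_zerosPt (k := 0) (by omega) (α := q) (δ := 1) 0 hq one_ne_zero (by simp [hq])
        (by simp)
    rwa [LinRel, blowupPoints_pair_comm r (pt q⁻¹)] at h1

/-- A surface that is isomorphic to a normal form is isomorphic to no other one. -/
theorem isIso_iff_same [CharZero K] {S : GaSurface K} {e : NormalForm K} (he : e.Valid)
    (hS : S.IsoBl e.r e.pts) {e' : NormalForm K} (he' : e'.Valid) : e'.IsIso S ↔ e.Same e' := by
  rw [isIso_iff, GaSurface.isoBl_iff_of_isoBl hS]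
  exact ⟨fun ⟨_, hM⟩ => Same.of_mapRings_eq he he' hM, linRel_of_same he⟩

end NormalForm

end Classification

end GaSurfaces

end

theorem proposition5p5 {K : Type u} [Field K] [IsAlgClosed K] [CharZero K] :
    (∀ S : GaSurfaces.GaSurface K, (S.IsCaseA ∨ S.IsCaseC ∨ S.IsCaseE) →
      ∃ e : GaSurfaces.NormalForm K, e.Valid ∧
        ∀ e' : GaSurfaces.NormalForm K, e'.Valid → (e'.IsIso S ↔ e.Same e')) ∧
    (∀ S : GaSurfaces.GaSurface K,
      S.IsoBl 1 [GaSurfaces.ptInf 1 1] ↔ S.IsoBl 2 [GaSurfaces.zerosPt 1 1, GaSurfaces.pt 1]) := by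
  refine ⟨fun S hS => ?_, fun S => ⟨GaSurfaces.linRel_one_two.isoBl,
    GaSurfaces.linRel_one_two.symm.isoBl⟩⟩
  obtain ⟨r, ps, hS, e, he, hrel⟩ : ∃ r ps, S.IsoBl r ps ∧
      ∃ e : GaSurfaces.NormalForm K, e.Valid ∧ GaSurfaces.LinRel r ps e.r e.pts := by
    rcases hS with ⟨r, k, q₁, q₂, -, hk, h₁, h₂, h₃, hS⟩ | ⟨r, w, q, hr, hw, hS⟩ |
        ⟨r, q, w, hr, hq, hw, hS⟩
    · exact ⟨r, _, hS, GaSurfaces.NormalForm.exists_linRel_caseA hk h₁ h₂ h₃⟩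
    · exact ⟨r, _, hS, GaSurfaces.NormalForm.exists_linRel_caseC hr hw⟩
    · exact ⟨r, _, hS, GaSurfaces.NormalForm.exists_linRel_caseE hr hq hw⟩
  exact ⟨e, he, fun e' he' => GaSurfaces.NormalForm.isIso_iff_same he (hrel.isoBl hS) he'⟩
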